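/- **Setting.** Let $K$ be a field, $d_1,\dots,d_k\ge 0$ integers, and let $S$ be the rational normal scroll given by the $2\times 2$ minors $f_{\alpha\beta}=z_\alpha z_{\beta+1}-z_{\alpha+1}z_\beta$ of the matrix with columns $(z_\alpha,z_{\alpha+1})=(z^{(i)}_j,z^{(i)}_{j+1})$, $1\le i\le k$, $0\le j<d_i$. It is parametrised by $z^{(i)}_j=z^{(i)}s^{d_i-j}t^j$, where $(s:t;z^{(1)}:\dots:z^{(k)})$ are the coordinates on a projective bundle $\widetilde S$ over $\mathbb P^1$. Let $P^{(1)},\dots,P^{(l)}$, $l\le k$, be equations of divisors of type $2H-b_nR$ ($b_n\ge 0$) forming a complete intersection on $\widetilde S$; that is, $P^{(n)}$ is quadratic in the $z^{(i)}$ and of total degree $-b_n$, where $z^{(i)}$ has weight $-d_i$ and $s,t$ have weight $1$; write $p^{(n)}_{\delta_i+\delta_{i'},j}$ for the coefficient of $s^{d_i+d_{i'}-b_n-j}t^jz^{(i)}z^{(i')}$ in $P^{(n)}$. Let $P^{(n)}_m(z)$, $0\le m\le b_n$, be quadratic forms in the $z^{(i)}_j$ that restrict to $s^{b_n-m}t^mP^{(n)}$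 on the scroll and are obtained by rolling factors: $P^{(n)}_m=\sum_\alpha p^{(n)}_{\alpha,m}z_\alpha$ and $P^{(n)}_{m+1}=\sum_\alpha p^{(n)}_{\alpha,m}z_{\alpha+1}$ for $0\le m<b_n$, with linear forms $p^{(n)}_{\alpha,m}$ in the $z$-variables. Let $X$ be the affine cone defined by the $f_{\alpha\beta}$ and all $P^{(n)}_m$. Let $\zeta^{(i)}_j$ ($0<j<d_i$) be variables, put $\zeta^{(i)}_0=\zeta^{(i)}_{d_i}=0$, and deform the scroll to the scroll with columns $(z_\alpha,z_{\alpha+1}+\zeta_{\alpha+1})$. Let $\rho^{(n,i)}_j$ ($1\le n\le l$, $1\le i\le k$, $0\le j\le d_i-b_n$) be further variables. Let $L\subset K[\zeta,\rho]$ be the ideal generated by the *lifting conditions*: for all $n$, all $i$ and all $r$ with $0<r<b_n-d_i$, $$\sum_{i'=1}^k\ \sum_{j=0}^{d_i+d_{i'}-b_n}(1+\delta_{ii'})\,p^{(n)}_{\delta_i+\delta_{i'},j}\,\zeta^{(i')}_{j+r}=0,$$ where the factor $1+\delta_{ii'}$ is $2$ if $i=i'$ and $1$ otherwise. Let $$P'^{(n)}_m(z,\zeta,\rho)=Q^{(n)}_m(z,\zeta)+\sum_{i}\sum_{j=0}^{d_i-b_n}\rho^{(n,i)}_j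 z^{(i)}_{j+m}\qquad(0\le m\le b_n),$$ where the $Q^{(n)}_m$ are bilinear over $K$ in $z$ and $\zeta$ and are a first-order lift of the deformation of the scroll: on the scroll, and modulo $L$, $$sQ^{(n)}_{m+1}-tQ^{(n)}_m=s\sum_\alpha p^{(n)}_{\alpha,m}\zeta_{\alpha+1}\qquad(0\le m<b_n).$$ Put $\mathfrak m=(\zeta,\rho)\subset K[\zeta,\rho]$. The *infinitesimal deformation defined by the $P'^{(n)}_m$* is the one over $K[\zeta,\rho]/(L+\mathfrak m^2)$ given by the minors of the deformed scroll matrix and the $P^{(n)}_m+P'^{(n)}_m$. For an ideal $J$ with $L\subset J\subset L+\mathfrak m^2$, an *extension over $K[\zeta,\rho]/J$* is an ideal of $(K[\zeta,\rho]/J)[z]$ with quotient flat over $K[\zeta,\rho]/J$ which reduces to the ideal of the infinitesimal deformation modulo $L+\mathfrak m^2$. It is *graded* if it is the image of an ideal of $K[\zeta,\rho][z]$ that is homogeneous for the grading in which all variables $z,\zeta,\rho$ have degree $1$. **Proposition 3.2.** The maximal extension of the infinitesimal deformation defined by the $P'^{(n)}_m$ lives over the base given, inside the linear space of the lifting conditions,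 by the $\sum_n\max(b_n-1,0)$ base equations $$P'^{(n)}_m(\zeta,\zeta,\rho)-P^{(n)}_m(\zeta)=0,\qquad 1\le n\le l,\quad 1\le m\le b_n-1 .$$ Precisely, let $\mathfrak a\subset K[\zeta,\rho]$ be the ideal generated by $L$ and the left hand sides of the base equations. Then $\mathfrak a$ is the smallest homogeneous ideal $J$ such that there is a graded extension over $K[\zeta,\rho]/J$. Moreover, if there is an extension (graded or not) over $K[\zeta,\rho]/J$ for an arbitrary ideal $J$ with $L\subset J\subset L+\mathfrak m^2$, then $\mathfrak a\subset J+\mathfrak m^3$. -/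

import Mathlib

open MvPolynomial

noncomputable section

namespace RollingFactors

/-! ### Families of affine schemes -/

/-- Base change, along a ring homomorphism `A → R`, of the family with ideal `I ⊆ A[z]`. -/
def restrict {A R σ : Type*} [CommRing A] [CommRing R] (φ : A →+* R)
    (I : Ideal (MvPolynomial σ A)) : Ideal (MvPolynomial σ R) :=
  I.map (map φ)

/-- The base change along `A → R` of the family with ideal `I ⊆ A[z]` is flat over `R`. -/
def IsFlatFamily {A R σ : Type*} [CommRing A] [CommRing R] (φ : A →+* R)
    (I : Ideal (MvPolynomial σ A)) : Prop :=
  Module.Flat R (MvPolynomial σ R ⧸ restrict φ I)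

/-- The ideal `I` of `K[σ]` is homogeneous for the standard grading. -/
def IsHomogeneousIdeal {K σ : Type*} [CommRing K] (I : Ideal (MvPolynomial σ K)) : Prop :=
  letI := MvPolynomial.gradedAlgebra (σ := σ) (R := K)
  I.IsHomogeneous (homogeneousSubmodule σ K)

/-! ### The scroll -/

/-- The coordinates `z^(i)_j` (`0 ≤ j ≤ d i`) of the projective space containing the scroll of type
`d = (d 0, …, d (k-1))`. -/
abbrev ZVar {k : ℕ} (d : Fin k → ℕ) : Type := (i : Fin k) × Fin (d i + 1)

/-- The columns `α = (z^(i)_j, z^(i)_{j+1})` (`0 ≤ j < d i`) of the scroll matrix. -/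
abbrev Col {k : ℕ} (d : Fin k → ℕ) : Type := (i : Fin k) × Fin (d i)

/-- The index of the entry `z_α` in the top row of the column `α`. -/
def Col.top {k : ℕ} {d : Fin k → ℕ} (α : Col d) : ZVar d := ⟨α.1, α.2.castSucc⟩

/-- The index of the entry `z_{α+1}` in the bottom row of the column `α`. -/
def Col.bot {k : ℕ} {d : Fin k → ℕ} (α : Col d) : ZVar d := ⟨α.1, α.2.succ⟩

/-- The bihomogeneous coordinates `s, t, z^(1), …, z^(k)` of the projective bundle over `ℙ¹`
whose image is the scroll. -/
abbrev CoxVar (k : ℕ) : Type := Fin 2 ⊕ Fin k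

/-- The coordinate `s`. -/
def sVar (k : ℕ) : CoxVar k := Sum.inl 0

/-- The coordinate `t`. -/
def tVar (k : ℕ) : CoxVar k := Sum.inl 1

/-- The substitution `z^(i)_j = z^(i) s^{d i - j} t^j`, over any coefficient ring. -/
def toCox (R : Type*) [CommRing R] {k : ℕ} (d : Fin k → ℕ) :
    MvPolynomial (ZVar d) R →ₐ[R] MvPolynomial (CoxVar k) R :=
  aeval fun z => X (Sum.inr z.1) * X (sVar k) ^ (d z.1 - (z.2 : ℕ)) * X (tVar k) ^ (z.2 : ℕ)

/-- `P(s, t, z^(i))` is the equation of a divisor in `|2H - bR|`: it is quadratic in the `z^(i)`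
and has total degree `-b`, where `s, t` have weight `1` and `z^(i)` has weight `-d i`. -/
def IsDivisorEquation {K : Type*} [Field K] {k : ℕ} (d : Fin k → ℕ) (b : ℕ)
    (P : MvPolynomial (CoxVar k) K) : Prop :=
  IsWeightedHomogeneous (Sum.elim (fun _ => 0) (fun _ => 1) : CoxVar k → ℕ) P 2 ∧
  IsWeightedHomogeneous (Sum.elim (fun _ => 1) (fun i => -(d i : ℤ)) : CoxVar k → ℤ) P (-(b : ℤ))

/-- The equations `P_1, …, P_l` cut out a complete intersection: they form a regular sequence
over each of the two charts `s ≠ 0` and `t ≠ 0` of `ℙ¹`.  As the rings are Cohen-Macaulay and the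
zero section `z = 0` has codimension `k`, this says that `l ≤ k` and that the equations form
a regular sequence in each local ring of their common zero scheme in the projective bundle
(equivalently, that this scheme is empty or has codimension `l`). -/
def IsCompleteIntersection {K : Type*} [Field K] {k l : ℕ}
    (P : Fin l → MvPolynomial (CoxVar k) K) : Prop :=
  RingTheory.Sequence.IsWeaklyRegular
    (Localization.Away (X (sVar k) : MvPolynomial (CoxVar k) K)) (List.ofFn P) ∧
  RingTheory.Sequence.IsWeaklyRegular
    (Localization.Away (X (tVar k) : MvPolynomial (CoxVar k) K)) (List.ofFn P)

/-! ### The additional equations -/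

/-- A complete intersection of divisors of type `2H - (b n) R`, `n = 1, …, l`, on the scroll of
type `d`, with additional equations `P^(n)_m` (`0 ≤ m ≤ b n`) obtained by rolling factors. -/
structure QuadricSystem (K : Type*) [Field K] (k l : ℕ) where
  /-- the degrees of the scroll -/
  d : Fin k → ℕ
  /-- the `n`-th divisor is of type `2H - (b n) R` -/
  b : Fin l → ℕ
  /-- the equations on the scroll -/
  P : Fin l → MvPolynomial (CoxVar k) K
  isDivisorEquation : ∀ n, IsDivisorEquation d (b n) (P n)
  isCompleteIntersection : IsCompleteIntersection P
  /-- the additional equations `P^(n)_m` -/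
  eqn : Fin l → ℕ → MvPolynomial (ZVar d) K
  /-- the coefficients `p^(n)_{α,m}` by which one rolls from `P^(n)_m` to `P^(n)_{m+1}` -/
  roll : Fin l → ℕ → Col d → MvPolynomial (ZVar d) K
  eqn_homogeneous : ∀ n m, m ≤ b n → (eqn n m).IsHomogeneous 2
  roll_homogeneous : ∀ n m α, m < b n → (roll n m α).IsHomogeneous 1
  toCox_eqn : ∀ n m, m ≤ b n →
    toCox K d (eqn n m) = X (sVar k) ^ (b n - m) * X (tVar k) ^ m * P n
  eqn_eq : ∀ n m, m < b n → eqn n m = ∑ α, roll n m α * X α.top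
  eqn_succ : ∀ n m, m < b n → eqn n (m + 1) = ∑ α, roll n m α * X α.bot

namespace QuadricSystem

variable {K : Type*} [Field K] {k l : ℕ} (D : QuadricSystem K k l)

/-! ### The deformation variables -/

/-- Indices of the deformation variables `ζ^(i)_j`, `0 < j < d i`, of the scroll: the pair `(i, j)`
stands for `ζ^(i)_{j+1}`. -/
abbrev ZetaIdx : Type := (i : Fin k) × Fin (D.d i - 1)

/-- Indices of the variables `ρ^(n,i)_j`, `0 ≤ j ≤ d i - b n`, of the pure rolling factors
deformations. -/
abbrev RhoIdx : Type := (n : Fin l) × (i : Fin k) × Fin (D.d i + 1 - D.b n)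

/-- The ring `K[ζ, ρ]`. -/
abbrev Base : Type _ := MvPolynomial (D.ZetaIdx ⊕ D.RhoIdx) K

/-- The variable `ζ^(i)_j`; in particular `ζ^(i)_0 = ζ^(i)_{d i} = 0`. -/
def zeta (i : Fin k) (j : ℕ) : D.Base :=
  if h : 0 < j ∧ j < D.d i then X (Sum.inl ⟨i, ⟨j - 1, by omega⟩⟩) else 0

/-- The point `z = ζ`, that is `z^(i)_j = ζ^(i)_j`. -/
def zetaPt (z : ZVar D.d) : D.Base := D.zeta z.1 z.2

/-- The coefficient `p^(n)_{δ_i+δ_i',j}` of `s^{d i + d i' - b n - j} t^j z^(i) z^(i')` in `P^(n)`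
(where `b n + j ≤ d i + d i'`). -/
def coef (n : Fin l) (i i' : Fin k) (j : ℕ) : K :=
  (D.P n).coeff (Finsupp.single (sVar k) (D.d i + D.d i' - D.b n - j) +
    Finsupp.single (tVar k) j + Finsupp.single (Sum.inr i) 1 + Finsupp.single (Sum.inr i') 1)

/-- The left hand side of the linear lifting equation of `P^(n)` with indices `I = δ_i` and `r`. -/
def liftingForm (n : Fin l) (i : Fin k) (r : ℕ) : D.Base :=
  ∑ i' : Fin k, ∑ j ∈ Finset.range (D.d i + D.d i' + 1 - D.b n),
    C ((if i' = i then 2 else 1) * D.coef n i i' j) * D.zeta i' (j + r)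

/-- The ideal of `K[ζ, ρ]` generated by the lifting conditions, `0 < r < b n - d i`. -/
def liftingIdeal : Ideal D.Base :=
  Ideal.span {g | ∃ n i r, 0 < r ∧ r + D.d i < D.b n ∧ g = D.liftingForm n i r}

/-- The ideal of the origin in `K[ζ, ρ]`. -/
def originIdeal : Ideal D.Base := Ideal.span (Set.range X)

/-! ### Perturbations of the equations -/

/-- The bilinear form `∑ q z v · ζ_v · z` in the `z`-variables and the `ζ`-variables. -/
def bilin (q : ZVar D.d → D.ZetaIdx → K) : MvPolynomial (ZVar D.d) D.Base :=
  ∑ z, C (∑ v, C (q z v) * X (Sum.inl v)) * X z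

/-- The coordinate `z^(i)_j`, for `j ≤ d i`. -/
def zCoord (i : Fin k) (j : ℕ) : MvPolynomial (ZVar D.d) D.Base :=
  if h : j < D.d i + 1 then X ⟨i, ⟨j, h⟩⟩ else 0

/-- The pure rolling factors perturbation `∑ ρ^(n,i)_j z^(i)_{j+m}` of `P^(n)_m`. -/
def purePart (n : Fin l) (m : ℕ) : MvPolynomial (ZVar D.d) D.Base :=
  ∑ i : Fin k, ∑ j : Fin (D.d i + 1 - D.b n),
    C (X (Sum.inr ⟨n, i, j⟩)) * D.zCoord i (j + m)

/-- First order perturbations of the additional equations, compatible with the deformation `ζ` of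
the scroll whenever the lifting conditions are satisfied: the bilinear forms `Q^(n)_m(z, ζ)` satisfy
`s Q_{m+1} - t Q_m = s ∑_α p_{α,m} ζ_{α+1}` on the scroll, modulo the lifting conditions. -/
structure FirstOrderLift where
  /-- the coefficients of the `Q^(n)_m` -/
  q : Fin l → ℕ → ZVar D.d → D.ZetaIdx → K
  lift : ∀ n m, m < D.b n →
    X (sVar k) * toCox D.Base D.d (D.bilin (q n (m + 1)))
      - X (tVar k) * toCox D.Base D.d (D.bilin (q n m))
      - X (sVar k) * toCox D.Base D.d
          (∑ α : Col D.d, map C (D.roll n m α) * C (D.zetaPt α.bot))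
      ∈ D.liftingIdeal.map (C : D.Base →+* MvPolynomial (CoxVar k) D.Base)

variable {D}

/-- The perturbation `P'^(n)_m(z, ζ, ρ)` of `P^(n)_m`. -/
def FirstOrderLift.pert (F : D.FirstOrderLift) (n : Fin l) (m : ℕ) :
    MvPolynomial (ZVar D.d) D.Base :=
  D.bilin (F.q n m) + D.purePart n m

variable (D) in
/-- The `2 × 2` minor in the columns `α, β` of the deformed scroll matrix with columns
`(z_α, z_{α+1} + ζ_{α+1})`. -/
def deformedMinor (α β : Col D.d) : MvPolynomial (ZVar D.d) D.Base :=
  X α.top * (X β.bot + C (D.zetaPt β.bot)) - (X α.bot + C (D.zetaPt α.bot)) * X β.top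

/-- The equations of the infinitesimal deformation: the minors of the deformed scroll matrix and
the `P^(n)_m + P'^(n)_m`. -/
def FirstOrderLift.equations (F : D.FirstOrderLift) : Ideal (MvPolynomial (ZVar D.d) D.Base) :=
  Ideal.span ({g | ∃ α β, g = D.deformedMinor α β} ∪
    {g | ∃ n m, m ≤ D.b n ∧ g = map C (D.eqn n m) + F.pert n m})

/-- The left hand side `P'_m(ζ, ζ, ρ) - P_m(ζ)` of a base equation. -/
def FirstOrderLift.baseEquation (F : D.FirstOrderLift) (n : Fin l) (m : ℕ) : D.Base :=
  eval D.zetaPt (F.pert n m) - aeval D.zetaPt (D.eqn n m)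

/-- The ideal generated by the lifting conditions and the base equations, `1 ≤ m ≤ b n - 1`. -/
def FirstOrderLift.baseIdeal (F : D.FirstOrderLift) : Ideal D.Base :=
  D.liftingIdeal ⊔ Ideal.span {g | ∃ n m, 1 ≤ m ∧ m + 1 ≤ D.b n ∧ g = F.baseEquation n m}

/-- The infinitesimal deformation, over `K[ζ, ρ]` modulo the lifting conditions and the square of
the ideal of the origin, extends over the base `K[ζ, ρ] ⧸ J` as the flat family with equations `I`.
(The ideal of the family is the image of `I` in `(K[ζ, ρ] ⧸ J)[z]`; each ideal is of this form.) -/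
structure FirstOrderLift.IsExtension (F : D.FirstOrderLift) (J : Ideal D.Base)
    (I : Ideal (MvPolynomial (ZVar D.d) D.Base)) : Prop where
  lifting_le : D.liftingIdeal ≤ J
  le_first_order : J ≤ D.liftingIdeal ⊔ D.originIdeal ^ 2
  flat : IsFlatFamily (Ideal.Quotient.mk J) I
  first_order :
    restrict (Ideal.Quotient.mk (D.liftingIdeal ⊔ D.originIdeal ^ 2)) I =
      restrict (Ideal.Quotient.mk (D.liftingIdeal ⊔ D.originIdeal ^ 2)) F.equations

/-- The ideal `J` of `K[ζ, ρ]` is homogeneous. -/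
def BaseHomogeneous (J : Ideal D.Base) : Prop :=
  IsHomogeneousIdeal J

/-- The ideal `I` of `K[ζ, ρ][z]` is homogeneous, all variables `z, ζ, ρ` having degree `1`. -/
def FamilyHomogeneous (I : Ideal (MvPolynomial (ZVar D.d) D.Base)) : Prop :=
  IsHomogeneousIdeal (I.comap (sumAlgEquiv K (ZVar D.d) (D.ZetaIdx ⊕ D.RhoIdx)))

end QuadricSystem

end RollingFactors

end

/-!
On the scroll, `P'_{m+1} - ∑_α p_{α,m} ζ_{α+1}` is `t / s` times `P'_m`, so that modulo the lifting
conditions the first is `∑_α c_α z_{α+1}` and the second `∑_α c_α z_α` for some `c_α ∈ K[ζ, ρ]`.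
Rolling `P_m + P'_m = ∑_α (p_{α,m} + c_α) z_α` to `∑_α (p_{α,m} + c_α) (z_{α+1} + ζ_{α+1})`
therefore yields `P_{m+1} + P'_{m+1}` plus the value of `∑_α c_α z_{α+1}` at `z = ζ`, which is
exactly the left hand side of the base equation with index `m + 1`.

Hence over the base equations one can roll, provided that for `m = b` the excess is added to the
last equation. The resulting family is flat because it has the same leading forms as the cone `X`,
and this is a lifting property of relations. On the charts of a complete intersection, a relation
between the `P_n` is a Koszul relation, and sections on the charts of weight at least `-1` glue, so
that rolling and Koszul relations generate the relations between the `P^(n)_m` on the scroll.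

Conversely, let a flat family be given. Its equations differ from those of the infinitesimal
deformation by second order terms. The failure of rolling is an element of the ideal of the
family with second order coefficients, so by flatness its constant and linear terms are of third
order modulo `J`. This is a relation between the base equation, the constant terms of the
corrections of the equations and those of the minors. The latter form an alternating matrix and
cancel after multiplication with `p_{β,m}` and summation over `β`. What is left is a linear
relation between `P_m` and `P_{m+1}`, which are linearly independent.
-/

noncomputable section

namespace RollingFactors

/-! ### Homogeneous components and initial forms -/

section Weighted

variable {R σ M : Type*} [CommRing R] {w : σ → M} {p f : MvPolynomial σ R} {a b : M}

lemma weightedHomogeneousComponent_add_mul [AddCancelCommMonoid M]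
    (hf : IsWeightedHomogeneous w f b) :
    weightedHomogeneousComponent w (a + b) (p * f) = weightedHomogeneousComponent w a p * f := by
  classical
  let _ := weightedGradedAlgebra R w
  have h := DirectSum.coe_decompose_mul_add_of_right_mem (weightedHomogeneousSubmodule R w)
    (i := a) (a := p) ((mem_weightedHomogeneousSubmodule R w b f).2 hf)
  rw [← weightedDecomposition.decompose'_apply, ← weightedDecomposition.decompose'_apply]
  exact h

variable [AddCommGroup M]

lemma weightedHomogeneousComponent_mul (hf : IsWeightedHomogeneous w f b) :
    weightedHomogeneousComponent w a (p * f) = weightedHomogeneousComponent w (a - b) p * f := by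
  rw [← weightedHomogeneousComponent_add_mul hf, sub_add_cancel]

lemma exists_homogeneous_coeffs_of_mem_span {ι : Type*} [Fintype ι] {g : ι → MvPolynomial σ R}
    {D : ι → M} (hg : ∀ i, IsWeightedHomogeneous w (g i) (D i))
    (hp : IsWeightedHomogeneous w p a) (hmem : p ∈ Ideal.span (Set.range g)) :
    ∃ c : ι → MvPolynomial σ R, (∀ i, IsWeightedHomogeneous w (c i) (a - D i)) ∧
      p = ∑ i, c i * g i := by
  obtain ⟨c, hc⟩ := (Submodule.mem_span_range_iff_exists_fun _).1 hmem
  refine ⟨fun i => weightedHomogeneousComponent w (a - D i) (c i), fun i =>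
    weightedHomogeneousComponent_isWeightedHomogeneous _ _, ?_⟩
  rw [← weightedHomogeneousComponent_eq_self hp, ← hc, map_sum]
  exact Finset.sum_congr rfl fun i _ => weightedHomogeneousComponent_mul (hg i)

lemma exists_homogeneous_sub_mul_mem [DecidableEq M] {I : Ideal (MvPolynomial σ R)}
    (hI : letI := weightedGradedAlgebra R w; I.IsHomogeneous (weightedHomogeneousSubmodule R w))
    (hf : IsWeightedHomogeneous w f b) (hp : IsWeightedHomogeneous w p a)
    (hmem : p ∈ I ⊔ Ideal.span {f}) :
    ∃ c, IsWeightedHomogeneous w c (a - b) ∧ p - c * f ∈ I := by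
  obtain ⟨x, hx, y, hy, hxy⟩ := Submodule.mem_sup.1 hmem
  obtain ⟨c, rfl⟩ := Ideal.mem_span_singleton'.1 hy
  refine ⟨weightedHomogeneousComponent w (a - b) c,
    weightedHomogeneousComponent_isWeightedHomogeneous _ _, ?_⟩
  rw [← weightedHomogeneousComponent_mul hf, ← weightedHomogeneousComponent_eq_self hp,
    ← map_sub, ← hxy, add_sub_cancel_right]
  exact weightedHomogeneousComponent_mem_of_mem R w hI hx a

end Weighted

/-- The polynomials of degree less than `q`.  Unlike for `restrictTotalDegree`, the bound is
strict, so that the filtration starts with the zero submodule at `q = 0`. -/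
def degreeLT (R σ : Type*) [CommRing R] (q : ℕ) : Submodule R (MvPolynomial σ R) :=
  restrictSupport R {e | e.degree < q}

section DegreeLT

variable {R σ : Type*} [CommRing R] {p f : MvPolynomial σ R} {a b e q : ℕ}

lemma mem_degreeLT : p ∈ degreeLT R σ q ↔ ∀ e, coeff e p ≠ 0 → e.degree < q := by
  simp [degreeLT, mem_restrictSupport_iff, Set.subset_def]

lemma degreeLT_mono (h : a ≤ b) : degreeLT R σ a ≤ degreeLT R σ b :=
  restrictSupport_mono R fun _ (he : _ < a) => he.trans_le h

lemma degreeLT_zero : degreeLT R σ 0 = ⊥ := by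
  refine eq_bot_iff.2 fun p hp => ?_
  ext e
  by_contra hne
  exact absurd (mem_degreeLT.1 hp e hne) (Nat.not_lt_zero _)

lemma exists_mem_degreeLT (p : MvPolynomial σ R) : ∃ q, p ∈ degreeLT R σ q :=
  ⟨p.totalDegree + 1, mem_degreeLT.2 fun _ he =>
    Nat.lt_succ_of_le (le_totalDegree (mem_support_iff.2 he))⟩

lemma mem_degreeLT_of_isHomogeneous (hp : p.IsHomogeneous a) : p ∈ degreeLT R σ (a + 1) :=
  mem_degreeLT.2 fun e he => by
    rw [Finsupp.degree_eq_weight_one]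
    exact Nat.lt_succ_of_le (hp he).le

lemma mul_mem_degreeLT (hp : p ∈ degreeLT R σ (a + 1)) (hf : f ∈ degreeLT R σ b) :
    p * f ∈ degreeLT R σ (a + b) := by
  classical
  rw [mem_degreeLT] at *
  intro e he
  rw [coeff_mul] at he
  obtain ⟨⟨u, v⟩, huv, hne⟩ := Finset.exists_ne_zero_of_sum_ne_zero he
  have hu : u.degree < a + 1 := hp u (left_ne_zero_of_mul hne)
  have hv : v.degree < b := hf v (right_ne_zero_of_mul hne)
  rw [← Finset.HasAntidiagonal.mem_antidiagonal.1 huv, map_add]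
  change u.degree + v.degree < a + b
  omega

lemma mul_mem_degreeLT' (hp : p ∈ degreeLT R σ a) (hf : f ∈ degreeLT R σ (b + 1)) :
    p * f ∈ degreeLT R σ (a + b) := by
  rw [mul_comm, add_comm]; exact mul_mem_degreeLT hf hp

lemma C_mul_mem_degreeLT (r : R) (hp : p ∈ degreeLT R σ a) : C r * p ∈ degreeLT R σ a := by
  rw [C_mul']; exact Submodule.smul_mem _ _ hp

lemma homogeneousComponent_of_mem_degreeLT (hp : p ∈ degreeLT R σ q) (h : q ≤ e) :
    homogeneousComponent e p = 0 :=
  homogeneousComponent_eq_zero' _ _ fun d hd =>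
    ((mem_degreeLT.1 hp d (mem_support_iff.1 hd)).trans_le h).ne

lemma sub_homogeneousComponent_mem_degreeLT (hp : p ∈ degreeLT R σ (q + 1)) :
    p - homogeneousComponent q p ∈ degreeLT R σ q := by
  classical
  rw [mem_degreeLT] at *
  intro e he
  rw [coeff_sub, coeff_homogeneousComponent] at he
  split_ifs at he with h
  · simp at he
  · exact lt_of_le_of_ne (Nat.le_of_lt_succ (hp e (by simpa using he))) h

lemma homogeneousComponent_add_mul (hf : f.IsHomogeneous b) :
    homogeneousComponent (a + b) (p * f) = homogeneousComponent a p * f :=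
  weightedHomogeneousComponent_add_mul hf

lemma homogeneousComponent_mul_of_lt (hf : f.IsHomogeneous b) (h : a < b) :
    homogeneousComponent a (p * f) = 0 := by
  let _ := MvPolynomial.gradedAlgebra (σ := σ) (R := R)
  have hzero := DirectSum.coe_decompose_mul_of_right_mem_of_not_le
    (homogeneousSubmodule σ R) (a := p) ((mem_homogeneousSubmodule b f).2 hf) h.not_ge
  rw [← decomposition.decompose'_apply]
  exact hzero

end DegreeLT

section MapCoeff

variable {K R σ : Type*} [CommRing K] [CommRing R] [Algebra K R]

/-- The linear form `lam` applied to the coefficients of a polynomial. -/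
def mapCoeff (σ : Type*) (lam : R →ₗ[K] K) : MvPolynomial σ R →ₗ[K] MvPolynomial σ K where
  toFun p := AddMonoidAlgebra.map lam.toAddMonoidHom p
  map_add' _ _ := by ext e; exact map_add lam _ _
  map_smul' _ _ := by ext e; exact map_smul lam _ _

@[simp] lemma coeff_mapCoeff (lam : R →ₗ[K] K) (p : MvPolynomial σ R) (e : σ →₀ ℕ) :
    coeff e (mapCoeff σ lam p) = lam (coeff e p) := rfl

lemma mapCoeff_C (lam : R →ₗ[K] K) (r : R) : mapCoeff σ lam (C r) = C (lam r) := by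
  classical
  ext e
  rw [coeff_mapCoeff, coeff_C, coeff_C, apply_ite lam, map_zero]

lemma mapCoeff_mul_map (lam : R →ₗ[K] K) (p : MvPolynomial σ R) (f : MvPolynomial σ K) :
    mapCoeff σ lam (p * map (algebraMap K R) f) = mapCoeff σ lam p * f := by
  classical
  ext e
  rw [coeff_mapCoeff, coeff_mul, coeff_mul, map_sum]
  refine Finset.sum_congr rfl fun x _ => ?_
  rw [coeff_map, coeff_mapCoeff, mul_comm (coeff x.1 p), ← Algebra.smul_def, map_smul, smul_eq_mul,
    mul_comm]

lemma mapCoeff_mem {I : Ideal (MvPolynomial σ K)} (lam : R →ₗ[K] K) {p : MvPolynomial σ R}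
    (hp : p ∈ I.map (map (algebraMap K R))) : mapCoeff σ lam p ∈ I := by
  suffices h : ∀ g, mapCoeff σ lam (g * p) ∈ I by simpa using h 1
  induction hp using Submodule.span_induction with
  | mem p hp =>
    obtain ⟨f, hf, rfl⟩ := hp
    exact fun g => by rw [mapCoeff_mul_map]; exact I.mul_mem_left _ hf
  | zero => simp
  | add x y _ _ hx hy =>
    exact fun g => by rw [mul_add, map_add]; exact I.add_mem (hx g) (hy g)
  | smul c x _ hx => exact fun g => by rw [smul_eq_mul, ← mul_assoc]; exact hx _

end MapCoeff

section InitialForms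

lemma exists_isCompl_span_image {K V ι : Type*} [DivisionRing K] [AddCommGroup V] [Module K V]
    (W : Submodule K V) {v : ι → V} (hv : Submodule.span K (Set.range v) = ⊤) :
    ∃ s : Set ι, IsCompl (Submodule.span K (v '' s)) W := by
  obtain ⟨κ, a, -, hspan, hind⟩ := exists_linearIndependent' K (W.mkQ ∘ v)
  refine ⟨Set.range a, ?_, ?_⟩ <;> rw [← Set.range_comp]
  · simpa using Submodule.range_ker_disjoint (f := W.mkQ) (v := v ∘ a) hind
  · rw [← W.ker_mkQ, ← Submodule.map_eq_range_iff, Submodule.map_span, ← Set.range_comp,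
      ← Function.comp_assoc, hspan, Set.range_comp, ← Submodule.map_span, hv, Submodule.map_top]

variable {K R σ : Type*} [Field K] [CommRing R] [Algebra K R]
  {I₀ : Ideal (MvPolynomial σ K)} {I : Ideal (MvPolynomial σ R)} {A : Set (σ →₀ ℕ)}

lemma exists_isCompl_restrictSupport (I₀ : Ideal (MvPolynomial σ K)) :
    ∃ A : Set (σ →₀ ℕ), IsCompl (restrictSupport K A) (I₀.restrictScalars K) := by
  simp only [restrictSupport_eq_span]
  exact exists_isCompl_span_image _ (by
    simpa [restrictSupport_univ] using (restrictSupport_eq_span K (Set.univ : Set (σ →₀ ℕ))).symm)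

lemma eq_zero_of_mem_map_of_mem_restrictSupport
    (hA : Disjoint (restrictSupport K A) (I₀.restrictScalars K)) {p : MvPolynomial σ R}
    (hp : p ∈ I₀.map (map (algebraMap K R))) (hpA : p ∈ restrictSupport R A) : p = 0 := by
  ext e
  refine (Module.forall_dual_apply_eq_zero_iff K _).1 fun lam => ?_
  have hlam : mapCoeff σ lam p ∈ restrictSupport K A := by
    refine (mem_restrictSupport_iff K).2 fun u hu => (mem_restrictSupport_iff R).1 hpA ?_
    rw [Finset.mem_coe, mem_support_iff, coeff_mapCoeff] at hu
    exact Finset.mem_coe.2 (mem_support_iff.2 fun h => hu (by rw [h, map_zero]))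
  rw [← coeff_mapCoeff, Submodule.disjoint_def.1 hA _ hlam (mapCoeff_mem lam hp), coeff_zero]

lemma homogeneousComponent_mem_restrictSupport {p : MvPolynomial σ R}
    (hp : p ∈ restrictSupport R A) (e : ℕ) : homogeneousComponent e p ∈ restrictSupport R A := by
  classical
  refine (mem_restrictSupport_iff R).2 fun u hu => (mem_restrictSupport_iff R).1 hp ?_
  rw [Finset.mem_coe, mem_support_iff, coeff_homogeneousComponent] at hu
  simpa using (ite_ne_right_iff.1 hu).2

lemma map_mem_restrictSupport {p : MvPolynomial σ K} (hp : p ∈ restrictSupport K A) :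
    map (algebraMap K R) p ∈ restrictSupport R A :=
  (mem_restrictSupport_iff R).2 <|
    (Finset.coe_subset.2 (support_map_subset _ _)).trans ((mem_restrictSupport_iff K).1 hp)

lemma disjoint_restrictSupport_of_initialForms
    (hA : Disjoint (restrictSupport K A) (I₀.restrictScalars K))
    (hinit : ∀ e, ∀ x ∈ I, x ∈ degreeLT R σ (e + 1) →
      homogeneousComponent e x ∈ I₀.map (map (algebraMap K R))) :
    Disjoint (restrictSupport R A) (I.restrictScalars R) := by
  refine Submodule.disjoint_def.2 fun x hxA hxI => ?_
  have hdegree : ∀ q, x ∈ degreeLT R σ q → x = 0 := by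
    intro q
    induction q with
    | zero => simp [degreeLT_zero]
    | succ q ih =>
      intro hq
      have hzero : homogeneousComponent q x = 0 := eq_zero_of_mem_map_of_mem_restrictSupport hA
        (hinit q x hxI hq) (homogeneousComponent_mem_restrictSupport hxA q)
      exact ih (by simpa [hzero] using sub_homogeneousComponent_mem_degreeLT hq)
  exact (exists_mem_degreeLT x).elim hdegree

lemma codisjoint_restrictSupport_of_lift
    (hA : Codisjoint (restrictSupport K A) (I₀.restrictScalars K))
    (hlift : ∀ f ∈ I₀, ∀ e, ∃ x ∈ I,
      x - map (algebraMap K R) (homogeneousComponent e f) ∈ degreeLT R σ e) :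
    Codisjoint (restrictSupport R A) (I.restrictScalars R) := by
  have hdegree : ∀ q, degreeLT R σ q ≤ restrictSupport R A ⊔ I.restrictScalars R := by
    intro q
    induction q with
    | zero => simp [degreeLT_zero]
    | succ q ih =>
      rw [degreeLT, restrictSupport_eq_span, Submodule.span_le]
      rintro _ ⟨u, hu, rfl⟩
      rcases (Nat.lt_succ_iff_lt_or_eq (m := u.degree)).1 hu with hlt | heq
      · exact ih ((monomial_mem_restrictSupport R).2 (Or.inl hlt))
      obtain ⟨g, hg, f, hf, hgf⟩ := Submodule.mem_sup.1
        (codisjoint_iff.1 hA ▸ Submodule.mem_top : monomial u (1 : K) ∈ _)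
      obtain ⟨x, hx, hxf⟩ := hlift f hf q
      have hu : homogeneousComponent q (monomial u (1 : K)) = monomial u 1 :=
        homogeneousComponent_eq_self (isHomogeneous_monomial _ heq)
      have hsplit : monomial u (1 : R) = map (algebraMap K R) (homogeneousComponent q g) +
          (x - (x - map (algebraMap K R) (homogeneousComponent q f))) := by
        rw [sub_sub_cancel, ← map_add, ← map_add, hgf, hu, map_monomial, RingHom.map_one]
      change monomial u (1 : R) ∈ _
      rw [hsplit]
      exact add_mem (Submodule.mem_sup_left
        (map_mem_restrictSupport (homogeneousComponent_mem_restrictSupport hg q)))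
        (sub_mem (Submodule.mem_sup_right hx) (ih hxf))
  exact codisjoint_iff_le_sup.2 fun p _ => (exists_mem_degreeLT p).elim fun q hq => hdegree q hq

-- The monomials that form a basis modulo `I₀` also form one modulo `I`.
theorem free_quotient_of_initialForms
    (hlift : ∀ f ∈ I₀, ∀ e, ∃ x ∈ I,
      x - map (algebraMap K R) (homogeneousComponent e f) ∈ degreeLT R σ e)
    (hinit : ∀ e, ∀ x ∈ I, x ∈ degreeLT R σ (e + 1) →
      homogeneousComponent e x ∈ I₀.map (map (algebraMap K R))) :
    Module.Free R (MvPolynomial σ R ⧸ I) := by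
  obtain ⟨A, hA⟩ := exists_isCompl_restrictSupport I₀
  have hcompl : IsCompl (I.restrictScalars R) (restrictSupport R A) :=
    ⟨(disjoint_restrictSupport_of_initialForms hA.1 hinit).symm,
      (codisjoint_restrictSupport_of_lift hA.2 hlift).symm⟩
  have := Module.Free.of_basis (basisRestrictSupport R A)
  exact Module.Free.of_equiv (Submodule.quotientEquivOfIsCompl _ _ hcompl).symm

lemma exists_lift_homogeneousComponent {S : Set (MvPolynomial σ K)}
    (hS : ∀ f ∈ S, ∃ n, f.IsHomogeneous n ∧
      ∃ x ∈ I, x - map (algebraMap K R) f ∈ degreeLT R σ n)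
    {f : MvPolynomial σ K} (hf : f ∈ Ideal.span S) (e : ℕ) :
    ∃ x ∈ I, x - map (algebraMap K R) (homogeneousComponent e f) ∈ degreeLT R σ e := by
  suffices h : ∀ a, ∃ x ∈ I,
      x - map (algebraMap K R) (homogeneousComponent e (a * f)) ∈ degreeLT R σ e by
    simpa using h 1
  induction hf using Submodule.span_induction with
  | mem f hf =>
    intro a
    obtain ⟨n, hfn, x, hx, hxf⟩ := hS f hf
    rcases lt_or_ge e n with he | he
    · exact ⟨0, zero_mem _, by simp [homogeneousComponent_mul_of_lt hfn he]⟩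
    obtain ⟨c, rfl⟩ := Nat.exists_eq_add_of_le' he
    refine ⟨map (algebraMap K R) (homogeneousComponent c a) * x, I.mul_mem_left _ hx, ?_⟩
    rw [homogeneousComponent_add_mul hfn, map_mul, ← mul_sub]
    exact mul_mem_degreeLT (mem_degreeLT_of_isHomogeneous
      ((homogeneousComponent_isHomogeneous _ _).map _)) hxf
  | zero => exact fun a => ⟨0, zero_mem _, by simp⟩
  | add f g _ _ hf hg =>
    intro a
    obtain ⟨x, hx, hxf⟩ := hf a
    obtain ⟨y, hy, hyg⟩ := hg a
    refine ⟨x + y, add_mem hx hy, ?_⟩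
    rw [mul_add, map_add, map_add, add_sub_add_comm]
    exact add_mem hxf hyg
  | smul c f _ hf => exact fun a => by simpa only [smul_eq_mul, ← mul_assoc] using hf (a * c)

end InitialForms

/-! ### Sections over a complete intersection -/

variable {K : Type*} [Field K] {k l : ℕ}

/-- The bidegrees of the Cox coordinates: the degree in the `z^(i)`, and the weight for which
`s, t` have weight `1` and `z^(i)` has weight `-d i`. -/
def bidegree (d : Fin k → ℕ) : CoxVar k → ℤ × ℤ :=
  Sum.elim (fun _ => (0, 1)) (fun i => (1, -(d i : ℤ)))

lemma weight_bidegree (d : Fin k → ℕ) (e : CoxVar k →₀ ℕ) :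
    Finsupp.weight (bidegree d) e = (∑ i, (e (Sum.inr i) : ℤ),
      (e (sVar k) : ℤ) + e (tVar k) - ∑ i, (d i : ℤ) * e (Sum.inr i)) := by
  rw [Finsupp.weight_apply, Finsupp.sum_fintype _ _ (by simp), Fintype.sum_sum_type,
    Fin.sum_univ_two]
  ext <;> simp [bidegree, sVar, tVar, Prod.fst_sum, Prod.snd_sum, sub_eq_add_neg, mul_comm]

lemma IsDivisorEquation.bidegree {d : Fin k → ℕ} {b : ℕ} {P : MvPolynomial (CoxVar k) K}
    (h : IsDivisorEquation d b P) : IsWeightedHomogeneous (bidegree d) P (2, -(b : ℤ)) := by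
  intro e he
  have hquadratic := h.1 he
  have hweight := h.2 he
  rw [Finsupp.weight_apply, Finsupp.sum_fintype _ _ (by simp), Fintype.sum_sum_type,
    Fin.sum_univ_two] at hquadratic hweight
  rw [weight_bidegree, ← hweight]
  refine Prod.ext ?_ ?_
  · change ∑ i, (e (Sum.inr i) : ℤ) = 2
    exact_mod_cast (by simpa using hquadratic : ∑ i, e (Sum.inr i) = 2)
  · simp [sVar, tVar, sub_eq_add_neg, mul_comm]

lemma isWeightedHomogeneous_sVar (d : Fin k → ℕ) :
    IsWeightedHomogeneous (bidegree d) (X (sVar k) : MvPolynomial (CoxVar k) K) (0, 1) :=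
  isWeightedHomogeneous_X _ _ _

lemma isWeightedHomogeneous_tVar (d : Fin k → ℕ) :
    IsWeightedHomogeneous (bidegree d) (X (tVar k) : MvPolynomial (CoxVar k) K) (0, 1) :=
  isWeightedHomogeneous_X _ _ _

variable {d : Fin k → ℕ}

lemma mem_span_sVar_tVar_of_weight_pos {x : MvPolynomial (CoxVar k) K} {w : ℤ × ℤ}
    (hw : 0 < w.2) (hx : IsWeightedHomogeneous (bidegree d) x w) :
    x ∈ Ideal.span ({X (sVar k), X (tVar k)} : Set (MvPolynomial (CoxVar k) K)) := by
  rw [← Set.image_pair, mem_ideal_span_X_image]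
  intro e he
  by_contra! hzero
  have hweight := congrArg Prod.snd (weight_bidegree d e)
  rw [hx (mem_support_iff.1 he), hzero _ (by simp), hzero _ (by simp)] at hweight
  have : 0 ≤ ∑ i, (d i : ℤ) * e (Sum.inr i) := Finset.sum_nonneg fun i _ => by positivity
  simp only [Nat.cast_zero] at hweight
  omega

lemma exists_eq_tVar_mul_sub_sVar_mul {x : MvPolynomial (CoxVar k) K} {w : ℤ × ℤ}
    (hw : 0 < w.2) (hx : IsWeightedHomogeneous (bidegree d) x w) :
    ∃ y z, IsWeightedHomogeneous (bidegree d) y (w - (0, 1)) ∧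
      IsWeightedHomogeneous (bidegree d) z (w - (0, 1)) ∧
      x = X (tVar k) * y - X (sVar k) * z := by
  obtain ⟨a, b, hab⟩ := Ideal.mem_span_pair.1 (mem_span_sVar_tVar_of_weight_pos hw hx)
  refine ⟨weightedHomogeneousComponent (bidegree d) (w - (0, 1)) b,
    -weightedHomogeneousComponent (bidegree d) (w - (0, 1)) a,
    weightedHomogeneousComponent_isWeightedHomogeneous _ _,
    (weightedHomogeneousComponent_isWeightedHomogeneous _ _).neg, ?_⟩
  rw [← weightedHomogeneousComponent_eq_self hx, ← hab, map_add,
    weightedHomogeneousComponent_mul (isWeightedHomogeneous_sVar d),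
    weightedHomogeneousComponent_mul (isWeightedHomogeneous_tVar d)]
  ring

/-- `I` is homogeneous for the bidegree. -/
def IsBihomogeneous (d : Fin k → ℕ) (I : Ideal (MvPolynomial (CoxVar k) K)) : Prop :=
  letI := weightedGradedAlgebra K (bidegree d)
  I.IsHomogeneous (weightedHomogeneousSubmodule K (bidegree d))

/-- The sections modulo `I` of weight at least `-1` are determined by their restrictions to the
charts `s ≠ 0` and `t ≠ 0`: in these weights the zeroth local cohomology at `(s, t)` vanishes. -/
def SectionsSeparated (d : Fin k → ℕ) (I : Ideal (MvPolynomial (CoxVar k) K)) : Prop :=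
  ∀ (g : MvPolynomial (CoxVar k) K) (w : ℤ × ℤ), -1 ≤ w.2 → IsWeightedHomogeneous (bidegree d) g w →
    X (sVar k) * g ∈ I → X (tVar k) * g ∈ I → g ∈ I

/-- The sections modulo `I` of weight at least `-1` on the charts `s ≠ 0` and `t ≠ 0` can be glued:
if `u / s = v / t`, there is a section `y` with `u = s y` and `v = t y`. -/
def SectionsGlue (d : Fin k → ℕ) (I : Ideal (MvPolynomial (CoxVar k) K)) : Prop :=
  ∀ (u v : MvPolynomial (CoxVar k) K) (w : ℤ × ℤ), 0 ≤ w.2 →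
    IsWeightedHomogeneous (bidegree d) u w → IsWeightedHomogeneous (bidegree d) v w →
    X (tVar k) * u - X (sVar k) * v ∈ I →
    ∃ y, IsWeightedHomogeneous (bidegree d) y (w - (0, 1)) ∧ u - X (sVar k) * y ∈ I ∧
      v - X (tVar k) * y ∈ I

section Sections

variable {I : Ideal (MvPolynomial (CoxVar k) K)} {f g : MvPolynomial (CoxVar k) K} {w e : ℤ × ℤ}

lemma SectionsSeparated.mem_of_pow_mul_mem (hI : SectionsSeparated d I) (hw : -1 ≤ w.2)
    (hg : IsWeightedHomogeneous (bidegree d) g w) {a b : ℕ}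
    (hs : X (sVar k) ^ a * g ∈ I) (ht : X (tVar k) ^ b * g ∈ I) : g ∈ I := by
  induction hN : a + b generalizing a b g w with
  | zero =>
    obtain rfl : a = 0 := by omega
    simpa using hs
  | succ N ih =>
    rcases a with _ | a
    · simpa using hs
    rcases b with _ | b
    · simpa using ht
    have hw' : -1 ≤ ((0, 1) + w).2 := by rw [Prod.snd_add]; omega
    refine hI g w hw hg
      (ih hw' ((isWeightedHomogeneous_sVar d).mul hg) (a := a) (b := b + 1) ?_ ?_ (by omega))
      (ih hw' ((isWeightedHomogeneous_tVar d).mul hg) (a := a + 1) (b := b) ?_ ?_ (by omega))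
    · rwa [← mul_assoc, ← pow_succ]
    · rw [mul_left_comm]; exact I.mul_mem_left _ ht
    · rw [mul_left_comm]; exact I.mul_mem_left _ hs
    · rwa [← mul_assoc, ← pow_succ]

lemma sectionsSeparated_bot : SectionsSeparated (K := K) d ⊥ := by
  intro g w _ _ hs _
  simpa using hs

lemma sectionsGlue_bot : SectionsGlue (K := K) d ⊥ := by
  intro u v w _ hu _ h
  rw [Ideal.mem_bot, sub_eq_zero] at h
  have hne : ¬ (X (sVar k) : MvPolynomial (CoxVar k) K) ∣ X (tVar k) := by
    simp [X_dvd_X, sVar, tVar]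
  obtain ⟨y, rfl⟩ := ((X_prime (R := K)).dvd_or_dvd ⟨v, h⟩).resolve_left hne
  obtain rfl : v = X (tVar k) * y :=
    mul_left_cancel₀ (X_ne_zero (sVar k)) (by rw [← h, mul_left_comm])
  have hy : weightedHomogeneousComponent (bidegree d) (w - (0, 1)) y = y := by
    refine mul_right_cancel₀ (X_ne_zero (sVar k)) ?_
    rw [← weightedHomogeneousComponent_mul (isWeightedHomogeneous_sVar d), mul_comm y,
      weightedHomogeneousComponent_eq_self hu]
  exact ⟨y, hy ▸ weightedHomogeneousComponent_isWeightedHomogeneous _ _, by simp, by simp⟩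

lemma mem_sup_span_of_sub_mul_mem (c : MvPolynomial (CoxVar k) K) (h : g - c * f ∈ I) :
    g ∈ I ⊔ Ideal.span {f} := by
  rw [← sub_add_cancel g (c * f)]
  exact Submodule.add_mem_sup h (Ideal.mem_span_singleton'.2 ⟨c, rfl⟩)

lemma SectionsSeparated.sup_span (hsep : SectionsSeparated d I) (hglue : SectionsGlue d I)
    (hI : IsBihomogeneous d I) (hf : IsWeightedHomogeneous (bidegree d) f e) (he : e.2 ≤ 0)
    (hreg : ∀ g w, -1 ≤ w.2 → IsWeightedHomogeneous (bidegree d) g w → g * f ∈ I → g ∈ I) :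
    SectionsSeparated d (I ⊔ Ideal.span {f}) := by
  intro g w hw hg hsg htg
  obtain ⟨u, hu, hu'⟩ :=
    exists_homogeneous_sub_mul_mem hI hf ((isWeightedHomogeneous_sVar d).mul hg) hsg
  obtain ⟨v, hv, hv'⟩ :=
    exists_homogeneous_sub_mul_mem hI hf ((isWeightedHomogeneous_tVar d).mul hg) htg
  have hcocycle : X (tVar k) * u - X (sVar k) * v ∈ I := by
    refine hreg _ ((0, 1) + ((0, 1) + w - e)) ?_ (((isWeightedHomogeneous_tVar d).mul hu).sub
      ((isWeightedHomogeneous_sVar d).mul hv)) ?_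
    · simp only [Prod.snd_add, Prod.snd_sub]; omega
    · convert sub_mem (I.mul_mem_left (X (sVar k)) hv') (I.mul_mem_left (X (tVar k)) hu') using 1
      ring
  obtain ⟨y, hy, hyu, hyv⟩ :=
    hglue u v _ (by simp only [Prod.snd_add, Prod.snd_sub]; omega) hu hv hcocycle
  have hyf : IsWeightedHomogeneous (bidegree d) (y * f) w := by
    convert hy.mul hf using 1; abel
  refine mem_sup_span_of_sub_mul_mem y (hsep _ w hw (hg.sub hyf) ?_ ?_)
  · convert add_mem hu' (I.mul_mem_right f hyu) using 1; ring
  · convert add_mem hv' (I.mul_mem_right f hyv) using 1; ring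

lemma SectionsGlue.sup_span (hglue : SectionsGlue d I) (hI : IsBihomogeneous d I)
    (hf : IsWeightedHomogeneous (bidegree d) f e) (he : e.2 ≤ 0) :
    SectionsGlue d (I ⊔ Ideal.span {f}) := by
  intro u v w hw hu hv h
  obtain ⟨x, hx, hx'⟩ := exists_homogeneous_sub_mul_mem hI hf
    (((isWeightedHomogeneous_tVar d).mul hu).sub ((isWeightedHomogeneous_sVar d).mul hv)) h
  obtain ⟨y, z, hy, hz, rfl⟩ := exists_eq_tVar_mul_sub_sVar_mul
    (by simp only [Prod.snd_add, Prod.snd_sub]; omega) hx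
  have hw' : (0, 1) + w - e - (0, 1) + e = w := by abel
  obtain ⟨c, hc, hcu, hcv⟩ := hglue (u - y * f) (v - z * f) w hw
    (hu.sub (hw' ▸ hy.mul hf)) (hv.sub (hw' ▸ hz.mul hf)) (by convert hx' using 1; ring)
  exact ⟨c, hc, mem_sup_span_of_sub_mul_mem y (by convert hcu using 1; ring),
    mem_sup_span_of_sub_mul_mem z (by convert hcv using 1; ring)⟩

end Sections

section CompleteIntersection

variable {P : Fin l → MvPolynomial (CoxVar k) K} {b : Fin l → ℕ}

/-- The ideal generated by the first `n` equations. -/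
def initialIdeal (P : Fin l → MvPolynomial (CoxVar k) K) (n : ℕ) :
    Ideal (MvPolynomial (CoxVar k) K) :=
  Ideal.span {f | ∃ i : Fin l, (i : ℕ) < n ∧ f = P i}

lemma initialIdeal_zero (P : Fin l → MvPolynomial (CoxVar k) K) : initialIdeal P 0 = ⊥ := by
  simp [initialIdeal]

lemma initialIdeal_succ (P : Fin l → MvPolynomial (CoxVar k) K) (n : Fin l) :
    initialIdeal P (n + 1) = initialIdeal P n ⊔ Ideal.span {P n} := by
  rw [initialIdeal, initialIdeal, ← Ideal.span_union]
  congr 1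
  ext f
  simp only [Set.mem_union, Set.mem_ofPred_eq, Set.mem_singleton_iff, Nat.lt_succ_iff_lt_or_eq,
    ← Fin.ext_iff, or_and_right, exists_or, exists_eq_left]

lemma isBihomogeneous_initialIdeal (hd : ∀ n, IsDivisorEquation d (b n) (P n)) (n : ℕ) :
    IsBihomogeneous d (initialIdeal P n) := by
  let _ := weightedGradedAlgebra K (bidegree d)
  refine Ideal.homogeneous_span _ _ ?_
  rintro _ ⟨i, -, rfl⟩
  exact ⟨_, (hd i).bidegree⟩

lemma ofList_take_ofFn (P : Fin l → MvPolynomial (CoxVar k) K) (n : Fin l) :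
    Ideal.ofList ((List.ofFn P).take n) = initialIdeal P n := by
  rw [Ideal.ofList, initialIdeal]
  congr 1
  ext f
  simp only [Set.mem_ofPred_eq, List.mem_take_iff_getElem, List.getElem_ofFn, List.length_ofFn]
  constructor
  · rintro ⟨i, hi, rfl⟩
    exact ⟨⟨i, by omega⟩, by simp; omega, rfl⟩
  · rintro ⟨i, hi, rfl⟩
    exact ⟨i, by omega, rfl⟩

lemma exists_pow_mul_mem_initialIdeal {y : MvPolynomial (CoxVar k) K}
    (h : RingTheory.Sequence.IsWeaklyRegular (Localization.Away y) (List.ofFn P))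
    (n : Fin l) {g : MvPolynomial (CoxVar k) K} (hg : g * P n ∈ initialIdeal P n) :
    ∃ N, y ^ N * g ∈ initialIdeal P n := by
  have hreg := h.regular_mod_prev n (by simp)
  rw [ofList_take_ofFn, List.getElem_ofFn, isSMulRegular_quotient_iff_mem_of_smul_mem] at hreg
  have hloc := hreg (algebraMap _ _ g) (by
    rw [Ideal.smul_top_eq_map, Submodule.restrictScalars_mem, Algebra.smul_def, ← map_mul, mul_comm]
    exact Ideal.mem_map_of_mem _ hg)
  rw [Ideal.smul_top_eq_map, Submodule.restrictScalars_mem,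
    IsLocalization.algebraMap_mem_map_algebraMap_iff (Submonoid.powers y)] at hloc
  obtain ⟨_, ⟨N, rfl⟩, hN⟩ := hloc
  exact ⟨N, hN⟩

lemma mem_initialIdeal_of_separated (hP : IsCompleteIntersection P) (n : Fin l)
    (hsep : SectionsSeparated d (initialIdeal P n)) {g : MvPolynomial (CoxVar k) K} {w : ℤ × ℤ}
    (hw : -1 ≤ w.2) (hg : IsWeightedHomogeneous (bidegree d) g w)
    (hmem : g * P n ∈ initialIdeal P n) : g ∈ initialIdeal P n :=
  (exists_pow_mul_mem_initialIdeal hP.1 n hmem).elim fun _ hs =>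
    (exists_pow_mul_mem_initialIdeal hP.2 n hmem).elim fun _ ht =>
      hsep.mem_of_pow_mul_mem hw hg hs ht

theorem sections_initialIdeal (hd : ∀ n, IsDivisorEquation d (b n) (P n))
    (hP : IsCompleteIntersection P) {n : ℕ} (hn : n ≤ l) :
    SectionsSeparated d (initialIdeal P n) ∧ SectionsGlue d (initialIdeal P n) := by
  induction n with
  | zero => rw [initialIdeal_zero]; exact ⟨sectionsSeparated_bot, sectionsGlue_bot⟩
  | succ n ih =>
    obtain ⟨hsep, hglue⟩ := ih (by omega)
    let m : Fin l := ⟨n, by omega⟩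
    have hI := isBihomogeneous_initialIdeal hd n
    have hweight : ((2 : ℤ), -(b m : ℤ)).2 ≤ 0 := by simp
    rw [initialIdeal_succ P m]
    exact ⟨hsep.sup_span hglue hI (hd m).bidegree hweight fun _ _ hw hg =>
        mem_initialIdeal_of_separated hP m hsep hw hg,
      hglue.sup_span hI (hd m).bidegree hweight⟩

theorem mem_initialIdeal_of_mul_mem (hd : ∀ n, IsDivisorEquation d (b n) (P n))
    (hP : IsCompleteIntersection P) (n : Fin l) {g : MvPolynomial (CoxVar k) K} {w : ℤ × ℤ}
    (hw : -1 ≤ w.2) (hg : IsWeightedHomogeneous (bidegree d) g w)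
    (hmem : g * P n ∈ initialIdeal P n) : g ∈ initialIdeal P n :=
  mem_initialIdeal_of_separated hP n (sections_initialIdeal hd hP n.2.le).1 hw hg hmem

theorem IsCompleteIntersection.ne_zero (hd : ∀ n, IsDivisorEquation d (b n) (P n))
    (hP : IsCompleteIntersection P) (n : Fin l) : P n ≠ 0 := by
  intro hzero
  have hone : (1 : MvPolynomial (CoxVar k) K) ∈ initialIdeal P n :=
    mem_initialIdeal_of_mul_mem hd hP n (w := 0) (by simp) (isWeightedHomogeneous_one K _)
      (by rw [hzero, mul_zero]; exact zero_mem _)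
  have hle : initialIdeal P n ≤ RingHom.ker (constantCoeff : MvPolynomial (CoxVar k) K →+* K) := by
    rw [initialIdeal, Ideal.span_le]
    rintro _ ⟨i, -, rfl⟩
    rw [SetLike.mem_coe, RingHom.mem_ker, constantCoeff_eq]
    by_contra hne
    simpa [Prod.ext_iff] using (hd i).bidegree hne
  exact one_ne_zero ((map_one _).symm.trans (RingHom.mem_ker.1 (hle hone)))

end CompleteIntersection

/-! ### The ideal of the deformed scroll -/

lemma sum_smul_mem_of_sum_monomial_eq_zero {ι σ R M : Type*} [CommRing R] [AddCommGroup M]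
    [Module R M] {W : Submodule R M} {s : Finset ι} {c : ι → R} {e : ι → M} {π : ι → σ →₀ ℕ}
    (hπ : ∑ i ∈ s, monomial (π i) (c i) = 0)
    (hW : ∀ i ∈ s, ∀ j ∈ s, π i = π j → e i - e j ∈ W) : ∑ i ∈ s, c i • e i ∈ W := by
  classical
  let rep : (σ →₀ ℕ) → M := fun x => if h : ∃ j ∈ s, π j = x then e h.choose else 0
  have hrep : ∑ i ∈ s, c i • rep (π i) = 0 := by
    have hterm : ∀ i, (basisMonomials σ R).constr R rep (monomial (π i) (c i)) =
        c i • rep (π i) := fun i => by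
      rw [← (basisMonomials σ R).constr_basis R rep, ← map_smul, coe_basisMonomials, smul_monomial,
        smul_eq_mul, mul_one]
    simpa only [map_sum, hterm, map_zero] using
      congrArg ((basisMonomials σ R).constr R rep) hπ
  rw [← sub_zero (∑ i ∈ s, c i • e i), ← hrep, ← Finset.sum_sub_distrib]
  refine Submodule.sum_mem _ fun i hi => ?_
  have hex : ∃ j ∈ s, π j = π i := ⟨i, hi, rfl⟩
  rw [← smul_sub, show rep (π i) = e hex.choose from dif_pos hex]
  exact W.smul_mem _ (hW _ hi _ hex.choose_spec.1 hex.choose_spec.2.symm)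

lemma sub_mem_of_eqvGen {α R M : Type*} [Ring R] [AddCommGroup M] [Module R M]
    {W : α → Submodule R M} {r : α → α → Prop} {e : α → M} (hW : ∀ x y, r x y → W x = W y)
    (h : ∀ x y, r x y → e x - e y ∈ W x) {x y : α} (hxy : Relation.EqvGen r x y) :
    W x = W y ∧ e x - e y ∈ W x := by
  induction hxy with
  | rel x y hr => exact ⟨hW x y hr, h x y hr⟩
  | refl x => exact ⟨rfl, by rw [sub_self]; exact (W x).zero_mem⟩
  | symm x y _ ih => exact ⟨ih.1.symm, by rw [← neg_sub, ← ih.1]; exact (W x).neg_mem ih.2⟩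
  | trans x y z _ _ ih ih' =>
    refine ⟨ih.1.trans ih'.1, ?_⟩
    rw [← sub_add_sub_cancel]
    exact (W x).add_mem ih.2 (ih.1 ▸ ih'.2)

lemma algHom_monomial {σ τ R : Type*} [CommRing R] {φ : MvPolynomial σ R →ₐ[R] MvPolynomial τ R}
    {ε : (σ →₀ ℕ) →+ (τ →₀ ℕ)} (h : ∀ x, φ (X x) = monomial (ε (Finsupp.single x 1)) 1)
    (u : σ →₀ ℕ) (r : R) : φ (monomial u r) = monomial (ε u) r := by
  conv_rhs => rw [← u.sum_single, map_finsuppSum, monomial_finsupp_sum_index]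
  rw [monomial_eq, map_mul, algHom_C, algebraMap_eq, Finsupp.prod, map_prod]
  refine congrArg (C r * ·) (Finset.prod_congr rfl fun x _ => ?_)
  rw [map_pow, h, monomial_pow, one_pow, ← map_nsmul, Finsupp.smul_single_one]

lemma exists_eq_add_single {σ : Type*} {u : σ →₀ ℕ} {z : σ} (hz : u z ≠ 0) :
    ∃ v, u = v + Finsupp.single z 1 :=
  ⟨u - Finsupp.single z 1, (tsub_add_cancel_of_le
    (Finsupp.single_le_iff.2 (Nat.one_le_iff_ne_zero.2 hz))).symm⟩

section Monomials

variable {k b : ℕ} {d : Fin k → ℕ}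

/-- The exponents of the `z^(i)` in the restriction of a monomial to the scroll. -/
def content : (ZVar d →₀ ℕ) →+ (Fin k →₀ ℕ) := Finsupp.mapDomain.addMonoidHom Sigma.fst

/-- The exponent of `t` in the restriction of a monomial to the scroll. -/
def tExponent : (ZVar d →₀ ℕ) →+ ℕ := Finsupp.weight fun z => (z.2 : ℕ)

@[simp] lemma content_single (z : ZVar d) (n : ℕ) :
    content (Finsupp.single z n) = Finsupp.single z.1 n :=
  Finsupp.mapDomain_single

@[simp] lemma tExponent_single (z : ZVar d) (n : ℕ) :
    tExponent (Finsupp.single z n) = n * z.2 := by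
  rw [tExponent, Finsupp.weight_single, smul_eq_mul]

@[simp] lemma degree_content (u : ZVar d →₀ ℕ) : (content u).degree = u.degree :=
  Finsupp.degree_mapDomain _ _

/-- The moves between the terms `s^{b-m} t^m z^u`, encoded as pairs `(m, u)`, which leave the
restriction to the scroll unchanged: exchanging the top and bottom entries of two columns, and
rolling. -/
inductive Move (d : Fin k → ℕ) (b : ℕ) :
    Fin (b + 1) × (ZVar d →₀ ℕ) → Fin (b + 1) × (ZVar d →₀ ℕ) → Prop
  | swap (m : Fin (b + 1)) (u : ZVar d →₀ ℕ) (α β : Col d) :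
      Move d b (m, u + Finsupp.single α.top 1 + Finsupp.single β.bot 1)
        (m, u + Finsupp.single α.bot 1 + Finsupp.single β.top 1)
  | roll (m : Fin b) (u : ZVar d →₀ ℕ) (α : Col d) :
      Move d b (m.castSucc, u + Finsupp.single α.bot 1) (m.succ, u + Finsupp.single α.top 1)

/-- The terms `(m, u)` and `(m', u')` are linked by a sequence of moves and inverse moves. -/
abbrev Linked (d : Fin k → ℕ) (b : ℕ) :
    Fin (b + 1) × (ZVar d →₀ ℕ) → Fin (b + 1) × (ZVar d →₀ ℕ) → Prop :=
  Relation.EqvGen (Move d b)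

variable {x y : Fin (b + 1) × (ZVar d →₀ ℕ)}

lemma Linked.add_right (h : Linked d b x y) (v : ZVar d →₀ ℕ) :
    Linked d b (x.1, x.2 + v) (y.1, y.2 + v) := by
  induction h with
  | rel _ _ h =>
    refine .rel _ _ ?_
    cases h with
    | swap m u α β => simpa only [add_right_comm _ _ v] using Move.swap m (u + v) α β
    | roll m u α => simpa only [add_right_comm _ _ v] using Move.roll m (u + v) α
  | refl => exact .refl _
  | symm _ _ _ ih => exact ih.symm
  | trans _ _ _ _ _ ih ih' => exact ih.trans _ _ _ ih'

lemma Linked.content_eq (h : Linked d b x y) : content x.2 = content y.2 := by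
  induction h with
  | rel _ _ h => cases h <;> simp [Col.top, Col.bot]
  | refl => rfl
  | symm _ _ _ ih => exact ih.symm
  | trans _ _ _ _ _ ih ih' => exact ih.trans ih'

lemma Linked.tExponent_eq (h : Linked d b x y) : tExponent x.2 + x.1 = tExponent y.2 + y.1 := by
  induction h with
  | rel _ _ h => cases h <;> simp [Col.top, Col.bot] <;> omega
  | refl => rfl
  | symm _ _ _ ih => exact ih.symm
  | trans _ _ _ _ _ ih ih' => exact ih.trans ih'

lemma Linked.degree_eq (h : Linked d b x y) : x.2.degree = y.2.degree := by
  rw [← degree_content, h.content_eq, degree_content]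

lemma exists_eq_add_single_bot {u : ZVar d →₀ ℕ} (h : 0 < tExponent u) :
    ∃ v, ∃ β : Col d, u = v + Finsupp.single β.bot 1 := by
  obtain ⟨⟨i, j⟩, hz, hj⟩ : ∃ z, u z ≠ 0 ∧ (z.2 : ℕ) ≠ 0 := by
    by_contra! hzero
    rw [tExponent, Finsupp.weight_apply, Finsupp.sum, Finset.sum_eq_zero fun z hz => by
      rw [hzero z (Finsupp.mem_support_iff.1 hz), smul_zero]] at h
    exact lt_irrefl _ h
  obtain ⟨j, rfl⟩ := Fin.exists_succ_eq.2 fun h0 : j = 0 => hj (by rw [h0]; rfl)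
  obtain ⟨v, hv⟩ := exists_eq_add_single hz
  exact ⟨v, ⟨i, j⟩, hv⟩

lemma exists_eq_add_single_of_content {u : ZVar d →₀ ℕ} {i : Fin k} (h : content u i ≠ 0) :
    ∃ v, ∃ j, u = v + Finsupp.single ⟨i, j⟩ 1 := by
  classical
  obtain ⟨⟨_, j⟩, hz, rfl⟩ :=
    Finset.mem_image.1 (Finsupp.mapDomain_support (Finsupp.mem_support_iff.2 h))
  obtain ⟨v, hv⟩ := exists_eq_add_single (Finsupp.mem_support_iff.1 hz)
  exact ⟨v, j, hv⟩

lemma exists_linked_bot (m : Fin (b + 1)) (u : ZVar d →₀ ℕ) (α : Col d)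
    (h : 0 < tExponent u + m) :
    ∃ m' v, Linked d b (m, u + Finsupp.single α.top 1) (m', v + Finsupp.single α.bot 1) := by
  cases m using Fin.cases with
  | zero =>
    obtain ⟨v, β, rfl⟩ := exists_eq_add_single_bot (by simpa using h)
    refine ⟨0, v + Finsupp.single β.top 1, ?_⟩
    convert Relation.EqvGen.rel _ _ (Move.swap (0 : Fin (b + 1)) v α β) using 2 <;> abel
  | succ m => exact ⟨m.castSucc, u, .symm _ _ (.rel _ _ (.roll m u α))⟩

lemma exists_linked_single (i : Fin k) (j₀ j : Fin (d i + 1)) (hj : j ≤ j₀) (m : Fin (b + 1))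
    (u : ZVar d →₀ ℕ) (h : (j₀ : ℕ) ≤ tExponent u + j + m) :
    ∃ m' v, Linked d b (m, u + Finsupp.single ⟨i, j⟩ 1) (m', v + Finsupp.single ⟨i, j₀⟩ 1) := by
  induction j using Fin.reverseInduction generalizing m u with
  | last =>
    obtain rfl : j₀ = Fin.last _ := Fin.last_le_iff.1 hj
    exact ⟨m, u, .refl _⟩
  | cast j ih =>
    rcases hj.eq_or_lt with rfl | hlt
    · exact ⟨m, u, .refl _⟩
    have hlt' : (j : ℕ) < j₀ := hlt
    rw [Fin.val_castSucc] at h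
    obtain ⟨m', v, hv⟩ := exists_linked_bot m u ⟨i, j⟩ (by omega)
    have ht := hv.tExponent_eq
    simp only [map_add, tExponent_single, Col.top, Col.bot, Fin.val_castSucc, Fin.val_succ] at ht
    obtain ⟨m'', v', hv'⟩ := ih (Fin.castSucc_lt_iff_succ_le.1 hlt) m' v
      (by rw [Fin.val_succ]; omega)
    exact ⟨m'', v', hv.trans _ _ _ hv'⟩

lemma exists_linked_max (m : Fin (b + 1)) (u : ZVar d →₀ ℕ) {i : Fin k} (hi : content u i ≠ 0) :
    ∃ m' v, Linked d b (m, u) (m', v + Finsupp.single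
      ⟨i, ⟨min (d i) (tExponent u + m), Nat.lt_succ_of_le (min_le_left _ _)⟩⟩ 1) := by
  obtain ⟨v, j, rfl⟩ := exists_eq_add_single_of_content hi
  have hj := j.2
  exact exists_linked_single i _ j (Fin.le_def.2 (by simp; omega)) m v (by simp)

theorem linked_of_content_eq_of_tExponent_eq (hc : content x.2 = content y.2)
    (ht : tExponent x.2 + x.1 = tExponent y.2 + y.1) : Linked d b x y := by
  obtain ⟨m, u⟩ := x
  obtain ⟨m', u'⟩ := y
  induction hq : u.degree generalizing m u m' u' with
  | zero =>
    obtain rfl : u = 0 := (Finsupp.degree_eq_zero_iff u).1 hq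
    obtain rfl : u' = 0 := by
      rw [← Finsupp.degree_eq_zero_iff, ← degree_content, ← hc, degree_content, hq]
    obtain rfl : m = m' := Fin.ext (by simpa using ht)
    exact .refl _
  | succ q ih =>
    obtain ⟨i, hi⟩ : ∃ i, content u i ≠ 0 := by
      by_contra! hzero
      rw [← degree_content, (Finsupp.ext hzero : content u = 0), map_zero] at hq
      omega
    obtain ⟨n, v, hv⟩ := exists_linked_max m u hi
    obtain ⟨n', v', hv'⟩ := exists_linked_max m' u' (hc ▸ hi)
    simp only [← ht] at hv'
    have hdegree := hv.degree_eq
    have hcontent := hv.content_eq.symm.trans (hc.trans hv'.content_eq)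
    have htExponent := hv.tExponent_eq.symm.trans (ht.trans hv'.tExponent_eq)
    simp only [map_add, Finsupp.degree_single, add_left_inj] at hdegree hcontent htExponent
    have hlink := ih n v n' v' hcontent (by dsimp only; omega) (by omega)
    exact hv.trans _ _ _ ((hlink.add_right _).trans _ _ _ hv'.symm)

/-- The exponent of the restriction of a monomial to the chart `s = 1` of the scroll. -/
def chartExponent : (ZVar d →₀ ℕ) →+ (CoxVar k →₀ ℕ) :=
  (Finsupp.mapDomain.addMonoidHom Sum.inr).comp content +
    (Finsupp.singleAddHom (tVar k)).comp tExponent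

lemma linked_of_chartExponent_eq (h : chartExponent x.2 + Finsupp.single (tVar k) (x.1 : ℕ) =
    chartExponent y.2 + Finsupp.single (tVar k) (y.1 : ℕ)) : Linked d b x y := by
  refine linked_of_content_eq_of_tExponent_eq (Finsupp.ext fun i => ?_) ?_
  · have := DFunLike.congr_fun h (Sum.inr i)
    simpa [chartExponent, Finsupp.mapDomain_apply Sum.inr_injective, tVar] using this
  · have hinl : ∀ f : Fin k →₀ ℕ, f.mapDomain Sum.inr (tVar k) = 0 := fun f =>
      Finsupp.mapDomain_of_notMem_range _ _ (by simp [tVar])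
    have := DFunLike.congr_fun h (tVar k)
    simpa [chartExponent, hinl] using this

end Monomials

section Chart

variable {R : Type*} [CommRing R] {k : ℕ} {d : Fin k → ℕ}

variable (d) in
/-- The minors of the deformed scroll matrix, over any ring. -/
def scrollMinor (ζ : Fin k → ℕ → R) (α β : Col d) : MvPolynomial (ZVar d) R :=
  X α.top * (X β.bot + C (ζ β.1 (β.2 + 1))) - (X α.bot + C (ζ α.1 (α.2 + 1))) * X β.top

variable (d) in
/-- The ideal of the deformed scroll. -/
def scrollIdeal (ζ : Fin k → ℕ → R) : Ideal (MvPolynomial (ZVar d) R) :=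
  Ideal.span {g | ∃ α β, g = scrollMinor d ζ α β}

lemma scrollMinor_mem (ζ : Fin k → ℕ → R) (α β : Col d) : scrollMinor d ζ α β ∈ scrollIdeal d ζ :=
  Ideal.subset_span ⟨α, β, rfl⟩

/-- Parametrisation of the chart `s = 1` of the deformed scroll. -/
def chart (ζ : Fin k → ℕ → R) : MvPolynomial (ZVar d) R →ₐ[R] MvPolynomial (CoxVar k) R :=
  aeval fun z => X (Sum.inr z.1) * X (tVar k) ^ (z.2 : ℕ) -
    ∑ c ∈ Finset.range z.2, C (ζ z.1 (c + 1)) * X (tVar k) ^ ((z.2 : ℕ) - 1 - c)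

lemma chart_X (ζ : Fin k → ℕ → R) (z : ZVar d) :
    chart ζ (X z) = X (Sum.inr z.1) * X (tVar k) ^ (z.2 : ℕ) -
      ∑ c ∈ Finset.range z.2, C (ζ z.1 (c + 1)) * X (tVar k) ^ ((z.2 : ℕ) - 1 - c) :=
  aeval_X _ _

lemma chart_C (ζ : Fin k → ℕ → R) (r : R) : chart (d := d) ζ (C r) = C r :=
  aeval_C _ _

lemma chart_zero_X (z : ZVar d) :
    chart (0 : Fin k → ℕ → R) (X z) = X (Sum.inr z.1) * X (tVar k) ^ (z.2 : ℕ) := by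
  simp [chart_X]

lemma chart_bot (ζ : Fin k → ℕ → R) (α : Col d) :
    chart ζ (X α.bot) + C (ζ α.1 (α.2 + 1)) = X (tVar k) * chart ζ (X α.top) := by
  have hshift : ∑ c ∈ Finset.range (α.2 : ℕ), C (ζ α.1 (c + 1)) * X (tVar k) ^ ((α.2 : ℕ) - c) =
      X (tVar k) * ∑ c ∈ Finset.range (α.2 : ℕ),
        C (ζ α.1 (c + 1)) * X (tVar k) ^ ((α.2 : ℕ) - 1 - c) := by
    rw [Finset.mul_sum]
    refine Finset.sum_congr rfl fun c hc => ?_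
    rw [Finset.mem_range] at hc
    rw [mul_left_comm, ← pow_succ', show (α.2 : ℕ) - 1 - c + 1 = α.2 - c by omega]
  simp only [chart_X, Col.bot, Col.top, Fin.val_succ, Fin.val_castSucc, Finset.sum_range_succ,
    add_tsub_cancel_right, tsub_self, pow_zero, mul_one, hshift]
  ring

lemma chart_eq_zero_of_mem (ζ : Fin k → ℕ → R) {x : MvPolynomial (ZVar d) R}
    (hx : x ∈ scrollIdeal d ζ) : chart ζ x = 0 := by
  rw [← RingHom.mem_ker]
  refine (Ideal.span_le (I := RingHom.ker (chart ζ))).2 ?_ hx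
  rintro _ ⟨α, β, rfl⟩
  rw [SetLike.mem_coe, RingHom.mem_ker, scrollMinor, map_sub, map_mul, map_mul, map_add, map_add,
    chart_C, chart_C, chart_bot, chart_bot]
  ring

lemma chart_zero_monomial (u : ZVar d →₀ ℕ) (r : R) :
    chart (0 : Fin k → ℕ → R) (monomial u r) = monomial (chartExponent u) r := by
  refine algHom_monomial (fun z => ?_) u r
  rw [chart_zero_X, X_pow_eq_monomial, X, monomial_mul]
  simp [chartExponent]

lemma sum_mem_of_sum_chart_eq_zero {b : ℕ} {M : Type*} [AddCommGroup M] [Module R M]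
    {W : Submodule R M} (ε : Fin (b + 1) → MvPolynomial (ZVar d) R →ₗ[R] M)
    {h : Fin (b + 1) → MvPolynomial (ZVar d) R}
    (hzero : ∑ m, chart (0 : Fin k → ℕ → R) (h m) * X (tVar k) ^ (m : ℕ) = 0)
    (hW : ∀ x y, x.2 ∈ (h x.1).support → Linked d b x y →
      ε x.1 (monomial x.2 1) - ε y.1 (monomial y.2 1) ∈ W) :
    ∑ m, ε m (h m) ∈ W := by
  have hterm : ∑ m, ε m (h m) = ∑ x ∈ Finset.univ.sigma fun m => (h m).support,
      coeff x.2 (h x.1) • ε x.1 (monomial x.2 1) := by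
    rw [Finset.sum_sigma]
    refine Finset.sum_congr rfl fun m _ => ?_
    conv_lhs => rw [(h m).as_sum, map_sum]
    exact Finset.sum_congr rfl fun u _ => by
      rw [← map_smul, smul_monomial, smul_eq_mul, mul_one]
  rw [hterm]
  refine sum_smul_mem_of_sum_monomial_eq_zero
    (π := fun x => chartExponent x.2 + Finsupp.single (tVar k) (x.1 : ℕ)) ?_
    fun x hx y _ hxy => hW (x.1, x.2) (y.1, y.2) (Finset.mem_sigma.1 hx).2
      (linked_of_chartExponent_eq hxy)
  rw [← hzero, Finset.sum_sigma]
  refine Finset.sum_congr rfl fun m _ => ?_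
  conv_rhs => rw [(h m).as_sum, map_sum, Finset.sum_mul]
  refine Finset.sum_congr rfl fun u _ => ?_
  rw [chart_zero_monomial, X_pow_eq_monomial, monomial_mul, mul_one]

theorem mem_scrollIdeal_of_chart {x : MvPolynomial (ZVar d) R}
    (hx : chart (0 : Fin k → ℕ → R) x = 0) : x ∈ scrollIdeal d (0 : Fin k → ℕ → R) := by
  have hsum := sum_mem_of_sum_chart_eq_zero (b := 0) (h := fun _ => x)
    (W := (scrollIdeal d (0 : Fin k → ℕ → R)).restrictScalars R) (fun _ => LinearMap.id)
    (by simpa using hx) fun _ _ _ hlink => (sub_mem_of_eqvGen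
      (W := fun _ => (scrollIdeal d (0 : Fin k → ℕ → R)).restrictScalars R)
      (e := fun x : Fin 1 × (ZVar d →₀ ℕ) => (monomial x.2 1 : MvPolynomial (ZVar d) R))
      (fun _ _ _ => rfl) ?_ hlink).2
  · simpa using hsum
  intro _ _ hmove
  cases hmove with
  | swap m u α β =>
    rw [Submodule.restrictScalars_mem]
    convert Ideal.mul_mem_left _ (monomial u 1) (scrollMinor_mem (0 : Fin k → ℕ → R) α β) using 1
    simp only [scrollMinor, Pi.zero_apply, C_0, add_zero, monomial_add_single, pow_one]
    ring
  | roll m => exact m.elim0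

/-- The degree in the `z^(i)`. -/
def fibreWeight (k : ℕ) : CoxVar k → ℕ := Sum.elim (fun _ => 0) (fun _ => 1)

lemma fibreComponent_chart_mul_X (ζ : Fin k → ℕ → R) (p : MvPolynomial (ZVar d) R) (z : ZVar d)
    (e : ℕ) : ∃ q, weightedHomogeneousComponent (fibreWeight k) (e + 1) (chart ζ (p * X z)) =
      weightedHomogeneousComponent (fibreWeight k) e (chart ζ p) * chart 0 (X z) -
      weightedHomogeneousComponent (fibreWeight k) (e + 1) (chart ζ p) * q := by
  have hlead : IsWeightedHomogeneous (fibreWeight k)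
      (X (Sum.inr z.1) * X (tVar k) ^ (z.2 : ℕ) : MvPolynomial (CoxVar k) R) 1 := by
    simpa [fibreWeight, tVar] using (isWeightedHomogeneous_X R (fibreWeight k) (Sum.inr z.1)).mul
      ((isWeightedHomogeneous_X R (fibreWeight k) (tVar k)).pow z.2)
  have htail : IsWeightedHomogeneous (fibreWeight k) (∑ c ∈ Finset.range z.2,
      C (ζ z.1 (c + 1)) * X (tVar k) ^ ((z.2 : ℕ) - 1 - c) : MvPolynomial (CoxVar k) R) 0 := by
    refine IsWeightedHomogeneous.sum _ _ _ fun c _ => ?_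
    simpa [fibreWeight, tVar] using ((isWeightedHomogeneous_X R (fibreWeight k) (tVar k)).pow
      ((z.2 : ℕ) - 1 - c)).C_mul (ζ z.1 (c + 1))
  refine ⟨∑ c ∈ Finset.range z.2, C (ζ z.1 (c + 1)) * X (tVar k) ^ ((z.2 : ℕ) - 1 - c), ?_⟩
  rw [map_mul, chart_X, chart_zero_X, mul_sub, map_sub, weightedHomogeneousComponent_add_mul hlead,
    ← weightedHomogeneousComponent_add_mul (a := e + 1) htail, add_zero]

lemma fibreComponent_chart_monomial (ζ : Fin k → ℕ → R) {u : ZVar d →₀ ℕ} (r : R) {e : ℕ}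
    (hu : u.degree ≤ e) :
    weightedHomogeneousComponent (fibreWeight k) e (chart ζ (monomial u r)) =
      chart 0 (homogeneousComponent e (monomial u r)) := by
  classical
  induction hn : u.degree generalizing u e with
  | zero =>
    obtain rfl : u = 0 := (Finsupp.degree_eq_zero_iff u).1 hn
    change weightedHomogeneousComponent _ e (chart ζ (C r)) =
      chart 0 (homogeneousComponent e (C r))
    rw [chart_C, weightedHomogeneousComponent_of_mem (isWeightedHomogeneous_C _ r),
      homogeneousComponent_of_mem (isHomogeneous_C _ r), apply_ite (chart 0), chart_C, map_zero]
  | succ n ih =>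
    obtain ⟨z, hz⟩ := Finsupp.ne_iff.1 (show u ≠ 0 by rintro rfl; simp at hn)
    obtain ⟨v, rfl⟩ := exists_eq_add_single hz
    obtain ⟨e, rfl⟩ : ∃ e', e = e' + 1 := ⟨e - 1, by omega⟩
    simp only [map_add, Finsupp.degree_single, Nat.add_left_inj] at hn
    rw [map_add, Finsupp.degree_single] at hu
    have hv : (monomial v r : MvPolynomial (ZVar d) R).IsHomogeneous n :=
      isHomogeneous_monomial _ hn
    obtain ⟨q, hq⟩ := fibreComponent_chart_mul_X ζ (monomial v r) z e
    rw [monomial_add_single, pow_one, hq, ih (by omega) hn, ih (by omega) hn,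
      homogeneousComponent_of_mem hv (m := e + 1), if_neg (by omega), map_zero, zero_mul, sub_zero,
      homogeneousComponent_add_mul (isHomogeneous_X _ _), map_mul]

lemma fibreComponent_chart (ζ : Fin k → ℕ → R) {x : MvPolynomial (ZVar d) R} {e : ℕ}
    (hx : x ∈ degreeLT R (ZVar d) (e + 1)) :
    weightedHomogeneousComponent (fibreWeight k) e (chart ζ x) =
      chart 0 (homogeneousComponent e x) := by
  rw [x.as_sum]
  simp only [map_sum]
  exact Finset.sum_congr rfl fun u hu => fibreComponent_chart_monomial ζ _
    (Nat.le_of_lt_succ (mem_degreeLT.1 hx u (mem_support_iff.1 hu)))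

theorem homogeneousComponent_mem_scrollIdeal (ζ : Fin k → ℕ → R) {x : MvPolynomial (ZVar d) R}
    {e : ℕ} (hx : x ∈ scrollIdeal d ζ) (hdeg : x ∈ degreeLT R (ZVar d) (e + 1)) :
    homogeneousComponent e x ∈ scrollIdeal d (0 : Fin k → ℕ → R) := by
  refine mem_scrollIdeal_of_chart ?_
  rw [← fibreComponent_chart ζ hdeg, chart_eq_zero_of_mem ζ hx, map_zero]

end Chart

/-! ### Relations between the additional equations that lift -/

section Restriction

variable {R : Type*} [CommRing R] {k : ℕ} {d : Fin k → ℕ}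

/-- The exponent of the restriction of a monomial to the scroll. -/
def coxExponent : (ZVar d →₀ ℕ) →+ (CoxVar k →₀ ℕ) :=
  (Finsupp.mapDomain.addMonoidHom Sum.inr).comp content +
    (Finsupp.singleAddHom (sVar k)).comp (Finsupp.weight fun z => d z.1 - (z.2 : ℕ)) +
    (Finsupp.singleAddHom (tVar k)).comp tExponent

lemma coxExponent_single (z : ZVar d) :
    coxExponent (Finsupp.single z 1) = Finsupp.single (Sum.inr z.1) 1 +
      Finsupp.single (sVar k) (d z.1 - (z.2 : ℕ)) + Finsupp.single (tVar k) (z.2 : ℕ) := by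
  simp [coxExponent, Finsupp.weight_single]

lemma toCox_monomial (u : ZVar d →₀ ℕ) (r : R) :
    toCox R d (monomial u r) = monomial (coxExponent u) r := by
  refine algHom_monomial (fun z => ?_) u r
  rw [toCox, aeval_X, coxExponent_single, X_pow_eq_monomial, X_pow_eq_monomial, X, monomial_mul,
    monomial_mul, one_mul, one_mul]

lemma weight_coxExponent (u : ZVar d →₀ ℕ) :
    Finsupp.weight (bidegree d) (coxExponent u) = ((u.degree : ℤ), (0 : ℤ)) := by
  induction u using Finsupp.induction_linear with
  | zero => simp only [map_zero, Nat.cast_zero, Prod.mk_zero_zero]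
  | add u v hu hv => rw [map_add, map_add, hu, hv, map_add]; simp
  | single z n =>
    have hz : (z.2 : ℕ) ≤ d z.1 := Nat.lt_succ_iff.1 z.2.2
    have hsingle : Finsupp.weight (bidegree d) (coxExponent (Finsupp.single z 1)) =
        ((1 : ℤ), (0 : ℤ)) := by
      rw [coxExponent_single]
      simp only [map_add, Finsupp.weight_single]
      refine Prod.ext (by simp [bidegree, sVar, tVar]) ?_
      simp [bidegree, sVar, tVar, Nat.cast_sub hz, add_assoc]
    rw [← Finsupp.smul_single_one, map_nsmul, map_nsmul, hsingle]
    simp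

lemma degree_eq_of_mem_support {σ : Type*} {p : MvPolynomial σ R} {q : ℕ} (hp : p.IsHomogeneous q)
    {u : σ →₀ ℕ} (hu : u ∈ p.support) : u.degree = q := by
  rw [Finsupp.degree_eq_weight_one (R := ℕ)]
  exact hp (mem_support_iff.1 hu)

lemma toCox_isWeightedHomogeneous {p : MvPolynomial (ZVar d) R} {q : ℕ} (hp : p.IsHomogeneous q) :
    IsWeightedHomogeneous (bidegree d) (toCox R d p) ((q : ℤ), (0 : ℤ)) := by
  rw [p.as_sum, map_sum]
  refine IsWeightedHomogeneous.sum _ _ _ fun u hu => ?_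
  rw [toCox_monomial]
  refine isWeightedHomogeneous_monomial _ _ _ ?_
  rw [weight_coxExponent, degree_eq_of_mem_support hp hu]

lemma single_add_single_eq_of_fibre_eq_zero {e : CoxVar k →₀ ℕ} {r : ℕ}
    (h0 : ∀ i, e (Sum.inr i) = 0) (hr : e (sVar k) + e (tVar k) = r) :
    Finsupp.single (sVar k) (r - e (tVar k)) + Finsupp.single (tVar k) (e (tVar k)) = e := by
  refine Finsupp.ext (Sum.forall.2 ⟨Fin.forall_fin_two.2 ⟨?_, ?_⟩, fun i => ?_⟩)
  · change _ = e (sVar k)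
    rw [← hr]
    simp [sVar, tVar]
  · change _ = e (tVar k)
    simp [sVar, tVar]
  · simp [sVar, tVar, h0]

lemma exists_coxExponent_single_le {e : CoxVar k →₀ ℕ} {i : Fin k} (hi : e (Sum.inr i) ≠ 0)
    (h : d i ≤ e (sVar k) + e (tVar k)) :
    ∃ j, coxExponent (Finsupp.single (⟨i, j⟩ : ZVar d) 1) ≤ e := by
  classical
  refine ⟨⟨min (e (tVar k)) (d i), by omega⟩, ?_⟩
  rw [coxExponent_single]
  refine Sum.forall.2 ⟨Fin.forall_fin_two.2 ⟨?_, ?_⟩, fun i' => ?_⟩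
  · change _ ≤ e (sVar k)
    simp [sVar, tVar] at h ⊢
    omega
  · change _ ≤ e (tVar k)
    simp [sVar, tVar]
  · by_cases hii : i = i'
    · subst hii
      simpa [sVar, tVar, Nat.one_le_iff_ne_zero] using hi
    · simp [sVar, tVar, hii]

lemma exists_coxExponent_add_eq {e : CoxVar k →₀ ℕ} {q r : ℕ}
    (he : Finsupp.weight (bidegree d) e = ((q : ℤ), (r : ℤ))) :
    ∃ u : ZVar d →₀ ℕ, ∃ m : Fin (r + 1), u.degree = q ∧
      coxExponent u + (Finsupp.single (sVar k) (r - m) + Finsupp.single (tVar k) (m : ℕ)) = e := by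
  induction q generalizing e with
  | zero =>
    rw [weight_bidegree, Prod.mk.injEq] at he
    have h0 : ∀ i, e (Sum.inr i) = 0 := by
      have hsum := he.1
      norm_cast at hsum
      simpa using hsum
    have hr : e (sVar k) + e (tVar k) = r := by
      have hdiff := he.2
      simp only [h0, Nat.cast_zero, mul_zero, Finset.sum_const_zero, sub_zero] at hdiff
      exact_mod_cast hdiff
    exact ⟨0, ⟨e (tVar k), by omega⟩, map_zero _, by
      rw [map_zero, zero_add, single_add_single_eq_of_fibre_eq_zero h0 hr]⟩
  | succ q ih =>
    have hw := he
    rw [weight_bidegree, Prod.mk.injEq] at hw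
    obtain ⟨i, hi⟩ : ∃ i, e (Sum.inr i) ≠ 0 := by
      by_contra! hzero
      simp [hzero] at hw
      omega
    have hle : (d i : ℤ) ≤ ∑ i, (d i : ℤ) * e (Sum.inr i) :=
      (le_mul_of_one_le_right (by positivity) (by omega)).trans <| Finset.single_le_sum
        (f := fun i => (d i : ℤ) * e (Sum.inr i)) (fun _ _ => by positivity) (Finset.mem_univ i)
    obtain ⟨j, hj⟩ := exists_coxExponent_single_le hi (d := d) (by omega)
    obtain ⟨f, rfl⟩ := exists_add_of_le hj
    rw [map_add, weight_coxExponent, Finsupp.degree_single] at he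
    obtain ⟨u, m, hu, hum⟩ := ih (e := f) (by
      rw [← add_right_inj, he]; simp [add_comm])
    refine ⟨Finsupp.single ⟨i, j⟩ 1 + u, m, by simp [hu, add_comm], ?_⟩
    rw [map_add, add_assoc, hum]

theorem exists_eq_sum_toCox_mul {G : MvPolynomial (CoxVar k) R} {q r : ℕ}
    (hG : IsWeightedHomogeneous (bidegree d) G ((q : ℤ), (r : ℤ))) :
    ∃ g : Fin (r + 1) → MvPolynomial (ZVar d) R, (∀ m, (g m).IsHomogeneous q) ∧
      G = ∑ m, toCox R d (g m) * (X (sVar k) ^ (r - (m : ℕ)) * X (tVar k) ^ (m : ℕ)) := by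
  classical
  choose! u m hu hum using fun e (he : e ∈ G.support) =>
    exists_coxExponent_add_eq (hG (mem_support_iff.1 he))
  refine ⟨fun m' => ∑ e ∈ G.support with m e = m', monomial (u e) (coeff e G), fun m' =>
    IsHomogeneous.sum _ _ _ fun e he =>
      isHomogeneous_monomial _ (hu e (Finset.mem_filter.1 he).1), ?_⟩
  conv_lhs => rw [G.as_sum, ← Finset.sum_fiberwise _ m]
  refine Finset.sum_congr rfl fun m' _ => ?_
  rw [map_sum, Finset.sum_mul]
  refine Finset.sum_congr rfl fun e he => ?_
  obtain ⟨hsupp, rfl⟩ := Finset.mem_filter.1 he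
  rw [toCox_monomial, X_pow_eq_monomial, X_pow_eq_monomial, monomial_mul, monomial_mul, mul_one,
    mul_one, hum e hsupp]

lemma eq_zero_of_bidegree_neg {G : MvPolynomial (CoxVar k) R} {w : ℤ × ℤ}
    (hG : IsWeightedHomogeneous (bidegree d) G w) (hw : w.1 < 0) : G = 0 := by
  by_contra hne
  obtain ⟨e, he⟩ := ne_zero_iff.1 hne
  rw [← hG he, weight_bidegree] at hw
  exact hw.not_ge (show (0 : ℤ) ≤ ∑ i, (e (Sum.inr i) : ℤ) from
    Finset.sum_nonneg fun _ _ => Int.natCast_nonneg _)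

lemma exists_toCox_top_bot (α : Col d) : ∃ w : MvPolynomial (CoxVar k) R,
    toCox R d (X α.top) = X (sVar k) * w ∧ toCox R d (X α.bot) = X (tVar k) * w := by
  have := α.2.2
  refine ⟨X (Sum.inr α.1) * X (sVar k) ^ (d α.1 - ((α.2 : ℕ) + 1)) * X (tVar k) ^ (α.2 : ℕ), ?_, ?_⟩
  · simp only [toCox, aeval_X, Col.top, Fin.val_castSucc]
    rw [show d α.1 - (α.2 : ℕ) = (d α.1 - ((α.2 : ℕ) + 1)) + 1 by omega]
    ring
  · simp only [toCox, aeval_X, Col.bot, Fin.val_succ]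
    ring

lemma toCox_eq_zero_of_mem_scrollIdeal {x : MvPolynomial (ZVar d) R}
    (hx : x ∈ scrollIdeal d (0 : Fin k → ℕ → R)) : toCox R d x = 0 := by
  rw [← RingHom.mem_ker]
  refine (Ideal.span_le (I := RingHom.ker (toCox R d))).2 ?_ hx
  rintro _ ⟨α, β, rfl⟩
  obtain ⟨w, htop, hbot⟩ := exists_toCox_top_bot (R := R) α
  obtain ⟨w', htop', hbot'⟩ := exists_toCox_top_bot (R := R) β
  rw [SetLike.mem_coe, RingHom.mem_ker, scrollMinor]
  simp only [Pi.zero_apply, C_0, add_zero, map_sub, map_mul, htop, hbot, htop', hbot']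
  ring

lemma sum_chart_eq_zero_of_sum_toCox_eq_zero {b : ℕ} {h : Fin (b + 1) → MvPolynomial (ZVar d) R}
    (hh : ∑ m, toCox R d (h m) * (X (sVar k) ^ (b - (m : ℕ)) * X (tVar k) ^ (m : ℕ)) = 0) :
    ∑ m, chart (0 : Fin k → ℕ → R) (h m) * X (tVar k) ^ (m : ℕ) = 0 := by
  -- the specialisation `s = 1`
  let φ : MvPolynomial (CoxVar k) R →ₐ[R] MvPolynomial (CoxVar k) R :=
    aeval (Sum.elim (fun j => if j = 0 then 1 else X (tVar k)) fun i => X (Sum.inr i))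
  have hs : φ (X (sVar k)) = 1 := by simp [φ, sVar]
  have ht : φ (X (tVar k)) = X (tVar k) := by simp [φ, tVar]
  have hφ : φ.comp (toCox R d) = chart 0 := by
    ext1 z
    rw [AlgHom.comp_apply, toCox, aeval_X, chart_zero_X, map_mul, map_mul, map_pow, map_pow, hs, ht]
    simp [φ]
  simpa only [map_sum, map_mul, map_pow, hs, ht, one_pow, one_mul, map_zero, ← AlgHom.comp_apply,
    hφ] using congrArg φ hh

lemma map_toCox {K : Type*} [CommRing K] [Algebra K R] (p : MvPolynomial (ZVar d) K) :
    map (algebraMap K R) (toCox K d p) = toCox R d (map (algebraMap K R) p) := by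
  rw [p.as_sum]
  simp only [map_sum, toCox_monomial, map_monomial]

end Restriction

namespace QuadricSystem

variable {K : Type*} [Field K] {k l : ℕ} (D : QuadricSystem K k l)
variable {R : Type*} [CommRing R]
variable (ζ : Fin k → ℕ → R) (E : Fin l → ℕ → MvPolynomial (ZVar D.d) R)

/-- Indices of the additional equations `P^(n)_m`. -/
abbrev EqnIdx : Type := (n : Fin l) × Fin (D.b n + 1)

/-- The combination of the equations `E` with given coefficients. -/
def combination : (D.EqnIdx → MvPolynomial (ZVar D.d) R) →ₗ[MvPolynomial (ZVar D.d) R]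
    MvPolynomial (ZVar D.d) R :=
  Fintype.linearCombination _ fun i : D.EqnIdx => E i.1 i.2

lemma combination_apply (h : D.EqnIdx → MvPolynomial (ZVar D.d) R) :
    D.combination E h = ∑ i, h i * E i.1 i.2 := rfl

lemma combination_single (i : D.EqnIdx) (p : MvPolynomial (ZVar D.d) R) :
    D.combination E (Pi.single i p) = p * E i.1 i.2 := by
  rw [combination, Fintype.linearCombination_apply_single, smul_eq_mul]

/-- The families of coefficients that become relations between the equations `E` on the deformed
scroll after adding terms of degree less than `q`. -/
def liftable (q : ℕ) : Submodule R (D.EqnIdx → MvPolynomial (ZVar D.d) R) where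
  carrier := {g | ∃ h : D.EqnIdx → MvPolynomial (ZVar D.d) R,
    (∀ i, h i - g i ∈ degreeLT R (ZVar D.d) q) ∧ D.combination E h ∈ scrollIdeal D.d ζ}
  add_mem' := by
    rintro g g' ⟨h, hg, hE⟩ ⟨h', hg', hE'⟩
    refine ⟨h + h', fun i => ?_, by rw [map_add]; exact add_mem hE hE'⟩
    rw [Pi.add_apply, Pi.add_apply, add_sub_add_comm]
    exact add_mem (hg i) (hg' i)
  zero_mem' := ⟨0, fun i => by simp, by simp⟩
  smul_mem' := by
    rintro c g ⟨h, hg, hE⟩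
    refine ⟨C c • h, fun i => ?_, by rw [map_smul]; exact Ideal.mul_mem_left _ _ hE⟩
    rw [Pi.smul_apply, Pi.smul_apply, smul_eq_mul, ← C_mul', ← mul_sub]
    exact C_mul_mem_degreeLT _ (hg i)

variable {D ζ E}

/-- The family of coefficients whose only nonzero entry is the monomial `x.2`, in the equation
`P^(n)_m` with `m = x.1`. -/
def termFamily (R : Type*) [CommRing R] {D : QuadricSystem K k l} (n : Fin l)
    (x : Fin (D.b n + 1) × (ZVar D.d →₀ ℕ)) : D.EqnIdx → MvPolynomial (ZVar D.d) R :=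
  Pi.single ⟨n, x.1⟩ (monomial x.2 1)

lemma single_sub_single_mem_degreeLT {q : ℕ} {j : D.EqnIdx} {p p' : MvPolynomial (ZVar D.d) R}
    (h : p - p' ∈ degreeLT R (ZVar D.d) q) (i : D.EqnIdx) :
    (Pi.single j p : D.EqnIdx → _) i - (Pi.single j p' : D.EqnIdx → _) i ∈
      degreeLT R (ZVar D.d) q := by
  rw [← Pi.sub_apply, ← Pi.single_sub, Pi.single_apply]
  split_ifs
  · exact h
  · exact zero_mem _

lemma monomial_mul_C_mem_degreeLT (u : ZVar D.d →₀ ℕ) (r : R) :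
    monomial u 1 * C r ∈ degreeLT R (ZVar D.d) (u.degree + 1) := by
  rw [mul_comm]
  exact C_mul_mem_degreeLT _ (mem_degreeLT_of_isHomogeneous (isHomogeneous_monomial _ rfl))

variable [Algebra K R]

/-- A family of inhomogeneous equations over `R` with leading forms the `P^(n)_m`, compatible with
rolling factors on the deformed scroll. -/
structure IsRollingFamily (D : QuadricSystem K k l) (ζ : Fin k → ℕ → R)
    (E : Fin l → ℕ → MvPolynomial (ZVar D.d) R) : Prop where
  leading : ∀ n m, m ≤ D.b n → E n m - map (algebraMap K R) (D.eqn n m) ∈ degreeLT R (ZVar D.d) 2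
  roll : ∀ n m, m < D.b n → ∀ β : Col D.d,
    E n m * (X β.bot + C (ζ β.1 (β.2 + 1))) - E n (m + 1) * X β.top ∈ scrollIdeal D.d ζ

variable {n : Fin l}

omit [Algebra K R] in
lemma swap_mem_liftable (m : Fin (D.b n + 1)) (u : ZVar D.d →₀ ℕ) (α β : Col D.d) :
    termFamily R n (m, u + Finsupp.single α.top 1 + Finsupp.single β.bot 1) -
      termFamily R n (m, u + Finsupp.single α.bot 1 + Finsupp.single β.top 1) ∈
        D.liftable ζ E (u.degree + 2) := by
  have hX : ∀ z, (X z : MvPolynomial (ZVar D.d) R) ∈ degreeLT R (ZVar D.d) (1 + 1) := fun z =>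
    mem_degreeLT_of_isHomogeneous (isHomogeneous_X _ _)
  refine ⟨Pi.single (⟨n, m⟩ : D.EqnIdx) (monomial u 1 * scrollMinor D.d ζ α β), fun i => ?_, ?_⟩
  · rw [termFamily, termFamily, ← Pi.single_sub]
    refine single_sub_single_mem_degreeLT ?_ i
    rw [show u.degree + 2 = 1 + (u.degree + 1) by ring]
    convert sub_mem (mul_mem_degreeLT (hX α.top) (monomial_mul_C_mem_degreeLT u (ζ β.1 (β.2 + 1))))
      (mul_mem_degreeLT (hX β.top) (monomial_mul_C_mem_degreeLT u (ζ α.1 (α.2 + 1)))) using 1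
    simp only [monomial_add_single, pow_one, scrollMinor]
    ring
  · rw [combination_single, mul_right_comm]
    exact Ideal.mul_mem_left _ _ (scrollMinor_mem ζ α β)

lemma roll_mem_liftable (hE : D.IsRollingFamily ζ E) (m : Fin (D.b n)) (u : ZVar D.d →₀ ℕ)
    (α : Col D.d) :
    termFamily R n (m.castSucc, u + Finsupp.single α.bot 1) -
      termFamily R n (m.succ, u + Finsupp.single α.top 1) ∈
        D.liftable ζ E (u.degree + 1) := by
  refine ⟨Pi.single (⟨n, m.castSucc⟩ : D.EqnIdx) (monomial u 1 * (X α.bot + C (ζ α.1 (α.2 + 1)))) -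
    Pi.single (⟨n, m.succ⟩ : D.EqnIdx) (monomial u 1 * X α.top), fun i => ?_, ?_⟩
  · rw [termFamily, termFamily, monomial_add_single, monomial_add_single, pow_one, pow_one,
      Pi.sub_apply, Pi.sub_apply, sub_sub_sub_cancel_right]
    refine single_sub_single_mem_degreeLT ?_ i
    rw [mul_add, add_sub_cancel_left]
    exact monomial_mul_C_mem_degreeLT _ _
  · rw [map_sub, combination_single, combination_single]
    convert Ideal.mul_mem_left _ (monomial u 1) (hE.roll n m m.2 α) using 1
    simp only [Fin.val_castSucc, Fin.val_succ]
    ring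

lemma termFamily_sub_mem_liftable_of_move (hE : D.IsRollingFamily ζ E)
    {x y : Fin (D.b n + 1) × (ZVar D.d →₀ ℕ)} (h : Move D.d (D.b n) x y) :
    termFamily R n x - termFamily R n y ∈ D.liftable ζ E x.2.degree := by
  cases h with
  | swap m u α β =>
    have hdeg : (u + Finsupp.single α.top 1 + Finsupp.single β.bot 1).degree = u.degree + 2 := by
      simp only [map_add, Finsupp.degree_single]
    rw [hdeg]
    exact swap_mem_liftable m u α β
  | roll m u α =>
    rw [map_add, Finsupp.degree_single]
    exact roll_mem_liftable hE m u α

lemma termFamily_sub_mem_liftable (hE : D.IsRollingFamily ζ E)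
    {x y : Fin (D.b n + 1) × (ZVar D.d →₀ ℕ)} (h : Linked D.d (D.b n) x y) :
    termFamily R n x - termFamily R n y ∈ D.liftable ζ E x.2.degree :=
  (sub_mem_of_eqvGen (r := Move D.d (D.b n)) (e := termFamily R n)
    (W := fun x : Fin (D.b n + 1) × (ZVar D.d →₀ ℕ) => D.liftable ζ E x.2.degree)
    (fun _ _ h => by rw [Linked.degree_eq (.rel _ _ h)])
    (fun _ _ h => termFamily_sub_mem_liftable_of_move hE h) h).2

theorem sum_single_mem_liftable (hE : D.IsRollingFamily ζ E) {q : ℕ}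
    {h : Fin (D.b n + 1) → MvPolynomial (ZVar D.d) R} (hq : ∀ m, (h m).IsHomogeneous q)
    (hrel : ∑ m, toCox R D.d (h m) * (X (sVar k) ^ (D.b n - (m : ℕ)) * X (tVar k) ^ (m : ℕ)) = 0) :
    (∑ m, Pi.single (⟨n, m⟩ : D.EqnIdx) (h m) : D.EqnIdx → MvPolynomial (ZVar D.d) R) ∈
      D.liftable ζ E q := by
  refine sum_mem_of_sum_chart_eq_zero (fun m => LinearMap.single R
    (fun _ : D.EqnIdx => MvPolynomial (ZVar D.d) R) ⟨n, m⟩)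
    (sum_chart_eq_zero_of_sum_toCox_eq_zero hrel) fun x y hx hlink => ?_
  rw [← degree_eq_of_mem_support (hq x.1) hx]
  exact termFamily_sub_mem_liftable hE hlink

end QuadricSystem

/-! ### Lifting of the relations on a complete intersection -/

namespace QuadricSystem

variable {K : Type*} [Field K] {k l : ℕ} {D : QuadricSystem K k l}
variable {R : Type*} [CommRing R] [Algebra K R] {ζ : Fin k → ℕ → R}
  {E : Fin l → ℕ → MvPolynomial (ZVar D.d) R}

/-- Extension of scalars for families of coefficients. -/
def mapFamily (D : QuadricSystem K k l) (R : Type*) [CommRing R] [Algebra K R] :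
    (D.EqnIdx → MvPolynomial (ZVar D.d) K) →+ (D.EqnIdx → MvPolynomial (ZVar D.d) R) :=
  (map (algebraMap K R)).toAddMonoidHom.compLeft _

lemma mapFamily_apply (h : D.EqnIdx → MvPolynomial (ZVar D.d) K) (i : D.EqnIdx) :
    D.mapFamily R h i = map (algebraMap K R) (h i) := rfl

lemma mapFamily_single (i : D.EqnIdx) (p : MvPolynomial (ZVar D.d) K) :
    D.mapFamily R (Pi.single i p) = Pi.single i (map (algebraMap K R) p) :=
  funext (Pi.apply_single (fun _ => map (algebraMap K R)) (fun _ => map_zero _) i p)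

/-- The section `∑_m h_m s^{b-m} t^m` of a family of coefficients for the equations `P^(n)_m`. -/
def sectionOf (D : QuadricSystem K k l) (n : Fin l) :
    (D.EqnIdx → MvPolynomial (ZVar D.d) K) →ₗ[K] MvPolynomial (CoxVar k) K :=
  ∑ m : Fin (D.b n + 1),
    LinearMap.mulRight K (X (sVar k) ^ (D.b n - (m : ℕ)) * X (tVar k) ^ (m : ℕ)) ∘ₗ
      (toCox K D.d).toLinearMap ∘ₗ LinearMap.proj ⟨n, m⟩

lemma sectionOf_apply (n : Fin l) (h : D.EqnIdx → MvPolynomial (ZVar D.d) K) :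
    D.sectionOf n h = ∑ m : Fin (D.b n + 1), toCox K D.d (h ⟨n, m⟩) *
      (X (sVar k) ^ (D.b n - (m : ℕ)) * X (tVar k) ^ (m : ℕ)) := by
  simp [sectionOf, mul_assoc]

lemma sectionOf_eq_zero {n : Fin l} {h : D.EqnIdx → MvPolynomial (ZVar D.d) K}
    (h0 : ∀ m, h ⟨n, m⟩ = 0) : D.sectionOf n h = 0 := by
  simp [sectionOf_apply, h0]

lemma sectionOf_single (n : Fin l) (m : Fin (D.b n + 1)) (p : MvPolynomial (ZVar D.d) K) :
    D.sectionOf n (Pi.single ⟨n, m⟩ p) =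
      toCox K D.d p * (X (sVar k) ^ (D.b n - (m : ℕ)) * X (tVar k) ^ (m : ℕ)) := by
  rw [sectionOf_apply, Finset.sum_eq_single m]
  · rw [Pi.single_eq_same]
  · intro m' _ h
    rw [Pi.single_eq_of_ne (by simpa using h), map_zero, zero_mul]
  · simp

lemma sectionOf_single_of_ne {n : Fin l} {i : D.EqnIdx} (h : n ≠ i.1)
    (p : MvPolynomial (ZVar D.d) K) : D.sectionOf n (Pi.single i p) = 0 :=
  sectionOf_eq_zero fun _ => Pi.single_eq_of_ne (fun hi => h (congrArg Sigma.fst hi)) _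

lemma toCox_combination (h : D.EqnIdx → MvPolynomial (ZVar D.d) K) :
    toCox K D.d (D.combination D.eqn h) = ∑ n, D.sectionOf n h * D.P n := by
  rw [combination_apply, map_sum, Fintype.sum_sigma]
  refine Finset.sum_congr rfl fun n _ => ?_
  rw [sectionOf_apply, Finset.sum_mul]
  refine Finset.sum_congr rfl fun m _ => ?_
  rw [map_mul, D.toCox_eqn n m (by omega)]
  ring

lemma sectionOf_homogeneous {h : D.EqnIdx → MvPolynomial (ZVar D.d) K} {q : ℕ}
    (hq : ∀ i, (h i).IsHomogeneous q) (n : Fin l) :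
    IsWeightedHomogeneous (bidegree D.d) (D.sectionOf n h) ((q : ℤ), (D.b n : ℤ)) := by
  rw [sectionOf_apply]
  refine IsWeightedHomogeneous.sum _ _ _ fun m _ => ?_
  have hm : (m : ℕ) ≤ D.b n := by omega
  have hdeg : ((q : ℤ), (D.b n : ℤ)) =
      ((q : ℤ), 0) + ((D.b n - (m : ℕ)) • (0, 1) + (m : ℕ) • (0, 1)) := by
    simp [Nat.cast_sub hm]
  rw [hdeg]
  exact (toCox_isWeightedHomogeneous (hq ⟨n, m⟩)).mul
    (((isWeightedHomogeneous_sVar D.d).pow _).mul ((isWeightedHomogeneous_tVar D.d).pow _))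

/-- The Koszul relation between two equations, multiplied by `g`. -/
def koszul (i j : D.EqnIdx) (g : MvPolynomial (ZVar D.d) K) :
    D.EqnIdx → MvPolynomial (ZVar D.d) K :=
  Pi.single i (g * D.eqn j.1 j.2) - Pi.single j (g * D.eqn i.1 i.2)

lemma combination_koszul (i j : D.EqnIdx) (g : MvPolynomial (ZVar D.d) K) :
    D.combination D.eqn (koszul i j g) = 0 := by
  rw [koszul, map_sub, combination_single, combination_single]
  ring

lemma koszul_homogeneous (i j : D.EqnIdx) {g : MvPolynomial (ZVar D.d) K} {q : ℕ}
    (hg : g.IsHomogeneous q) (x : D.EqnIdx) : (koszul i j g x).IsHomogeneous (q + 2) := by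
  have hsingle : ∀ i j : D.EqnIdx, ((Pi.single i (g * D.eqn j.1 j.2) :
      D.EqnIdx → MvPolynomial (ZVar D.d) K) x).IsHomogeneous (q + 2) := fun i j => by
    rw [Pi.single_apply]
    split_ifs
    · exact hg.mul (D.eqn_homogeneous _ _ (Nat.lt_succ_iff.1 j.2.2))
    · exact isHomogeneous_zero _ _ _
  exact (hsingle i j).sub (hsingle j i)

lemma mapFamily_koszul_mem_liftable (hE : D.IsRollingFamily ζ E) (i j : D.EqnIdx)
    {g : MvPolynomial (ZVar D.d) K} {q : ℕ} (hg : g.IsHomogeneous q) :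
    D.mapFamily R (koszul i j g) ∈ D.liftable ζ E (q + 2) := by
  have hlead : ∀ i : D.EqnIdx, map (algebraMap K R) g * E i.1 i.2 -
      map (algebraMap K R) (g * D.eqn i.1 i.2) ∈ degreeLT R (ZVar D.d) (q + 2) := fun i => by
    rw [map_mul, ← mul_sub]
    exact mul_mem_degreeLT (mem_degreeLT_of_isHomogeneous (hg.map _))
      (hE.leading _ _ (Nat.lt_succ_iff.1 i.2.2))
  refine ⟨Pi.single i (map (algebraMap K R) g * E j.1 j.2) -
    Pi.single j (map (algebraMap K R) g * E i.1 i.2), fun x => ?_, ?_⟩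
  · rw [koszul, map_sub, mapFamily_single, mapFamily_single, Pi.sub_apply, Pi.sub_apply,
      sub_sub_sub_comm]
    exact sub_mem (single_sub_single_mem_degreeLT (hlead j) x)
      (single_sub_single_mem_degreeLT (hlead i) x)
  · rw [map_sub, combination_single, combination_single, mul_right_comm, sub_self]
    exact zero_mem _

/-- The Koszul relations, of degree `q`, between the equations `P^(n₀)_m` and the preceding ones. -/
def koszulRelations (D : QuadricSystem K k l) (n₀ : Fin l) (q : ℕ) :
    AddSubgroup (D.EqnIdx → MvPolynomial (ZVar D.d) K) :=
  .closure {κ | ∃ m j g q', j.1 < n₀ ∧ g.IsHomogeneous q' ∧ q' + 2 = q ∧ κ = koszul ⟨n₀, m⟩ j g}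

section KoszulRelations

variable {n₀ : Fin l} {q : ℕ} {κ : D.EqnIdx → MvPolynomial (ZVar D.d) K}

lemma combination_eq_zero_of_mem_koszulRelations (hκ : κ ∈ D.koszulRelations n₀ q) :
    D.combination D.eqn κ = 0 := by
  refine (AddSubgroup.closure_le (D.combination D.eqn).toAddMonoidHom.ker).2 ?_ hκ
  rintro _ ⟨m, j, g, q', -, -, -, rfl⟩
  exact combination_koszul _ _ g

lemma isHomogeneous_of_mem_koszulRelations (hκ : κ ∈ D.koszulRelations n₀ q) (i : D.EqnIdx) :
    (κ i).IsHomogeneous q := by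
  refine (AddSubgroup.closure_le ((homogeneousSubmodule (ZVar D.d) K q).toAddSubgroup.comap
    (Pi.evalAddMonoidHom _ i))).2 ?_ hκ
  rintro _ ⟨m, j, g, q', -, hg, rfl, rfl⟩
  exact koszul_homogeneous _ _ hg i

lemma apply_eq_zero_of_mem_koszulRelations (hκ : κ ∈ D.koszulRelations n₀ q) {i : D.EqnIdx}
    (hi : n₀ < i.1) : κ i = 0 := by
  refine (AddSubgroup.closure_le (Pi.evalAddMonoidHom _ i).ker).2 ?_ hκ
  rintro _ ⟨m, j, g, q', hj, -, -, rfl⟩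
  have hn₀ : i ≠ ⟨n₀, m⟩ := fun h => hi.ne' (congrArg Sigma.fst h)
  have hij : i ≠ j := fun h => (hj.trans hi).ne' (congrArg Sigma.fst h)
  rw [SetLike.mem_coe, AddMonoidHom.mem_ker, Pi.evalAddMonoidHom_apply, koszul, Pi.sub_apply,
    Pi.single_eq_of_ne hn₀, Pi.single_eq_of_ne hij, sub_zero]

lemma mapFamily_mem_liftable_of_mem_koszulRelations (hE : D.IsRollingFamily ζ E)
    (hκ : κ ∈ D.koszulRelations n₀ q) : D.mapFamily R κ ∈ D.liftable ζ E q := by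
  refine (AddSubgroup.closure_le
    ((D.liftable ζ E q).toAddSubgroup.comap (D.mapFamily R))).2 ?_ hκ
  rintro _ ⟨m, j, g, q', -, hg, rfl, rfl⟩
  exact mapFamily_koszul_mem_liftable hE _ _ hg

end KoszulRelations

lemma sectionOf_koszul {n₀ n : Fin l} (hn : n < n₀) (m₀ : Fin (D.b n₀ + 1)) (m : Fin (D.b n + 1))
    (g : MvPolynomial (ZVar D.d) K) :
    D.sectionOf n₀ (koszul ⟨n₀, m₀⟩ ⟨n, m⟩ g) = toCox K D.d g *
      (X (sVar k) ^ (D.b n - (m : ℕ) + (D.b n₀ - (m₀ : ℕ))) *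
        X (tVar k) ^ ((m : ℕ) + (m₀ : ℕ))) * D.P n := by
  rw [koszul, map_sub, sectionOf_single, sectionOf_single_of_ne hn.ne', sub_zero, map_mul,
    D.toCox_eqn n m (Nat.lt_succ_iff.1 m.2), pow_add, pow_add]
  ring

lemma exists_mem_koszulRelations_of_eq_mul {n n₀ : Fin l} (hn : n < n₀) {q : ℕ}
    {c : MvPolynomial (CoxVar k) K}
    (hc : IsWeightedHomogeneous (bidegree D.d) c ((q : ℤ) - 2, (D.b n₀ : ℤ) + D.b n)) :
    ∃ κ ∈ D.koszulRelations n₀ q, D.sectionOf n₀ κ = c * D.P n := by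
  rcases lt_or_ge q 2 with hq | hq
  · exact ⟨0, zero_mem _, by
      rw [map_zero, eq_zero_of_bidegree_neg hc (by dsimp only; omega), zero_mul]⟩
  obtain ⟨q, rfl⟩ := Nat.exists_eq_add_of_le' hq
  obtain ⟨g, hg, hcg⟩ := exists_eq_sum_toCox_mul (q := q) (r := D.b n₀ + D.b n) (G := c)
    (by simpa using hc)
  refine ⟨∑ M : Fin (D.b n₀ + D.b n + 1), koszul ⟨n₀, ⟨(M : ℕ) - min (M : ℕ) (D.b n), by omega⟩⟩
    ⟨n, ⟨min (M : ℕ) (D.b n), by omega⟩⟩ (g M),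
    sum_mem fun M _ => AddSubgroup.subset_closure ⟨_, _, g M, q, hn, hg M, rfl, rfl⟩, ?_⟩
  rw [map_sum, hcg, Finset.sum_mul]
  refine Finset.sum_congr rfl fun M _ => ?_
  rw [sectionOf_koszul hn]
  congr 4 <;> dsimp only <;> omega

lemma exists_mem_koszulRelations_of_mem_initialIdeal (n₀ : Fin l) {q : ℕ}
    {H : MvPolynomial (CoxVar k) K}
    (hH : IsWeightedHomogeneous (bidegree D.d) H ((q : ℤ), (D.b n₀ : ℤ)))
    (hmem : H ∈ initialIdeal D.P n₀) :
    ∃ κ ∈ D.koszulRelations n₀ q, D.sectionOf n₀ κ = H := by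
  have hspan : initialIdeal D.P n₀ = Ideal.span (Set.range fun n : Set.Iio n₀ => D.P n) :=
    congrArg Ideal.span (Set.ext fun f => by
      simp only [Set.mem_ofPred_eq, Set.mem_range, Subtype.exists, Set.mem_Iio, Fin.lt_def,
        exists_prop, eq_comm])
  obtain ⟨c, hc, rfl⟩ := exists_homogeneous_coeffs_of_mem_span
    (fun n : Set.Iio n₀ => (D.isDivisorEquation n).bidegree) hH (hspan ▸ hmem)
  choose κ hκ hsec using fun n : Set.Iio n₀ => exists_mem_koszulRelations_of_eq_mul n.2 (q := q)
    (c := c n) (by simpa only [Prod.mk_sub_mk, sub_neg_eq_add] using hc n)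
  exact ⟨∑ n, κ n, sum_mem fun n _ => hκ n, by simp only [map_sum, hsec]⟩

/-- The part of a family of coefficients that belongs to the equations `P^(n)_m` for a given `n`. -/
def block (n : Fin l) (h : D.EqnIdx → MvPolynomial (ZVar D.d) K) :
    D.EqnIdx → MvPolynomial (ZVar D.d) K :=
  fun i => if i.1 = n then h i else 0

lemma block_eq_sum_single (n : Fin l) (h : D.EqnIdx → MvPolynomial (ZVar D.d) K) :
    block n h = ∑ m, Pi.single ⟨n, m⟩ (h ⟨n, m⟩) := by
  ext1 ⟨n', m⟩
  rw [block, Finset.sum_apply]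
  split_ifs with hn
  · obtain rfl : n' = n := hn
    rw [Finset.sum_eq_single m, Pi.single_eq_same]
    · exact fun m' _ hm => Pi.single_eq_of_ne (by simpa using hm.symm) _
    · simp
  · exact (Finset.sum_eq_zero fun m' _ =>
      Pi.single_eq_of_ne (fun hi => hn (congrArg Sigma.fst hi)) _).symm

lemma isHomogeneous_block {h : D.EqnIdx → MvPolynomial (ZVar D.d) K} {q : ℕ}
    (hq : ∀ i, (h i).IsHomogeneous q) (n : Fin l) (i : D.EqnIdx) :
    (block n h i).IsHomogeneous q := by
  rw [block]
  split_ifs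
  · exact hq i
  · exact isHomogeneous_zero _ _ _

lemma toCox_combination_block (n : Fin l) (h : D.EqnIdx → MvPolynomial (ZVar D.d) K) :
    toCox K D.d (D.combination D.eqn (block n h)) = D.sectionOf n h * D.P n := by
  rw [toCox_combination, Finset.sum_eq_single n]
  · simp only [sectionOf_apply, block, if_true]
  · intro n' _ hn
    rw [sectionOf_eq_zero fun _ => if_neg hn, zero_mul]
  · simp

lemma mapFamily_block_mem_liftable (hE : D.IsRollingFamily ζ E) {q : ℕ} {n : Fin l}
    {h : D.EqnIdx → MvPolynomial (ZVar D.d) K} (hq : ∀ i, (h i).IsHomogeneous q)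
    (hsec : D.sectionOf n h = 0) : D.mapFamily R (block n h) ∈ D.liftable ζ E q := by
  rw [block_eq_sum_single, map_sum]
  simp only [mapFamily_single]
  refine sum_single_mem_liftable hE (fun m => (hq ⟨n, m⟩).map _) ?_
  have hmap := congrArg (map (algebraMap K R)) hsec
  rw [sectionOf_apply, map_sum, map_zero] at hmap
  simpa only [map_mul, map_pow, map_X, map_toCox] using hmap

lemma sectionOf_mul_mem_initialIdeal {h : D.EqnIdx → MvPolynomial (ZVar D.d) K}
    (hrel : toCox K D.d (D.combination D.eqn h) = 0) {n₀ : Fin l}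
    (h0 : ∀ i, n₀ < i.1 → h i = 0) : D.sectionOf n₀ h * D.P n₀ ∈ initialIdeal D.P n₀ := by
  rw [toCox_combination, ← Finset.add_sum_erase _ _ (Finset.mem_univ n₀)] at hrel
  rw [eq_neg_of_add_eq_zero_left hrel]
  refine neg_mem (Ideal.sum_mem _ fun n hn => ?_)
  rcases (Finset.ne_of_mem_erase hn).lt_or_gt with hlt | hgt
  · exact Ideal.mul_mem_left _ _ (Ideal.subset_span ⟨n, hlt, rfl⟩)
  · rw [sectionOf_eq_zero fun _ => h0 _ hgt, zero_mul]
    exact zero_mem _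

-- Modulo Koszul relations the section of the last block vanishes, as the `P^(n)` are a regular
-- sequence; such a block is liftable by itself.
theorem mapFamily_mem_liftable (hE : D.IsRollingFamily ζ E) {q : ℕ} {N : ℕ} (hN : N ≤ l)
    {h : D.EqnIdx → MvPolynomial (ZVar D.d) K} (hq : ∀ i, (h i).IsHomogeneous q)
    (hrel : toCox K D.d (D.combination D.eqn h) = 0) (h0 : ∀ i, N ≤ (i.1 : ℕ) → h i = 0) :
    D.mapFamily R h ∈ D.liftable ζ E q := by
  induction N generalizing h with
  | zero =>
    obtain rfl : h = 0 := funext fun i => h0 i (Nat.zero_le _)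
    rw [map_zero]
    exact zero_mem _
  | succ N ih =>
    let n₀ : Fin l := ⟨N, hN⟩
    have hsection := sectionOf_homogeneous hq n₀
    obtain ⟨κ, hκ, hκsec⟩ := exists_mem_koszulRelations_of_mem_initialIdeal n₀ hsection
      (mem_initialIdeal_of_mul_mem D.isDivisorEquation D.isCompleteIntersection n₀
        (by dsimp only; omega) hsection (sectionOf_mul_mem_initialIdeal hrel h0))
    have hq' : ∀ i, ((h - κ) i).IsHomogeneous q := fun i =>
      (hq i).sub (isHomogeneous_of_mem_koszulRelations hκ i)
    have hsec' : D.sectionOf n₀ (h - κ) = 0 := by rw [map_sub, hκsec, sub_self]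
    have hrest : D.mapFamily R (h - κ - block n₀ (h - κ)) ∈ D.liftable ζ E q := by
      refine ih (by omega) (fun i => (hq' i).sub (isHomogeneous_block hq' n₀ i)) ?_ fun i hi => ?_
      · rw [map_sub, map_sub, toCox_combination_block, hsec', zero_mul, sub_zero, map_sub,
          combination_eq_zero_of_mem_koszulRelations hκ, sub_zero, hrel]
      · rw [Pi.sub_apply, block]
        split_ifs with hn
        · exact sub_self _
        · have hlt : n₀ < i.1 := lt_of_le_of_ne hi (Ne.symm hn)
          rw [Pi.sub_apply, h0 i hlt, apply_eq_zero_of_mem_koszulRelations hκ hlt, sub_zero,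
            sub_zero]
    have hsum := add_mem (add_mem hrest (mapFamily_block_mem_liftable hE hq' hsec'))
      (mapFamily_mem_liftable_of_mem_koszulRelations hE hκ)
    rwa [← map_add, ← map_add, sub_add_cancel, sub_add_cancel] at hsum

end QuadricSystem

/-! ### Freeness of the deformed family -/

lemma scrollIdeal_zero_eq_map {K R : Type*} [CommRing K] [CommRing R] [Algebra K R] {k : ℕ}
    (d : Fin k → ℕ) : scrollIdeal d (0 : Fin k → ℕ → R) =
      (scrollIdeal d (0 : Fin k → ℕ → K)).map (map (algebraMap K R)) := by
  have hminor : ∀ α β : Col d, map (algebraMap K R) (scrollMinor d 0 α β) = scrollMinor d 0 α β :=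
    fun α β => by simp [scrollMinor]
  rw [scrollIdeal, scrollIdeal, Ideal.map_span]
  refine congrArg Ideal.span (Set.ext fun p => ⟨?_, ?_⟩)
  · rintro ⟨α, β, rfl⟩
    exact ⟨_, ⟨α, β, rfl⟩, hminor α β⟩
  · rintro ⟨_, ⟨α, β, rfl⟩, rfl⟩
    exact ⟨α, β, hminor α β⟩

lemma exists_eq_sum_smul_map_mapCoeff {K R σ ι κ : Type*} [Field K] [CommRing R] [Algebra K R]
    [Finite ι] (B : Module.Basis κ K R) (g : ι → MvPolynomial σ R) : ∃ S : Finset κ, ∀ i,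
      g i = ∑ x ∈ S, B x • map (algebraMap K R) (mapCoeff σ (B.coord x) (g i)) := by
  classical
  have := Fintype.ofFinite ι
  refine ⟨Finset.univ.biUnion fun i => (g i).support.biUnion fun u =>
    (B.repr (coeff u (g i))).support, fun i => ?_⟩
  ext u
  have hterm : ∀ x, coeff u (B x • map (algebraMap K R) (mapCoeff σ (B.coord x) (g i))) =
      B.repr (coeff u (g i)) x • B x := fun x => by
    rw [coeff_smul, coeff_map, coeff_mapCoeff, B.coord_apply, smul_eq_mul, mul_comm,
      Algebra.smul_def]
  simp only [coeff_sum, hterm]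
  by_cases hu : u ∈ (g i).support
  · conv_lhs => rw [← B.linearCombination_repr (coeff u (g i)), Finsupp.linearCombination_apply]
    refine Finset.sum_subset (fun x hx => Finset.mem_biUnion.2 ⟨i, Finset.mem_univ i,
      Finset.mem_biUnion.2 ⟨u, hu, hx⟩⟩) fun x _ hx => ?_
    exact (Finsupp.notMem_support_iff.1 hx).symm ▸ zero_smul K (B x)
  · rw [notMem_support_iff.1 hu, map_zero]
    simp only [Finsupp.coe_zero, Pi.zero_apply, zero_smul, Finset.sum_const_zero]

namespace QuadricSystem

variable {K : Type*} [Field K] {k l : ℕ} {D : QuadricSystem K k l}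
variable {R : Type*} [CommRing R] [Algebra K R] {ζ : Fin k → ℕ → R}
  {E : Fin l → ℕ → MvPolynomial (ZVar D.d) R}

/-- The equations `P^(n)_m` with coefficients in `R`. -/
abbrev eqnOver (D : QuadricSystem K k l) (R : Type*) [CommRing R] [Algebra K R] (n : Fin l)
    (m : ℕ) : MvPolynomial (ZVar D.d) R :=
  map (algebraMap K R) (D.eqn n m)

lemma isHomogeneous_eqnOver (i : D.EqnIdx) : (D.eqnOver R i.1 i.2).IsHomogeneous 2 :=
  (D.eqn_homogeneous _ _ (Nat.lt_succ_iff.1 i.2.2)).map _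

theorem mem_liftable (hE : D.IsRollingFamily ζ E) {q : ℕ}
    {g : D.EqnIdx → MvPolynomial (ZVar D.d) R} (hq : ∀ i, (g i).IsHomogeneous q)
    (hg : D.combination (D.eqnOver R) g ∈ scrollIdeal D.d (0 : Fin k → ℕ → R)) :
    g ∈ D.liftable ζ E q := by
  let B := Module.Basis.ofVectorSpace K R
  obtain ⟨S, hS⟩ := exists_eq_sum_smul_map_mapCoeff B g
  have hsum : g = ∑ x ∈ S, B x • D.mapFamily R fun i => mapCoeff _ (B.coord x) (g i) :=
    funext fun i => by simpa [mapFamily_apply] using hS i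
  rw [hsum]
  refine Submodule.sum_mem _ fun x _ => Submodule.smul_mem _ _ <|
    mapFamily_mem_liftable hE le_rfl (fun i u hu => hq i fun h0 => hu ?_) ?_
      fun i hi => absurd i.1.2 hi.not_gt
  · rw [coeff_mapCoeff, h0, map_zero]
  · rw [scrollIdeal_zero_eq_map (K := K)] at hg
    have hcoeff := mapCoeff_mem (B.coord x) hg
    rw [combination_apply, map_sum] at hcoeff
    simp only [mapCoeff_mul_map] at hcoeff
    exact toCox_eq_zero_of_mem_scrollIdeal hcoeff

/-- The ideal of a family of equations on a deformed scroll. -/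
def familyIdeal (D : QuadricSystem K k l) (ζ : Fin k → ℕ → R)
    (E : Fin l → ℕ → MvPolynomial (ZVar D.d) R) : Ideal (MvPolynomial (ZVar D.d) R) :=
  scrollIdeal D.d ζ ⊔ Ideal.span (Set.range fun i : D.EqnIdx => E i.1 i.2)

lemma familyIdeal_zero_eq_map : D.familyIdeal (0 : Fin k → ℕ → R) (D.eqnOver R) =
    (D.familyIdeal (0 : Fin k → ℕ → K) D.eqn).map (map (algebraMap K R)) := by
  rw [familyIdeal, familyIdeal, Ideal.map_sup, ← scrollIdeal_zero_eq_map, Ideal.map_span,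
    ← Set.range_comp]
  rfl

omit [Algebra K R] in
lemma combination_mem_span (h : D.EqnIdx → MvPolynomial (ZVar D.d) R) :
    D.combination E h ∈ Ideal.span (Set.range fun i : D.EqnIdx => E i.1 i.2) :=
  Ideal.sum_mem _ fun i _ => Ideal.mul_mem_left _ _ (Ideal.subset_span ⟨i, rfl⟩)

section LeadingForm

variable {q e : ℕ} {h : D.EqnIdx → MvPolynomial (ZVar D.d) R} {x : MvPolynomial (ZVar D.d) R}

lemma combination_sub_leading_mem_degreeLT (hE : D.IsRollingFamily ζ E)
    (hh : ∀ i, h i ∈ degreeLT R (ZVar D.d) (q + 1)) :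
    D.combination E h - D.combination (D.eqnOver R) (fun i => homogeneousComponent q (h i)) ∈
      degreeLT R (ZVar D.d) (q + 2) := by
  rw [combination_apply, combination_apply, ← Finset.sum_sub_distrib]
  refine Submodule.sum_mem _ fun i _ => ?_
  have hsplit : h i * E i.1 i.2 - homogeneousComponent q (h i) * D.eqnOver R i.1 i.2 =
      h i * (E i.1 i.2 - D.eqnOver R i.1 i.2) +
        (h i - homogeneousComponent q (h i)) * D.eqnOver R i.1 i.2 := by ring
  rw [hsplit]
  exact add_mem (mul_mem_degreeLT (hh i) (hE.leading _ _ (Nat.lt_succ_iff.1 i.2.2)))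
    (mul_mem_degreeLT' (sub_homogeneousComponent_mem_degreeLT (hh i))
      (mem_degreeLT_of_isHomogeneous (isHomogeneous_eqnOver i)))

lemma isHomogeneous_combination_eqnOver (hq : ∀ i, (h i).IsHomogeneous q) :
    (D.combination (D.eqnOver R) h).IsHomogeneous (q + 2) := by
  rw [combination_apply]
  exact IsHomogeneous.sum _ _ _ fun i _ => (hq i).mul (isHomogeneous_eqnOver i)

lemma combination_mem_degreeLT (hE : D.IsRollingFamily ζ E)
    (hh : ∀ i, h i ∈ degreeLT R (ZVar D.d) (q + 1)) :
    D.combination E h ∈ degreeLT R (ZVar D.d) (q + 3) := by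
  have hsum := add_mem
    (degreeLT_mono (Nat.le_succ _) (combination_sub_leading_mem_degreeLT hE hh))
    (mem_degreeLT_of_isHomogeneous (isHomogeneous_combination_eqnOver fun i =>
      homogeneousComponent_isHomogeneous q (h i)))
  rwa [sub_add_cancel] at hsum

lemma homogeneousComponent_combination (hE : D.IsRollingFamily ζ E)
    (hh : ∀ i, h i ∈ degreeLT R (ZVar D.d) (q + 1)) :
    homogeneousComponent (q + 2) (D.combination E h) =
      D.combination (D.eqnOver R) fun i => homogeneousComponent q (h i) := by
  have hlow := homogeneousComponent_of_mem_degreeLT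
    (combination_sub_leading_mem_degreeLT hE hh) le_rfl
  rwa [map_sub, homogeneousComponent_eq_self (isHomogeneous_combination_eqnOver fun i =>
    homogeneousComponent_isHomogeneous q (h i)), sub_eq_zero] at hlow

-- If the coefficients have larger degree than needed, their leading forms are a relation between
-- the `P^(n)_m` on the cone over the scroll; lifting it allows to lower the degree.
lemma exists_coeffs_of_lower_degree (hE : D.IsRollingFamily ζ E)
    (hdeg : x ∈ degreeLT R (ZVar D.d) (q + 2)) (hh : ∀ i, h i ∈ degreeLT R (ZVar D.d) (q + 1))
    (hx : x - D.combination E h ∈ scrollIdeal D.d ζ) :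
    ∃ h' : D.EqnIdx → MvPolynomial (ZVar D.d) R, (∀ i, h' i ∈ degreeLT R (ZVar D.d) q) ∧
      x - D.combination E h' ∈ scrollIdeal D.d ζ := by
  have hlead := homogeneousComponent_mem_scrollIdeal (e := q + 2) ζ hx
    (sub_mem (degreeLT_mono (Nat.le_succ _) hdeg) (combination_mem_degreeLT hE hh))
  rw [map_sub, homogeneousComponent_of_mem_degreeLT hdeg le_rfl, zero_sub,
    homogeneousComponent_combination hE hh, neg_mem_iff] at hlead
  obtain ⟨h', hh', hrel⟩ :=
    mem_liftable hE (fun i => homogeneousComponent_isHomogeneous q (h i)) hlead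
  refine ⟨h - h', fun i => ?_, ?_⟩
  · rw [Pi.sub_apply, ← sub_sub_sub_cancel_right _ _ (homogeneousComponent q (h i))]
    exact sub_mem (sub_homogeneousComponent_mem_degreeLT (hh i)) (hh' i)
  · rw [map_sub, sub_sub_eq_add_sub, add_sub_right_comm]
    exact add_mem hx hrel

lemma homogeneousComponent_mem_familyIdeal_of_le (hE : D.IsRollingFamily ζ E)
    (hdeg : x ∈ degreeLT R (ZVar D.d) (e + 1)) (hh : ∀ i, h i ∈ degreeLT R (ZVar D.d) (q + 1))
    (hx : x - D.combination E h ∈ scrollIdeal D.d ζ) (he : q + 2 ≤ e) :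
    homogeneousComponent e x ∈ D.familyIdeal (0 : Fin k → ℕ → R) (D.eqnOver R) := by
  have hcomb := combination_mem_degreeLT hE hh
  have hlead := homogeneousComponent_mem_scrollIdeal ζ hx
    (sub_mem hdeg (degreeLT_mono (by omega) hcomb))
  rw [map_sub] at hlead
  refine (sub_add_cancel (homogeneousComponent e x) _).subst
    (add_mem (Ideal.mem_sup_left hlead) ?_)
  rcases he.eq_or_lt with rfl | he
  · rw [homogeneousComponent_combination hE hh]
    exact Ideal.mem_sup_right (combination_mem_span _)
  · rw [homogeneousComponent_of_mem_degreeLT hcomb (by omega)]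
    exact zero_mem _

theorem homogeneousComponent_mem_familyIdeal (hE : D.IsRollingFamily ζ E)
    (hdeg : x ∈ degreeLT R (ZVar D.d) (e + 1)) (hh : ∀ i, h i ∈ degreeLT R (ZVar D.d) q)
    (hx : x - D.combination E h ∈ scrollIdeal D.d ζ) :
    homogeneousComponent e x ∈ D.familyIdeal (0 : Fin k → ℕ → R) (D.eqnOver R) := by
  induction q generalizing h with
  | zero =>
    obtain rfl : h = 0 := funext fun i => by simpa [degreeLT_zero] using hh i
    rw [map_zero, sub_zero] at hx
    exact Ideal.mem_sup_left (homogeneousComponent_mem_scrollIdeal ζ hx hdeg)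
  | succ q ih =>
    rcases lt_or_ge e (q + 2) with he | he
    · obtain ⟨h', hh', hx'⟩ := exists_coeffs_of_lower_degree hE (degreeLT_mono he hdeg) hh hx
      exact ih hh' hx'
    · exact homogeneousComponent_mem_familyIdeal_of_le hE hdeg hh hx he

end LeadingForm

omit [Algebra K R] in
lemma exists_coeffs_of_mem_familyIdeal {x : MvPolynomial (ZVar D.d) R}
    (hx : x ∈ D.familyIdeal ζ E) : ∃ (q : ℕ) (h : D.EqnIdx → MvPolynomial (ZVar D.d) R),
      (∀ i, h i ∈ degreeLT R (ZVar D.d) q) ∧ x - D.combination E h ∈ scrollIdeal D.d ζ := by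
  obtain ⟨y, hy, z, hz, rfl⟩ := Submodule.mem_sup.1 hx
  obtain ⟨h, rfl⟩ := (Submodule.mem_span_range_iff_exists_fun _).1 hz
  choose q hq using fun i => exists_mem_degreeLT (h i)
  refine ⟨Finset.univ.sup q, h, fun i =>
    degreeLT_mono (Finset.le_sup (Finset.mem_univ i)) (hq i), ?_⟩
  exact (add_sub_cancel_right y _).symm ▸ hy

lemma scrollMinor_zero_isHomogeneous {d : Fin k → ℕ} (α β : Col d) :
    (scrollMinor d (0 : Fin k → ℕ → R) α β).IsHomogeneous 2 := by
  simp only [scrollMinor, Pi.zero_apply, C_0, add_zero]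
  exact ((isHomogeneous_X _ _).mul (isHomogeneous_X _ _)).sub
    ((isHomogeneous_X _ _).mul (isHomogeneous_X _ _))

lemma scrollMinor_sub_mem_degreeLT {d : Fin k → ℕ} (ζ : Fin k → ℕ → R) (α β : Col d) :
    scrollMinor d ζ α β - map (algebraMap K R) (scrollMinor d 0 α β) ∈
      degreeLT R (ZVar d) 2 := by
  have hdiff : scrollMinor d ζ α β - map (algebraMap K R) (scrollMinor d 0 α β) =
      C (ζ β.1 (β.2 + 1)) * X α.top - C (ζ α.1 (α.2 + 1)) * X β.top := by
    simp only [scrollMinor, Pi.zero_apply, C_0, add_zero, map_sub, map_mul, map_X]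
    ring
  rw [hdiff]
  exact sub_mem (C_mul_mem_degreeLT _ (mem_degreeLT_of_isHomogeneous (isHomogeneous_X _ _)))
    (C_mul_mem_degreeLT _ (mem_degreeLT_of_isHomogeneous (isHomogeneous_X _ _)))

theorem free_familyIdeal (hE : D.IsRollingFamily ζ E) :
    Module.Free R (MvPolynomial (ZVar D.d) R ⧸ D.familyIdeal ζ E) := by
  refine free_quotient_of_initialForms (I₀ := D.familyIdeal (0 : Fin k → ℕ → K) D.eqn)
    (fun f hf => ?_) fun e x hx hdeg => ?_
  · rw [familyIdeal, scrollIdeal, ← Ideal.span_union] at hf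
    refine exists_lift_homogeneousComponent ?_ hf
    rintro f (⟨α, β, rfl⟩ | ⟨i, rfl⟩)
    · exact ⟨2, scrollMinor_zero_isHomogeneous α β, scrollMinor D.d ζ α β,
        Ideal.mem_sup_left (scrollMinor_mem ζ α β), scrollMinor_sub_mem_degreeLT ζ α β⟩
    · have hi := Nat.lt_succ_iff.1 i.2.2
      exact ⟨2, D.eqn_homogeneous _ _ hi, E i.1 i.2,
        Ideal.mem_sup_right (Ideal.subset_span ⟨i, rfl⟩), hE.leading _ _ hi⟩
  · rw [← familyIdeal_zero_eq_map]
    obtain ⟨q, h, hh, hrel⟩ := exists_coeffs_of_mem_familyIdeal hx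
    exact homogeneousComponent_mem_familyIdeal hE hdeg hh hrel

end QuadricSystem

/-! ### Rolling modulo the base equations -/

section LinearForms

variable {R : Type*} [CommRing R]

lemma eq_sum_of_isHomogeneous_one {σ : Type*} [Fintype σ] {p : MvPolynomial σ R}
    (hp : p.IsHomogeneous 1) : p = ∑ z, C (coeff (Finsupp.single z 1) p) * X z := by
  classical
  have hmem : p ∈ homogeneousSubmodule σ R 1 := hp
  rw [homogeneousSubmodule_one_eq_span_X] at hmem
  obtain ⟨c, rfl⟩ := (Submodule.mem_span_range_iff_exists_fun _).1 hmem
  refine Finset.sum_congr rfl fun z _ => ?_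
  rw [coeff_sum, Finset.sum_eq_single z]
  · rw [coeff_smul, coeff_X, if_pos rfl, smul_eq_mul, mul_one, C_mul']
  · intro y _ h
    rw [coeff_smul, coeff_X,
      if_neg fun hy => h (Finsupp.single_left_injective one_ne_zero hy), smul_zero]
  · simp

lemma eval_mem_of_mem_map_C {σ : Type*} {I : Ideal R} {p : MvPolynomial σ R} (x : σ → R)
    (hp : p ∈ I.map (C : R →+* MvPolynomial σ R)) : eval x p ∈ I := by
  have hcomp : (eval x).comp (C : R →+* MvPolynomial σ R) = RingHom.id R := RingHom.ext (eval_C ·)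
  simpa [Ideal.map_map, hcomp] using Ideal.mem_map_of_mem (eval x) hp

variable {k : ℕ} {d : Fin k → ℕ}

lemma sum_zVar_top {M : Type*} [AddCommMonoid M] (f : ZVar d → M) :
    ∑ z, f z = ∑ α : Col d, f α.top + ∑ i, f ⟨i, Fin.last _⟩ := by
  rw [Fintype.sum_sigma, Fintype.sum_sigma, ← Finset.sum_add_distrib]
  exact Finset.sum_congr rfl fun i _ => Fin.sum_univ_castSucc _

lemma sum_zVar_bot {M : Type*} [AddCommMonoid M] (f : ZVar d → M) :
    ∑ z, f z = ∑ α : Col d, f α.bot + ∑ i, f ⟨i, 0⟩ := by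
  rw [Fintype.sum_sigma, Fintype.sum_sigma, ← Finset.sum_add_distrib]
  exact Finset.sum_congr rfl fun i _ => (Fin.sum_univ_succ _).trans (add_comm _ _)

lemma coxExponent_single_injective :
    Function.Injective fun z : ZVar d => coxExponent (Finsupp.single z 1) := by
  rintro ⟨i, j⟩ ⟨i', j'⟩ h
  simp only [coxExponent_single] at h
  obtain rfl : i = i' := by
    by_contra hne
    simpa [sVar, tVar, Finsupp.single_apply, Ne.symm hne] using DFunLike.congr_fun h (Sum.inr i)
  have hj : j = j' := by
    simpa [sVar, tVar, Fin.ext_iff] using DFunLike.congr_fun h (tVar k)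
  rw [hj]

lemma coxExponent_bot_add_single (α : Col d) :
    coxExponent (Finsupp.single α.bot 1) + Finsupp.single (sVar k) 1 =
      coxExponent (Finsupp.single α.top 1) + Finsupp.single (tVar k) 1 := by
  have hα : d α.1 - (α.2 : ℕ) = (d α.1 - ((α.2 : ℕ) + 1)) + 1 := by omega
  simp only [coxExponent_single, Col.top, Col.bot, Fin.val_succ, Fin.val_castSucc, hα,
    Finsupp.single_add]
  abel

lemma coeff_toCox_of_isHomogeneous_one {p : MvPolynomial (ZVar d) R} (hp : p.IsHomogeneous 1)
    (z : ZVar d) :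
    coeff (coxExponent (Finsupp.single z 1)) (toCox R d p) = coeff (Finsupp.single z 1) p := by
  classical
  conv_lhs => rw [eq_sum_of_isHomogeneous_one hp]
  simp only [map_sum, C_mul_X_eq_monomial, toCox_monomial, coeff_sum, coeff_monomial,
    coxExponent_single_injective.eq_iff (f := fun z : ZVar d => coxExponent (Finsupp.single z 1)),
    Finset.sum_ite_eq', Finset.mem_univ, if_true]

section SectionCongruence

variable {I : Ideal R} {U V : MvPolynomial (ZVar d) R} (hU : U.IsHomogeneous 1)
  (hV : V.IsHomogeneous 1) (h : X (sVar k) * toCox R d V - X (tVar k) * toCox R d U ∈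
    I.map (C : R →+* MvPolynomial (CoxVar k) R))

include hV h in
lemma coeff_first_mem_of_section_congr (i : Fin k) : coeff (Finsupp.single ⟨i, 0⟩ 1) V ∈ I := by
  have hcoeff := mem_map_C_iff.1 h
    (Finsupp.single (sVar k) 1 + coxExponent (Finsupp.single (⟨i, 0⟩ : ZVar d) 1))
  rw [coeff_sub, coeff_X_mul, coeff_toCox_of_isHomogeneous_one hV, coeff_X_mul', if_neg,
    sub_zero] at hcoeff
  · exact hcoeff
  · simp [coxExponent_single, sVar, tVar]

include hU h in
lemma coeff_last_mem_of_section_congr (i : Fin k) :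
    coeff (Finsupp.single ⟨i, Fin.last _⟩ 1) U ∈ I := by
  have hcoeff := mem_map_C_iff.1 h
    (Finsupp.single (tVar k) 1 + coxExponent (Finsupp.single (⟨i, Fin.last _⟩ : ZVar d) 1))
  rw [coeff_sub, coeff_X_mul, coeff_toCox_of_isHomogeneous_one hU, coeff_X_mul', if_neg,
    zero_sub, neg_mem_iff] at hcoeff
  · exact hcoeff
  · simp [coxExponent_single, sVar, tVar]

include hU hV h in
lemma coeff_bot_sub_coeff_top_mem_of_section_congr (α : Col d) :
    coeff (Finsupp.single α.bot 1) V - coeff (Finsupp.single α.top 1) U ∈ I := by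
  have hcoeff := mem_map_C_iff.1 h
    (coxExponent (Finsupp.single α.bot 1) + Finsupp.single (sVar k) 1)
  rw [coeff_sub] at hcoeff
  nth_rw 2 [coxExponent_bot_add_single] at hcoeff
  rwa [add_comm, coeff_X_mul, add_comm, coeff_X_mul, coeff_toCox_of_isHomogeneous_one hV,
    coeff_toCox_of_isHomogeneous_one hU] at hcoeff

include hU h in
lemma sub_sum_top_mem_of_section_congr :
    U - ∑ α : Col d, C (coeff (Finsupp.single α.top 1) U) * X α.top ∈
      I.map (C : R →+* MvPolynomial (ZVar d) R) := by
  nth_rw 1 [eq_sum_of_isHomogeneous_one hU]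
  rw [sum_zVar_top, add_sub_cancel_left]
  exact Ideal.sum_mem _ fun i _ => Ideal.mul_mem_right _ _
    (Ideal.mem_map_of_mem _ (coeff_last_mem_of_section_congr hU h i))

include hU hV h in
lemma sub_sum_bot_mem_of_section_congr :
    V - ∑ α : Col d, C (coeff (Finsupp.single α.top 1) U) * X α.bot ∈
      I.map (C : R →+* MvPolynomial (ZVar d) R) := by
  nth_rw 1 [eq_sum_of_isHomogeneous_one hV]
  rw [sum_zVar_bot, add_sub_right_comm, ← Finset.sum_sub_distrib]
  refine add_mem (Ideal.sum_mem _ fun α _ => ?_) (Ideal.sum_mem _ fun i _ =>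
    Ideal.mul_mem_right _ _ (Ideal.mem_map_of_mem _ (coeff_first_mem_of_section_congr hV h i)))
  rw [← sub_mul, ← C_sub]
  exact Ideal.mul_mem_right _ _
    (Ideal.mem_map_of_mem _ (coeff_bot_sub_coeff_top_mem_of_section_congr hU hV h α))

end SectionCongruence

lemma sum_mul_scrollMinor (ζ : Fin k → ℕ → R) (a : Col d → MvPolynomial (ZVar d) R) (β : Col d) :
    ∑ α, a α * scrollMinor d ζ α β =
      (∑ α, a α * X α.top) * (X β.bot + C (ζ β.1 (β.2 + 1))) -
        (∑ α, a α * (X α.bot + C (ζ α.1 (α.2 + 1)))) * X β.top := by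
  rw [Finset.sum_mul, Finset.sum_mul, ← Finset.sum_sub_distrib]
  refine Finset.sum_congr rfl fun α _ => ?_
  rw [scrollMinor]
  ring

lemma sVar_mul_toCox_bot (α : Col d) :
    X (sVar k) * toCox R d (X α.bot) = X (tVar k) * toCox R d (X α.top) := by
  simp only [X, toCox_monomial, monomial_mul, mul_one]
  rw [add_comm, coxExponent_bot_add_single, add_comm]

end LinearForms

namespace QuadricSystem

variable {K : Type*} [Field K] {k l : ℕ} {D : QuadricSystem K k l}

lemma zCoord_isHomogeneous (i : Fin k) (j : ℕ) : (D.zCoord i j).IsHomogeneous 1 := by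
  rw [zCoord]
  split_ifs
  · exact isHomogeneous_X _ _
  · exact isHomogeneous_zero _ _ _

lemma sVar_mul_toCox_zCoord_succ {i : Fin k} {j : ℕ} (hj : j < D.d i) :
    X (sVar k) * toCox D.Base D.d (D.zCoord i (j + 1)) =
      X (tVar k) * toCox D.Base D.d (D.zCoord i j) := by
  rw [zCoord, zCoord, dif_pos (by omega), dif_pos (by omega)]
  exact sVar_mul_toCox_bot (⟨i, ⟨j, hj⟩⟩ : Col D.d)

lemma sVar_mul_toCox_purePart_succ {n : Fin l} {m : ℕ} (hm : m < D.b n) :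
    X (sVar k) * toCox D.Base D.d (D.purePart n (m + 1)) =
      X (tVar k) * toCox D.Base D.d (D.purePart n m) := by
  simp only [purePart, map_sum, map_mul, Finset.mul_sum]
  refine Finset.sum_congr rfl fun i _ => Finset.sum_congr rfl fun j _ => ?_
  rw [mul_left_comm, mul_left_comm (X (tVar k)), ← add_assoc,
    sVar_mul_toCox_zCoord_succ (by omega)]

namespace FirstOrderLift

variable (F : D.FirstOrderLift)

lemma pert_isHomogeneous (n : Fin l) (m : ℕ) : (F.pert n m).IsHomogeneous 1 :=
  .add (.sum _ _ _ fun z _ => (isHomogeneous_X _ z).C_mul _)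
    (.sum _ _ _ fun i _ => .sum _ _ _ fun _ _ => (zCoord_isHomogeneous i _).C_mul _)

/-- The part `P'_{m+1} - ∑_α p_{α,m} ζ_{α+1}` of `P'_{m+1}`, which restricts to `t/s` times `P'_m`
on the scroll. -/
def rolledPert (n : Fin l) (m : ℕ) : MvPolynomial (ZVar D.d) D.Base :=
  F.pert n (m + 1) - ∑ α : Col D.d, map C (D.roll n m α) * C (D.zetaPt α.bot)

/-- The coefficients by which one rolls from `P'_m` to `rolledPert n m`. -/
def pertRoll (n : Fin l) (m : ℕ) (α : Col D.d) : D.Base :=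
  coeff (Finsupp.single α.top 1) (F.pert n m)

/-- The equations `P^(n)_m + P'^(n)_m` of the infinitesimal deformation. -/
def equation (n : Fin l) (m : ℕ) : MvPolynomial (ZVar D.d) D.Base :=
  map C (D.eqn n m) + F.pert n m

variable {n : Fin l} {m : ℕ} (hm : m < D.b n)

include hm

lemma rolledPert_isHomogeneous : (F.rolledPert n m).IsHomogeneous 1 := by
  refine (F.pert_isHomogeneous n _).sub (IsHomogeneous.sum _ _ _ fun α _ => ?_)
  rw [mul_comm]
  exact ((D.roll_homogeneous n m α hm).map _).C_mul _

lemma section_rolledPert_congr :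
    X (sVar k) * toCox D.Base D.d (F.rolledPert n m) - X (tVar k) * toCox D.Base D.d (F.pert n m) ∈
      D.liftingIdeal.map (C : D.Base →+* MvPolynomial (CoxVar k) D.Base) := by
  convert F.lift n m hm using 1
  rw [rolledPert, pert, pert, map_sub, map_add, map_add, mul_sub, mul_add, mul_add,
    sVar_mul_toCox_purePart_succ hm]
  ring

lemma rolledPert_sub_mem :
    F.rolledPert n m - ∑ α : Col D.d, C (F.pertRoll n m α) * X α.bot ∈
      D.liftingIdeal.map (C : D.Base →+* MvPolynomial (ZVar D.d) D.Base) :=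
  sub_sum_bot_mem_of_section_congr (F.pert_isHomogeneous n m) (F.rolledPert_isHomogeneous hm)
    (F.section_rolledPert_congr hm)

lemma eval_zetaPt_rolledPert : eval D.zetaPt (F.rolledPert n m) = F.baseEquation n (m + 1) := by
  rw [rolledPert, baseEquation, map_sub, map_sum, D.eqn_succ n m hm, map_sum]
  refine congrArg _ (Finset.sum_congr rfl fun α _ => ?_)
  rw [map_mul, map_mul, eval_C, aeval_X, eval_map]
  rfl

lemma equation_sub_mem :
    F.equation n m - ∑ α : Col D.d, (map C (D.roll n m α) + C (F.pertRoll n m α)) * X α.top ∈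
      D.liftingIdeal.map (C : D.Base →+* MvPolynomial (ZVar D.d) D.Base) := by
  convert sub_sum_top_mem_of_section_congr (F.pert_isHomogeneous n m)
    (F.section_rolledPert_congr hm) using 1
  simp only [equation, D.eqn_eq n m hm, map_sum, map_mul, map_X, pertRoll, add_mul,
    Finset.sum_add_distrib]
  ring

lemma equation_succ_add_baseEquation_sub_mem :
    F.equation n (m + 1) + C (F.baseEquation n (m + 1)) - ∑ α : Col D.d,
        (map C (D.roll n m α) + C (F.pertRoll n m α)) * (X α.bot + C (D.zetaPt α.bot)) ∈
      D.liftingIdeal.map (C : D.Base →+* MvPolynomial (ZVar D.d) D.Base) := by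
  have hrolled := F.rolledPert_sub_mem hm
  have hbase := Ideal.mem_map_of_mem (C : D.Base →+* MvPolynomial (ZVar D.d) D.Base)
    (eval_mem_of_mem_map_C D.zetaPt hrolled)
  rw [map_sub, F.eval_zetaPt_rolledPert hm] at hbase
  convert add_mem hrolled hbase using 1
  simp only [equation, rolledPert, D.eqn_succ n m hm, map_sum, map_mul, map_X, map_sub, eval_C,
    eval_X, add_mul, mul_add, Finset.sum_add_distrib]
  ring

-- Rolling factors on the deformed scroll fails exactly by the base equation.
theorem roll_mem (β : Col D.d) :
    F.equation n m * (X β.bot + C (D.zetaPt β.bot)) - F.equation n (m + 1) * X β.top -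
      ∑ α, (map C (D.roll n m α) + C (F.pertRoll n m α)) * D.deformedMinor α β -
      C (F.baseEquation n (m + 1)) * X β.top ∈
      D.liftingIdeal.map (C : D.Base →+* MvPolynomial (ZVar D.d) D.Base) := by
  have hminors := sum_mul_scrollMinor D.zeta
    (fun α => map C (D.roll n m α) + C (F.pertRoll n m α)) β
  convert sub_mem (Ideal.mul_mem_right (X β.bot + C (D.zetaPt β.bot)) _ (F.equation_sub_mem hm))
    (Ideal.mul_mem_right (X β.top) _ (F.equation_succ_add_baseEquation_sub_mem hm)) using 1
  refine (congrArg (_ - · - _) hminors).trans ?_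
  simp only [zetaPt, Col.bot, Fin.val_succ]
  ring

end FirstOrderLift

end QuadricSystem

/-! ### The extension over the base equations -/

section Degrees

variable {R σ τ : Type*} [CommRing R]

lemma mem_idealOfVars_pow_of_isHomogeneous {p : MvPolynomial σ R} {q : ℕ} (hp : p.IsHomogeneous q) :
    p ∈ idealOfVars σ R ^ q :=
  (mem_pow_idealOfVars_iff' q p).2 fun _ hu => hp.coeff_eq_zero hu.ne

lemma mem_idealOfVars_of_isHomogeneous_one {p : MvPolynomial σ R} (hp : p.IsHomogeneous 1) :
    p ∈ idealOfVars σ R := by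
  simpa only [pow_one] using mem_idealOfVars_pow_of_isHomogeneous hp

lemma homogeneousComponent_eq_zero_of_mem_idealOfVars_pow {p : MvPolynomial σ R} {q a : ℕ}
    (hp : p ∈ idealOfVars σ R ^ q) (ha : a < q) : homogeneousComponent a p = 0 :=
  homogeneousComponent_eq_zero' _ _ fun u hu hua =>
    (ha.trans_le ((mem_pow_idealOfVars_iff q p).1 hp u hu)).ne' hua

lemma coeff_X_isHomogeneous (u : τ →₀ ℕ) (z : τ) :
    (coeff u (X z : MvPolynomial τ (MvPolynomial σ R))).IsHomogeneous 0 := by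
  classical
  rw [coeff_X]
  split_ifs
  exacts [isHomogeneous_one _ _, isHomogeneous_zero _ _ _]

lemma isHomogeneousIdeal_span {s : Set (MvPolynomial σ R)}
    (hs : ∀ p ∈ s, ∃ q, p.IsHomogeneous q) : IsHomogeneousIdeal (Ideal.span s) :=
  letI := MvPolynomial.gradedAlgebra (σ := σ) (R := R)
  Ideal.homogeneous_span _ _ hs

lemma sumAlgEquiv_symm_C_eq_rename (p : MvPolynomial τ R) :
    (sumAlgEquiv R σ τ).symm (C p) = rename Sum.inr p :=
  (AlgEquiv.symm_apply_eq _).2 (DFunLike.congr_fun (sumAlgEquiv_comp_rename_inr R σ τ) p).symm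

lemma sumAlgEquiv_symm_map_C_eq_rename (p : MvPolynomial σ R) :
    (sumAlgEquiv R σ τ).symm (map C p) = rename Sum.inl p :=
  (AlgEquiv.symm_apply_eq _).2 (DFunLike.congr_fun (sumAlgEquiv_comp_rename_inl R σ τ) p).symm

lemma isHomogeneousIdeal_comap_sumAlgEquiv_span {s : Set (MvPolynomial σ (MvPolynomial τ R))}
    (hs : ∀ p ∈ s, ∃ q, ((sumAlgEquiv R σ τ).symm p).IsHomogeneous q) :
    IsHomogeneousIdeal ((Ideal.span s).comap (sumAlgEquiv R σ τ)) := by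
  have hcomap : (Ideal.span s).comap (sumAlgEquiv R σ τ) =
      (Ideal.span s).map (sumAlgEquiv R σ τ).symm :=
    (Ideal.map_symm (sumAlgEquiv R σ τ).toRingEquiv).symm
  rw [hcomap, Ideal.map_span]
  exact isHomogeneousIdeal_span (Set.forall_mem_image.2 hs)

lemma map_mk_eq_zero_of_mem_map_C {J : Ideal R} {x : MvPolynomial σ R}
    (hx : x ∈ J.map (C : R →+* MvPolynomial σ R)) : map (Ideal.Quotient.mk J) x = 0 := by
  rwa [← RingHom.mem_ker, ker_map, Ideal.mk_ker]

end Degrees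

namespace QuadricSystem

variable {K : Type*} [Field K] {k l : ℕ} {D : QuadricSystem K k l}

lemma zeta_isHomogeneous (i : Fin k) (j : ℕ) : (D.zeta i j).IsHomogeneous 1 := by
  rw [zeta]
  split_ifs
  · exact isHomogeneous_X _ _
  · exact isHomogeneous_zero _ _ _

lemma zetaPt_isHomogeneous (z : ZVar D.d) : (D.zetaPt z).IsHomogeneous 1 := zeta_isHomogeneous _ _

lemma liftingForm_isHomogeneous (n : Fin l) (i : Fin k) (r : ℕ) :
    (D.liftingForm n i r).IsHomogeneous 1 :=
  .sum _ _ _ fun _ _ => .sum _ _ _ fun _ _ => (zeta_isHomogeneous _ _).C_mul _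

variable (D) in
/-- The ideal of the base of the infinitesimal deformation. -/
abbrev firstOrderIdeal : Ideal D.Base := D.liftingIdeal ⊔ D.originIdeal ^ 2

lemma firstOrderIdeal_le_originIdeal : D.firstOrderIdeal ≤ D.originIdeal := by
  refine sup_le (Ideal.span_le.2 ?_) (Ideal.pow_le_self two_ne_zero)
  rintro _ ⟨n, i, r, _, _, rfl⟩
  exact mem_idealOfVars_of_isHomogeneous_one (D.liftingForm_isHomogeneous n i r)

lemma map_deformedMinor {R : Type*} [CommRing R] (φ : D.Base →+* R) (α β : Col D.d) :
    map φ (D.deformedMinor α β) = scrollMinor D.d (fun i j => φ (D.zeta i j)) α β := by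
  simp [deformedMinor, scrollMinor, zetaPt, Col.bot]

lemma sumAlgEquiv_symm_deformedMinor_isHomogeneous (α β : Col D.d) :
    ((sumAlgEquiv K _ _).symm (D.deformedMinor α β)).IsHomogeneous 2 := by
  have hzeta (z : ZVar D.d) :
      (rename Sum.inr (D.zetaPt z) : MvPolynomial (ZVar D.d ⊕ _) K).IsHomogeneous 1 :=
    (zetaPt_isHomogeneous z).rename_isHomogeneous
  simp only [deformedMinor, map_sub, map_mul, map_add, sumAlgEquiv_symm_X,
    sumAlgEquiv_symm_C_eq_rename]
  exact ((isHomogeneous_X _ _).mul ((isHomogeneous_X _ _).add (hzeta _))).sub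
    (((isHomogeneous_X _ _).add (hzeta _)).mul (isHomogeneous_X _ _))

lemma coeff_bilin_isHomogeneous (q : ZVar D.d → D.ZetaIdx → K) (u : ZVar D.d →₀ ℕ) :
    (coeff u (D.bilin q)).IsHomogeneous 1 := by
  rw [bilin, coeff_sum]
  refine .sum _ _ _ fun z _ => ?_
  rw [coeff_C_mul]
  exact (IsHomogeneous.sum _ _ _ fun v _ => (isHomogeneous_X _ _).C_mul _).mul
    (coeff_X_isHomogeneous u z)

lemma coeff_purePart_isHomogeneous (n : Fin l) (m : ℕ) (u : ZVar D.d →₀ ℕ) :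
    (coeff u (D.purePart n m)).IsHomogeneous 1 := by
  simp only [purePart, coeff_sum]
  refine .sum _ _ _ fun i _ => .sum _ _ _ fun j _ => ?_
  rw [coeff_C_mul, zCoord]
  refine (isHomogeneous_X K (Sum.inr (⟨n, i, j⟩ : D.RhoIdx))).mul (n := 0) ?_
  split_ifs
  · exact coeff_X_isHomogeneous u _
  · exact isHomogeneous_zero _ _ _

namespace FirstOrderLift

variable (F : D.FirstOrderLift)

lemma coeff_pert_isHomogeneous (n : Fin l) (m : ℕ) (u : ZVar D.d →₀ ℕ) :
    (coeff u (F.pert n m)).IsHomogeneous 1 := by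
  rw [pert, coeff_add]
  exact (coeff_bilin_isHomogeneous _ u).add (coeff_purePart_isHomogeneous n m u)

lemma baseEquation_isHomogeneous {n : Fin l} {m : ℕ} (hm : m ≤ D.b n) :
    (F.baseEquation n m).IsHomogeneous 2 := by
  refine IsHomogeneous.sub ?_ ?_
  · rw [eq_sum_of_isHomogeneous_one (F.pert_isHomogeneous n m), map_sum]
    refine .sum _ _ _ fun z _ => ?_
    rw [map_mul, eval_C, eval_X]
    exact (F.coeff_pert_isHomogeneous n m _).mul (zetaPt_isHomogeneous z)
  · simpa only [one_mul] using (D.eqn_homogeneous n m hm).aeval _ zetaPt_isHomogeneous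

lemma baseEquation_mem_originIdeal_sq {n : Fin l} {m : ℕ} (hm : m ≤ D.b n) :
    F.baseEquation n m ∈ D.originIdeal ^ 2 :=
  mem_idealOfVars_pow_of_isHomogeneous (F.baseEquation_isHomogeneous hm)

lemma baseEquation_mem_baseIdeal {n : Fin l} {m : ℕ} (hm : 1 ≤ m) (hm' : m + 1 ≤ D.b n) :
    F.baseEquation n m ∈ F.baseIdeal :=
  Ideal.mem_sup_right (Ideal.subset_span ⟨n, m, hm, hm', rfl⟩)

lemma baseIdeal_le_firstOrderIdeal : F.baseIdeal ≤ D.firstOrderIdeal := by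
  refine sup_le_sup_left (Ideal.span_le.2 ?_) _
  rintro _ ⟨n, m, _, hm, rfl⟩
  exact F.baseEquation_mem_originIdeal_sq (by omega)

lemma baseHomogeneous_baseIdeal : BaseHomogeneous F.baseIdeal := by
  rw [BaseHomogeneous, baseIdeal, liftingIdeal, ← Ideal.span_union]
  refine isHomogeneousIdeal_span ?_
  rintro _ (⟨n, i, r, _, _, rfl⟩ | ⟨n, m, _, hm, rfl⟩)
  · exact ⟨1, D.liftingForm_isHomogeneous n i r⟩
  · exact ⟨2, F.baseEquation_isHomogeneous (by omega)⟩

/-- The equations of the universal extension: those of the infinitesimal deformation, except that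
the last one of each divisor is corrected by the obstruction to roll to it. -/
def extEquation (n : Fin l) (m : ℕ) : MvPolynomial (ZVar D.d) D.Base :=
  F.equation n m + C (if m = D.b n then F.baseEquation n m else 0)

/-- The ideal of the universal extension, which is flat over the base equations. -/
def extIdeal : Ideal (MvPolynomial (ZVar D.d) D.Base) :=
  Ideal.span ({g | ∃ α β, g = D.deformedMinor α β} ∪
    {g | ∃ n m, m ≤ D.b n ∧ g = F.extEquation n m})

lemma restrict_extIdeal {R : Type*} [CommRing R] (φ : D.Base →+* R) :
    restrict φ F.extIdeal = D.familyIdeal (fun i j => φ (D.zeta i j))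
      (fun n m => map φ (F.extEquation n m)) := by
  rw [restrict, extIdeal, Ideal.map_span, Set.image_union, Ideal.span_union, familyIdeal,
    scrollIdeal]
  congr 2
  · ext p
    constructor
    · rintro ⟨_, ⟨α, β, rfl⟩, rfl⟩
      exact ⟨α, β, map_deformedMinor φ α β⟩
    · rintro ⟨α, β, rfl⟩
      exact ⟨_, ⟨α, β, rfl⟩, map_deformedMinor φ α β⟩
  · ext p
    constructor
    · rintro ⟨_, ⟨n, m, hm, rfl⟩, rfl⟩
      exact ⟨⟨n, ⟨m, by omega⟩⟩, rfl⟩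
    · rintro ⟨⟨n, m⟩, rfl⟩
      exact ⟨_, ⟨n, m, by omega, rfl⟩, rfl⟩

lemma extEquation_roll_mem {n : Fin l} {m : ℕ} (hm : m < D.b n) (β : Col D.d) :
    F.extEquation n m * (X β.bot + C (D.zetaPt β.bot)) - F.extEquation n (m + 1) * X β.top -
      ∑ α, (map C (D.roll n m α) + C (F.pertRoll n m α)) * D.deformedMinor α β ∈
      F.baseIdeal.map (C : D.Base →+* MvPolynomial (ZVar D.d) D.Base) := by
  have hroll := Ideal.map_mono (f := (C : D.Base →+* MvPolynomial (ZVar D.d) D.Base))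
    (show D.liftingIdeal ≤ F.baseIdeal from le_sup_left) (F.roll_mem hm β)
  rw [extEquation, extEquation, if_neg hm.ne, C_0]
  by_cases hlast : m + 1 = D.b n
  · rw [if_pos hlast]
    convert hroll using 1
    ring
  · have hbase : F.baseEquation n (m + 1) ∈ F.baseIdeal :=
      F.baseEquation_mem_baseIdeal (by omega) (by omega)
    rw [if_neg hlast, C_0]
    convert add_mem hroll (Ideal.mul_mem_right (X β.top) _ (Ideal.mem_map_of_mem C hbase)) using 1
    ring

lemma map_extEquation_sub_leading_mem_degreeLT {R : Type*} [CommRing R] [Algebra K R]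
    (φ : D.Base →ₐ[K] R) (n : Fin l) (m : ℕ) :
    map (φ : D.Base →+* R) (F.extEquation n m) - map (algebraMap K R) (D.eqn n m) ∈
      degreeLT R (ZVar D.d) 2 := by
  have hleading : map (φ : D.Base →+* R) (map C (D.eqn n m)) =
      map (algebraMap K R) (D.eqn n m) := by
    rw [map_map]
    exact congrArg (map · _) φ.comp_algebraMap
  rw [extEquation, equation, map_add, map_add, hleading, add_assoc, add_sub_cancel_left, map_C]
  exact add_mem (mem_degreeLT_of_isHomogeneous ((F.pert_isHomogeneous n m).map _))
    (degreeLT_mono one_le_two (mem_degreeLT_of_isHomogeneous (isHomogeneous_C _ _)))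

lemma isRollingFamily_extEquation : D.IsRollingFamily
    (fun i j => Ideal.Quotient.mk F.baseIdeal (D.zeta i j))
    (fun n m => map (Ideal.Quotient.mk F.baseIdeal) (F.extEquation n m)) where
  leading n m _ :=
    F.map_extEquation_sub_leading_mem_degreeLT (Ideal.Quotient.mkₐ K F.baseIdeal) n m
  roll n m hm β := by
    have hroll := map_mk_eq_zero_of_mem_map_C (F.extEquation_roll_mem hm β)
    simp only [map_sub, map_mul, map_add, map_X, map_C, map_sum, sub_eq_zero,
      map_deformedMinor] at hroll
    refine (congrArg (· ∈ _) hroll).mpr ?_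
    exact Ideal.sum_mem _ fun α _ => Ideal.mul_mem_left _ _ (scrollMinor_mem _ α β)

lemma isFlatFamily_extIdeal : IsFlatFamily (Ideal.Quotient.mk F.baseIdeal) F.extIdeal := by
  rw [IsFlatFamily, restrict_extIdeal]
  have := free_familyIdeal F.isRollingFamily_extEquation
  exact Module.Flat.of_free

lemma map_extEquation_eq_map_equation {n : Fin l} {m : ℕ} (hm : m ≤ D.b n) :
    map (Ideal.Quotient.mk D.firstOrderIdeal) (F.extEquation n m) =
      map (Ideal.Quotient.mk D.firstOrderIdeal) (F.equation n m) := by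
  have hcorrection : (if m = D.b n then F.baseEquation n m else 0) ∈ D.firstOrderIdeal := by
    split_ifs
    · exact Ideal.mem_sup_right (F.baseEquation_mem_originIdeal_sq hm)
    · exact zero_mem _
  rw [extEquation, map_add (map (Ideal.Quotient.mk _)) (F.equation n m), map_C,
    Ideal.Quotient.eq_zero_iff_mem.2 hcorrection, C_0, add_zero]

theorem isExtension_extIdeal : F.IsExtension F.baseIdeal F.extIdeal where
  lifting_le := le_sup_left
  le_first_order := F.baseIdeal_le_firstOrderIdeal
  flat := F.isFlatFamily_extIdeal
  first_order := by
    rw [restrict, restrict, extIdeal, equations, Ideal.map_span, Ideal.map_span, Set.image_union,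
      Set.image_union]
    congr 2
    ext p
    constructor
    · rintro ⟨_, ⟨n, m, hm, rfl⟩, rfl⟩
      exact ⟨_, ⟨n, m, hm, rfl⟩, (F.map_extEquation_eq_map_equation hm).symm⟩
    · rintro ⟨_, ⟨n, m, hm, rfl⟩, rfl⟩
      exact ⟨_, ⟨n, m, hm, rfl⟩, F.map_extEquation_eq_map_equation hm⟩

lemma sumAlgEquiv_symm_extEquation_isHomogeneous {n : Fin l} {m : ℕ} (hm : m ≤ D.b n) :
    ((sumAlgEquiv K _ _).symm (F.extEquation n m)).IsHomogeneous 2 := by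
  rw [extEquation, equation, map_add, map_add, sumAlgEquiv_symm_map_C_eq_rename,
    sumAlgEquiv_symm_C_eq_rename]
  refine .add (.add (D.eqn_homogeneous n m hm).rename_isHomogeneous ?_)
    (IsHomogeneous.rename_isHomogeneous ?_)
  · rw [eq_sum_of_isHomogeneous_one (F.pert_isHomogeneous n m), map_sum]
    refine .sum _ _ _ fun z _ => ?_
    rw [map_mul, sumAlgEquiv_symm_C_eq_rename, sumAlgEquiv_symm_X]
    exact (F.coeff_pert_isHomogeneous n m _).rename_isHomogeneous.mul (isHomogeneous_X _ _)
  · split_ifs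
    · exact F.baseEquation_isHomogeneous hm
    · exact isHomogeneous_zero _ _ _

lemma familyHomogeneous_extIdeal : FamilyHomogeneous F.extIdeal := by
  refine isHomogeneousIdeal_comap_sumAlgEquiv_span ?_
  rintro _ (⟨α, β, rfl⟩ | ⟨n, m, hm, rfl⟩)
  · exact ⟨2, sumAlgEquiv_symm_deformedMinor_isHomogeneous α β⟩
  · exact ⟨2, F.sumAlgEquiv_symm_extEquation_isHomogeneous hm⟩

end FirstOrderLift

end QuadricSystem

/-! ### Polynomials with small coefficients in low degrees -/

lemma smul_top_inf_le_smul_of_flat {R M : Type*} [CommRing R] [AddCommGroup M] [Module R M]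
    (N : Ideal R) (P : Submodule R M) [Module.Flat R (M ⧸ P)] :
    N • (⊤ : Submodule R M) ⊓ P ≤ N • P := by
  rintro x ⟨hxN, hxP⟩
  rw [← Submodule.span_univ, ← Set.range_id, SetLike.mem_coe,
    Submodule.mem_ideal_smul_span_iff_exists_sum] at hxN
  obtain ⟨a, haN, rfl⟩ := hxN
  rw [Finsupp.sum, ← Finset.sum_coe_sort] at hxP ⊢
  have hrelation : ∑ y : a.support, a y • P.mkQ y = 0 := by
    simp_rw [← map_smul]
    rw [← map_sum]
    exact (Submodule.Quotient.mk_eq_zero P).2 hxP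
  obtain ⟨_, c, y, hy, hac⟩ := Module.Flat.isTrivialRelation_of_sum_smul_eq_zero hrelation
  choose Y hY using fun j => P.mkQ_surjective (y j)
  have hcancel : ∑ u : a.support, a u • ∑ j, c u j • Y j = 0 := by
    simp_rw [Finset.smul_sum, smul_smul]
    rw [Finset.sum_comm]
    refine Finset.sum_eq_zero fun j _ => ?_
    rw [← Finset.sum_smul, hac, zero_smul]
  rw [← sub_zero (∑ u : a.support, _), ← hcancel, ← Finset.sum_sub_distrib]
  simp_rw [← smul_sub]
  refine Submodule.sum_mem _ fun u _ => Submodule.smul_mem_smul (haN u) ?_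
  rw [← Submodule.Quotient.mk_eq_zero, ← Submodule.mkQ_apply, map_sub, map_sum, sub_eq_zero]
  simpa only [map_smul, hY, id] using hy u

section LowIdeal

variable {R σ : Type*} [CommRing R] {N N' : Ideal R}

/-- The polynomials whose coefficients in degrees `0` and `1` lie in `N`. -/
def lowIdeal (σ : Type*) (N : Ideal R) : Ideal (MvPolynomial σ R) :=
  N.map C ⊔ idealOfVars σ R ^ 2

lemma map_C_le_lowIdeal : N.map C ≤ lowIdeal σ N := le_sup_left

lemma mem_lowIdeal_of_isHomogeneous_two {x : MvPolynomial σ R} (hx : x.IsHomogeneous 2) :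
    x ∈ lowIdeal σ N :=
  Ideal.mem_sup_right (mem_idealOfVars_pow_of_isHomogeneous hx)

lemma mem_lowIdeal_iff {x : MvPolynomial σ R} :
    x ∈ lowIdeal σ N ↔ ∀ u : σ →₀ ℕ, u.degree < 2 → coeff u x ∈ N := by
  classical
  constructor
  · intro hx u hu
    obtain ⟨y, hy, v, hv, rfl⟩ := Submodule.mem_sup.1 hx
    rw [coeff_add, (mem_pow_idealOfVars_iff' 2 v).1 hv u hu, add_zero]
    exact mem_map_C_iff.1 hy u
  · intro hx
    rw [x.as_sum]
    refine Ideal.sum_mem _ fun u _ => ?_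
    by_cases hu : u.degree < 2
    · rw [← mul_one (coeff u x), ← C_mul_monomial]
      exact map_C_le_lowIdeal (Ideal.mul_mem_right _ _ (Ideal.mem_map_of_mem C (hx u hu)))
    · refine Ideal.mem_sup_right ((mem_pow_idealOfVars_iff' 2 _).2 fun v hv => ?_)
      rw [coeff_monomial, if_neg]
      rintro rfl
      exact hu hv

lemma smul_restrictScalars_le_lowIdeal {I : Ideal (MvPolynomial σ R)} (hI : I ≤ lowIdeal σ N') :
    N • I.restrictScalars R ≤ (lowIdeal σ (N * N')).restrictScalars R := by
  refine Submodule.smul_le.2 fun r hr x hx => mem_lowIdeal_iff.2 fun u hu => ?_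
  exact Ideal.mul_mem_mul hr (mem_lowIdeal_iff.1 (hI hx) u hu)

lemma mem_lowIdeal_mul_of_flat {I : Ideal (MvPolynomial σ R)}
    (hflat : Module.Flat R (MvPolynomial σ R ⧸ I)) (hI : I ≤ lowIdeal σ N') {x : MvPolynomial σ R}
    (hx : x ∈ I) (hN : x ∈ N.map C) : x ∈ lowIdeal σ (N * N') := by
  have : Module.Flat R (MvPolynomial σ R ⧸ I.restrictScalars R) :=
    .of_linearEquiv (Submodule.Quotient.restrictScalarsEquiv R I)
  refine smul_restrictScalars_le_lowIdeal hI (smul_top_inf_le_smul_of_flat N _ ⟨?_, hx⟩)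
  rw [Ideal.smul_top_eq_map]
  exact hN

lemma map_mem_lowIdeal {S : Type*} [CommRing S] (φ : R →+* S) {x : MvPolynomial σ R}
    (hx : x ∈ lowIdeal σ N) : map φ x ∈ lowIdeal σ (N.map φ) := by
  rw [mem_lowIdeal_iff] at hx ⊢
  intro u hu
  rw [coeff_map]
  exact Ideal.mem_map_of_mem _ (hx u hu)

lemma mem_map_C_of_mem_lowIdeal {x : MvPolynomial σ R} (hx : x ∈ lowIdeal σ N)
    (hlin : x.IsHomogeneous 1) : x ∈ N.map C := by
  refine mem_map_C_iff.2 fun u => ?_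
  by_cases hu : u.degree < 2
  · exact mem_lowIdeal_iff.1 hx u hu
  · rw [hlin.coeff_eq_zero (by omega)]
    exact zero_mem _

-- Multiplying by a linear form `p` only sees the constant coefficient of `x`.
lemma mul_add_C_sub_mem_lowIdeal {T : Ideal R} (hT : N * N' ≤ T) {x p : MvPolynomial σ R} {c : R}
    (hx : x ∈ N.map C) (hp : p.IsHomogeneous 1) (hc : c ∈ N') :
    x * (p + C c) - C (coeff 0 x) * p ∈ lowIdeal σ T := by
  have hconst : x - C (coeff 0 x) ∈ idealOfVars σ R := by
    refine (pow_one (idealOfVars σ R)) ▸ (mem_pow_idealOfVars_iff' 1 _).2 fun u hu => ?_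
    rw [(Finsupp.degree_eq_zero_iff u).1 (by omega), coeff_sub, coeff_zero_C, sub_self]
  have hquadratic : (x - C (coeff 0 x)) * p ∈ idealOfVars σ R ^ 2 :=
    pow_two (idealOfVars σ R) ▸ Ideal.mul_mem_mul hconst (mem_idealOfVars_of_isHomogeneous_one hp)
  have hsmall : x * C c ∈ T.map C := by
    refine Ideal.map_mono hT ?_
    rw [Ideal.map_mul]
    exact Ideal.mul_mem_mul hx (Ideal.mem_map_of_mem _ hc)
  convert add_mem (map_C_le_lowIdeal hsmall) (Ideal.mem_sup_right hquadratic) using 1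
  ring

end LowIdeal

lemma sum_mul_mul_eq_zero_of_alternating {R ι : Type*} [CommRing R] [Fintype ι] (p : ι → R)
    {φ : ι → ι → R} (hskew : ∀ α β, φ α β + φ β α = 0) (halt : ∀ α, φ α α = 0) :
    ∑ β, (∑ α, φ α β * p α) * p β = 0 := by
  simp_rw [Finset.sum_mul]
  rw [← Fintype.sum_prod_type_right (f := fun x : ι × ι => φ x.1 x.2 * p x.1 * p x.2)]
  refine Finset.sum_involution (fun x _ => x.swap) ?_ ?_ (fun _ _ => Finset.mem_univ _)
    fun _ _ => rfl
  · rintro ⟨α, β⟩ _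
    exact (by linear_combination p α * p β * hskew α β :
      φ α β * p α * p β + φ β α * p β * p α = 0)
  · rintro ⟨α, β⟩ _ hne heq
    obtain rfl : β = α := congrArg Prod.fst heq
    exact hne (by simp only [halt, zero_mul])

lemma exists_sub_mem_of_restrict_mk_eq {A σ : Type*} [CommRing A] {N : Ideal A}
    {I I' : Ideal (MvPolynomial σ A)}
    (h : restrict (Ideal.Quotient.mk N) I = restrict (Ideal.Quotient.mk N) I')
    {x : MvPolynomial σ A} (hx : x ∈ I') : ∃ y ∈ I, y - x ∈ N.map (C : A →+* MvPolynomial σ A) := by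
  have hx' : map (Ideal.Quotient.mk N) x ∈ restrict (Ideal.Quotient.mk N) I :=
    h ▸ Ideal.mem_map_of_mem _ hx
  obtain ⟨y, hy, hyx⟩ := (Ideal.mem_map_iff_of_surjective _
    (map_surjective _ Ideal.Quotient.mk_surjective)).1 hx'
  refine ⟨y, hy, ?_⟩
  rw [← Ideal.mk_ker (I := N), ← ker_map, RingHom.mem_ker, map_sub, hyx, sub_self]

namespace QuadricSystem

variable {K : Type*} [Field K] {k l : ℕ} {D : QuadricSystem K k l}

section Syzygies

variable {R : Type*} [CommRing R] [Algebra K R] {n : Fin l} {m : ℕ} (hm : m < D.b n)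

include hm

lemma eq_zero_of_C_mul_eqn_add_eq_zero {a c : K}
    (h : C a * D.eqn n m + C c * D.eqn n (m + 1) = 0) : a = 0 ∧ c = 0 := by
  have hcox := congrArg (toCox K D.d) h
  simp only [map_zero, map_add, map_mul, D.toCox_eqn n m hm.le, D.toCox_eqn n (m + 1) hm,
    algHom_C, algebraMap_eq] at hcox
  have hfactor : (X (sVar k) ^ (D.b n - (m + 1)) * X (tVar k) ^ m * D.P n) *
      (C a * X (sVar k) + C c * X (tVar k)) = 0 := by
    rw [← hcox, show D.b n - m = D.b n - (m + 1) + 1 by omega]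
    ring
  have hline : (C a * X (sVar k) + C c * X (tVar k) : MvPolynomial (CoxVar k) K) = 0 :=
    (mul_eq_zero.1 hfactor).resolve_left <| mul_ne_zero
      (mul_ne_zero (pow_ne_zero _ (X_ne_zero _)) (pow_ne_zero _ (X_ne_zero _)))
      (IsCompleteIntersection.ne_zero D.isDivisorEquation D.isCompleteIntersection n)
  have hst : sVar k ≠ tVar k := by simp [sVar, tVar]
  constructor
  · simpa [hst.symm] using congrArg (eval (Pi.single (sVar k) 1)) hline
  · simpa [hst] using congrArg (eval (Pi.single (tVar k) 1)) hline

lemma eq_zero_of_C_mul_eqnOver_add_eq_zero {a c : R}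
    (h : C a * D.eqnOver R n m + C c * D.eqnOver R n (m + 1) = 0) : a = 0 ∧ c = 0 := by
  have hdual (lam : R →ₗ[K] K) : lam a = 0 ∧ lam c = 0 := by
    have hlam := congrArg (mapCoeff (ZVar D.d) lam) h
    rw [map_add, mapCoeff_mul_map, mapCoeff_mul_map, mapCoeff_C, mapCoeff_C, map_zero] at hlam
    exact eq_zero_of_C_mul_eqn_add_eq_zero hm hlam
  exact ⟨(Module.forall_dual_apply_eq_zero_iff K a).1 fun lam => (hdual lam).1,
    (Module.forall_dual_apply_eq_zero_iff K c).1 fun lam => (hdual lam).2⟩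

lemma eq_zero_of_alternating_roll {a c : R} {φ : Col D.d → Col D.d → R}
    (hskew : ∀ α β, φ α β + φ β α = 0) (halt : ∀ α, φ α α = 0)
    (h : ∀ β : Col D.d, C a * X β.top + C c * X β.bot =
      ∑ α, C (φ α β) * map (algebraMap K R) (D.roll n m α)) : a = 0 ∧ c = 0 := by
  refine eq_zero_of_C_mul_eqnOver_add_eq_zero hm ?_
  have hzero := sum_mul_mul_eq_zero_of_alternating
    (fun α => map (algebraMap K R) (D.roll n m α)) (φ := fun α β => C (φ α β))
    (fun α β => by rw [← C_add, hskew, C_0]) (fun α => by rw [halt, C_0])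
  simp only [← h] at hzero
  rw [eqnOver, eqnOver, D.eqn_eq n m hm, D.eqn_succ n m hm, map_sum, map_sum, Finset.mul_sum,
    Finset.mul_sum, ← Finset.sum_add_distrib, ← hzero]
  refine Finset.sum_congr rfl fun β _ => ?_
  rw [map_mul, map_mul, map_X, map_X]
  ring

end Syzygies

end QuadricSystem

/-! ### The obstruction -/

namespace QuadricSystem

variable {K : Type*} [Field K] {k l : ℕ} {D : QuadricSystem K k l}

namespace FirstOrderLift

variable {F : D.FirstOrderLift} {J : Ideal D.Base} {I : Ideal (MvPolynomial (ZVar D.d) D.Base)}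

lemma deformedMinor_mem_lowIdeal (α β : Col D.d) :
    D.deformedMinor α β ∈ lowIdeal (ZVar D.d) D.originIdeal := by
  have hzeta (z : ZVar D.d) : C (D.zetaPt z) ∈ D.originIdeal.map
      (C : D.Base →+* MvPolynomial (ZVar D.d) D.Base) :=
    Ideal.mem_map_of_mem _ (mem_idealOfVars_of_isHomogeneous_one (zetaPt_isHomogeneous z))
  have hdecomp : D.deformedMinor α β = (X α.top * X β.bot - X α.bot * X β.top) +
      (X α.top * C (D.zetaPt β.bot) - C (D.zetaPt α.bot) * X β.top) := by
    rw [deformedMinor]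
    ring
  rw [hdecomp]
  exact add_mem
    (mem_lowIdeal_of_isHomogeneous_two (((isHomogeneous_X _ _).mul (isHomogeneous_X _ _)).sub
      ((isHomogeneous_X _ _).mul (isHomogeneous_X _ _))))
    (map_C_le_lowIdeal (sub_mem (Ideal.mul_mem_left _ _ (hzeta _))
      (Ideal.mul_mem_right _ _ (hzeta _))))

variable (F) in
lemma equation_mem_lowIdeal {n : Fin l} {m : ℕ} (hm : m ≤ D.b n) :
    F.equation n m ∈ lowIdeal (ZVar D.d) D.originIdeal :=
  add_mem (mem_lowIdeal_of_isHomogeneous_two ((D.eqn_homogeneous n m hm).map _))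
    (map_C_le_lowIdeal (mem_map_C_iff.2 fun u =>
      mem_idealOfVars_of_isHomogeneous_one (F.coeff_pert_isHomogeneous n m u)))

lemma equations_le_lowIdeal : F.equations ≤ lowIdeal (ZVar D.d) D.originIdeal := by
  rw [equations, Ideal.span_le]
  rintro _ (⟨α, β, rfl⟩ | ⟨n, m, hm, rfl⟩)
  · exact deformedMinor_mem_lowIdeal α β
  · exact F.equation_mem_lowIdeal hm

lemma IsExtension.le_lowIdeal (h : F.IsExtension J I) :
    I ≤ lowIdeal (ZVar D.d) D.originIdeal := by
  intro x hx
  obtain ⟨y, hy, hyx⟩ := exists_sub_mem_of_restrict_mk_eq h.first_order.symm hx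
  simpa only [sub_sub_cancel] using sub_mem (equations_le_lowIdeal hy)
    (map_C_le_lowIdeal (Ideal.map_mono firstOrderIdeal_le_originIdeal hyx))

-- Flatness: elements of `I` with second order coefficients are combinations of elements of `I`
-- with second order coefficients, and the elements of `I` have first order low degree terms.
lemma IsExtension.mem_lowIdeal (h : F.IsExtension J I) {x : MvPolynomial (ZVar D.d) D.Base}
    (hx : x ∈ I ⊔ J.map C) (hsmall : x ∈ D.firstOrderIdeal.map C) :
    x ∈ lowIdeal (ZVar D.d) (J ⊔ D.originIdeal ^ 3) := by
  set π := Ideal.Quotient.mk J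
  have hmem : map π x ∈ restrict π I := by
    obtain ⟨y, hy, z, hz, rfl⟩ := Submodule.mem_sup.1 hx
    rw [map_add, map_mk_eq_zero_of_mem_map_C hz, add_zero]
    exact Ideal.mem_map_of_mem _ hy
  have hcoeff : map π x ∈ ((D.originIdeal ^ 2).map π).map C := by
    rw [mem_map_C_iff] at hsmall ⊢
    intro u
    obtain ⟨y, hy, z, hz, hyz⟩ := Submodule.mem_sup.1 (hsmall u)
    rw [coeff_map, ← hyz, map_add, Ideal.Quotient.eq_zero_iff_mem.2 (h.lifting_le hy), zero_add]
    exact Ideal.mem_map_of_mem _ hz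
  have hlow : restrict π I ≤ lowIdeal (ZVar D.d) (D.originIdeal.map π) :=
    Ideal.map_le_iff_le_comap.2 fun y hy => map_mem_lowIdeal π (h.le_lowIdeal hy)
  have hcubic := mem_lowIdeal_mul_of_flat h.flat hlow hmem hcoeff
  rw [← Ideal.map_mul, ← pow_succ, mem_lowIdeal_iff] at hcubic
  refine mem_lowIdeal_iff.2 fun u hu => ?_
  rw [sup_comm, ← Ideal.mem_quotient_iff_mem_sup, ← coeff_map]
  exact hcubic u hu

lemma IsExtension.coeff_zero_mem (h : F.IsExtension J I) {x : MvPolynomial (ZVar D.d) D.Base}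
    (hx : x ∈ I) (hsmall : x ∈ D.firstOrderIdeal.map C) :
    coeff 0 x ∈ J ⊔ D.originIdeal ^ 3 :=
  mem_lowIdeal_iff.1 (h.mem_lowIdeal (Ideal.mem_sup_left hx) hsmall) 0 (by simp)

lemma IsExtension.firstOrderIdeal_mul_originIdeal_le (h : F.IsExtension J I) :
    D.firstOrderIdeal * D.originIdeal ≤ J ⊔ D.originIdeal ^ 3 := by
  rw [Ideal.sup_mul, ← pow_succ]
  exact sup_le_sup_right (Ideal.mul_le_left.trans h.lifting_le) _

variable (F I) in
/-- Elements of the ideal `I` which lift the equations of the infinitesimal deformation. -/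
structure LiftedEquations where
  /-- the lift of the minor in the columns `α, β` of the deformed scroll matrix -/
  minor : Col D.d → Col D.d → MvPolynomial (ZVar D.d) D.Base
  /-- the lift of `P^(n)_m + P'^(n)_m` -/
  eqn : Fin l → ℕ → MvPolynomial (ZVar D.d) D.Base
  minor_mem : ∀ α β, minor α β ∈ I
  minor_sub_mem : ∀ α β, minor α β - D.deformedMinor α β ∈ D.firstOrderIdeal.map C
  eqn_mem : ∀ n m, m ≤ D.b n → eqn n m ∈ I
  eqn_sub_mem : ∀ n m, m ≤ D.b n → eqn n m - F.equation n m ∈ D.firstOrderIdeal.map C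

lemma IsExtension.nonempty_liftedEquations (h : F.IsExtension J I) :
    Nonempty (F.LiftedEquations I) := by
  have hminor (α β : Col D.d) :
      ∃ y ∈ I, y - D.deformedMinor α β ∈ D.firstOrderIdeal.map C :=
    exists_sub_mem_of_restrict_mk_eq h.first_order (Ideal.subset_span (Or.inl ⟨α, β, rfl⟩))
  have heqn (n : Fin l) (m : ℕ) : ∃ y, m ≤ D.b n →
      y ∈ I ∧ y - F.equation n m ∈ D.firstOrderIdeal.map C := by
    by_cases hm : m ≤ D.b n
    · obtain ⟨y, hy⟩ := exists_sub_mem_of_restrict_mk_eq h.first_order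
        (Ideal.subset_span (Or.inr ⟨n, m, hm, rfl⟩))
      exact ⟨y, fun _ => hy⟩
    · exact ⟨0, fun hm' => absurd hm' hm⟩
  choose minor minor_mem minor_sub_mem using hminor
  choose eqn eqn_mem using heqn
  exact ⟨⟨minor, eqn, minor_mem, minor_sub_mem, fun n m hm => (eqn_mem n m hm).1,
    fun n m hm => (eqn_mem n m hm).2⟩⟩

namespace LiftedEquations

variable (L : F.LiftedEquations I)

/-- The constant term of the second order correction of a minor. -/
def minorConst (α β : Col D.d) : D.Base := coeff 0 (L.minor α β - D.deformedMinor α β)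

/-- The constant term of the second order correction of `P^(n)_m + P'^(n)_m`. -/
def eqnConst (n : Fin l) (m : ℕ) : D.Base := coeff 0 (L.eqn n m - F.equation n m)

variable (h : F.IsExtension J I)

include h

lemma minorConst_self_mem (α : Col D.d) : L.minorConst α α ∈ J ⊔ D.originIdeal ^ 3 := by
  refine h.coeff_zero_mem ?_ (L.minor_sub_mem α α)
  convert L.minor_mem α α using 1
  rw [deformedMinor]
  ring

lemma minorConst_add_swap_mem (α β : Col D.d) :
    L.minorConst α β + L.minorConst β α ∈ J ⊔ D.originIdeal ^ 3 := by
  rw [minorConst, minorConst, ← coeff_add]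
  refine h.coeff_zero_mem ?_ (add_mem (L.minor_sub_mem α β) (L.minor_sub_mem β α))
  convert add_mem (L.minor_mem α β) (L.minor_mem β α) using 1
  rw [deformedMinor, deformedMinor]
  ring

variable {n : Fin l} {m : ℕ} (hm : m < D.b n)

include hm

lemma rolled_correction_mem_lowIdeal (β : Col D.d) :
    (L.eqn n m - F.equation n m) * (X β.bot + C (D.zetaPt β.bot)) -
      (L.eqn n (m + 1) - F.equation n (m + 1)) * X β.top -
      ∑ α, (L.minor α β - D.deformedMinor α β) *
        (map C (D.roll n m α) + C (F.pertRoll n m α)) +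
      C (F.baseEquation n (m + 1)) * X β.top ∈
      lowIdeal (ZVar D.d) (J ⊔ D.originIdeal ^ 3) := by
  refine h.mem_lowIdeal ?_ ?_
  · have hlifted : L.eqn n m * (X β.bot + C (D.zetaPt β.bot)) - L.eqn n (m + 1) * X β.top -
        ∑ α, L.minor α β * (map C (D.roll n m α) + C (F.pertRoll n m α)) ∈ I :=
      sub_mem (sub_mem (Ideal.mul_mem_right _ _ (L.eqn_mem n m hm.le))
        (Ideal.mul_mem_right _ _ (L.eqn_mem n (m + 1) hm)))
        (Ideal.sum_mem _ fun α _ => Ideal.mul_mem_right _ _ (L.minor_mem α β))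
    convert sub_mem (Ideal.mem_sup_left hlifted)
      (Ideal.mem_sup_right (Ideal.map_mono h.lifting_le (F.roll_mem hm β))) using 1
    simp only [sub_mul, Finset.sum_sub_distrib, mul_comm (D.deformedMinor _ β)]
    ring
  · exact add_mem (sub_mem
      (sub_mem (Ideal.mul_mem_right _ _ (L.eqn_sub_mem n m hm.le))
        (Ideal.mul_mem_right _ _ (L.eqn_sub_mem n (m + 1) hm)))
      (Ideal.sum_mem _ fun α _ => Ideal.mul_mem_right _ _ (L.minor_sub_mem α β)))
      (Ideal.mul_mem_right _ _ (Ideal.mem_map_of_mem _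
        (Ideal.mem_sup_right (F.baseEquation_mem_originIdeal_sq hm))))

lemma linear_relation_mem (β : Col D.d) :
    C (F.baseEquation n (m + 1) - L.eqnConst n (m + 1)) * X β.top +
      C (L.eqnConst n m) * X β.bot -
      ∑ α, C (L.minorConst α β) * map C (D.roll n m α) ∈
      (J ⊔ D.originIdeal ^ 3).map (C : D.Base →+* MvPolynomial (ZVar D.d) D.Base) := by
  have hroll (α : Col D.d) :
      (map C (D.roll n m α) : MvPolynomial (ZVar D.d) D.Base).IsHomogeneous 1 :=
    (D.roll_homogeneous n m α hm).map _
  refine mem_map_C_of_mem_lowIdeal ?_ ?_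
  · have hT := h.firstOrderIdeal_mul_originIdeal_le
    have heqn := mul_add_C_sub_mem_lowIdeal hT (L.eqn_sub_mem n m hm.le) (isHomogeneous_X _ β.bot)
      (mem_idealOfVars_of_isHomogeneous_one (zetaPt_isHomogeneous β.bot))
    have heqn_succ := mul_add_C_sub_mem_lowIdeal hT (L.eqn_sub_mem n (m + 1) hm)
      (isHomogeneous_X _ β.top) (zero_mem D.originIdeal)
    have hminors := Ideal.sum_mem _ fun α (_ : α ∈ Finset.univ) => mul_add_C_sub_mem_lowIdeal hT
      (L.minor_sub_mem α β) (hroll α)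
      (mem_idealOfVars_of_isHomogeneous_one (F.coeff_pert_isHomogeneous n m (.single α.top 1)))
    convert add_mem (add_mem (sub_mem (L.rolled_correction_mem_lowIdeal h hm β) heqn) heqn_succ)
      hminors using 1
    simp only [Finset.sum_sub_distrib, C_sub, C_0, add_zero, minorConst, eqnConst, pertRoll]
    ring
  · exact (((isHomogeneous_X _ _).C_mul _).add ((isHomogeneous_X _ _).C_mul _)).sub
      (.sum _ _ _ fun α _ => (hroll α).C_mul _)

lemma baseEquation_sub_eqnConst_mem_and_eqnConst_mem :
    F.baseEquation n (m + 1) - L.eqnConst n (m + 1) ∈ J ⊔ D.originIdeal ^ 3 ∧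
      L.eqnConst n m ∈ J ⊔ D.originIdeal ^ 3 := by
  simp only [← Ideal.Quotient.eq_zero_iff_mem]
  refine eq_zero_of_alternating_roll hm
    (φ := fun α β => Ideal.Quotient.mk _ (L.minorConst α β)) ?_ ?_ ?_
  · intro α β
    rw [← map_add]
    exact Ideal.Quotient.eq_zero_iff_mem.2 (L.minorConst_add_swap_mem h α β)
  · exact fun α => Ideal.Quotient.eq_zero_iff_mem.2 (L.minorConst_self_mem h α)
  · intro β
    have hrelation := map_mk_eq_zero_of_mem_map_C (L.linear_relation_mem h hm β)
    rw [map_sub, map_sum, sub_eq_zero] at hrelation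
    simp only [map_add, map_mul, map_C, map_X, map_map] at hrelation
    exact hrelation

end LiftedEquations

theorem IsExtension.baseIdeal_le (h : F.IsExtension J I) :
    F.baseIdeal ≤ J ⊔ D.originIdeal ^ 3 := by
  obtain ⟨L⟩ := h.nonempty_liftedEquations
  refine sup_le (h.lifting_le.trans le_sup_left) (Ideal.span_le.2 ?_)
  rintro _ ⟨n, m, hm, hm', rfl⟩
  obtain ⟨m, rfl⟩ := Nat.exists_eq_add_of_le' hm
  have hdiff := (L.baseEquation_sub_eqnConst_mem_and_eqnConst_mem h (n := n) (m := m)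
    (by omega)).1
  have hconst := (L.baseEquation_sub_eqnConst_mem_and_eqnConst_mem h (n := n) (m := m + 1)
    (by omega)).2
  simpa only [sub_add_cancel, SetLike.mem_coe] using add_mem hdiff hconst

theorem IsExtension.baseIdeal_le_of_homogeneous (h : F.IsExtension J I) (hJ : BaseHomogeneous J) :
    F.baseIdeal ≤ J := by
  refine sup_le h.lifting_le (Ideal.span_le.2 ?_)
  rintro _ ⟨n, m, hm, hm', rfl⟩
  obtain ⟨y, hy, v, hv, hyv⟩ :=
    Submodule.mem_sup.1 (h.baseIdeal_le (F.baseEquation_mem_baseIdeal hm hm'))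
  have hcomponent : homogeneousComponent 2 y = F.baseEquation n m := by
    have := congrArg (homogeneousComponent 2) hyv
    rwa [map_add, homogeneousComponent_eq_zero_of_mem_idealOfVars_pow hv (by omega), add_zero,
      homogeneousComponent_of_mem (F.baseEquation_isHomogeneous (by omega)), if_pos rfl] at this
  rw [SetLike.mem_coe, ← hcomponent, ← decomposition.decompose'_apply]
  let _ := MvPolynomial.gradedAlgebra (σ := D.ZetaIdx ⊕ D.RhoIdx) (R := K)
  exact hJ 2 hy

end FirstOrderLift

end QuadricSystem

end RollingFactors

end

open RollingFactors QuadricSystem in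
/-- The ideal of the lifting conditions and the base equations is the smallest homogeneous ideal
over whose quotient the infinitesimal deformation extends to a graded flat family; and any extension
whatsoever (graded or not) satisfies the base equations up to terms of order three. -/
theorem proposition3p2 {K : Type*} [Field K] {k l : ℕ} (D : QuadricSystem K k l)
    (F : D.FirstOrderLift) :
    IsLeast {J : Ideal D.Base | BaseHomogeneous J ∧
      ∃ I : Ideal (MvPolynomial (ZVar D.d) D.Base), FamilyHomogeneous I ∧ F.IsExtension J I}
      F.baseIdeal ∧
    ∀ (J : Ideal D.Base) (I : Ideal (MvPolynomial (ZVar D.d) D.Base)),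
      F.IsExtension J I → F.baseIdeal ≤ J ⊔ D.originIdeal ^ 3 :=
  ⟨⟨⟨F.baseHomogeneous_baseIdeal, F.extIdeal, F.familyHomogeneous_extIdeal,
    F.isExtension_extIdeal⟩, fun _ ⟨hJ, _, _, h⟩ => h.baseIdeal_le_of_homogeneous hJ⟩,
    fun _ _ h => h.baseIdeal_le⟩
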